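/- Let a three-web $W(3,2,2)$ of codimension two be given on an open set $U$ of a four-dimensional real space: three smooth foliations $\lambda_\xi$, $\xi=1,2,3$, of codimension two, in general position, given by $\underset{\xi}{\omega}{}^{1}=\underset{\xi}{\omega}{}^{2}=0$, where $\underset{1}{\omega}{}^{i},\underset{2}{\omega}{}^{i}$ ($i=1,2$) are smooth and form a coframe and $\underset{1}{\omega}{}^{i}+\underset{2}{\omega}{}^{i}+\underset{3}{\omega}{}^{i}=0$. Let the connection forms $\omega_j^i$, the covector $a=(a_1,a_2)$ and the curvature tensor $b^i_{jkl}$ of the web be determined by the structure equations (summation over repeated indices among $j,k,l$) $$d\underset{1}{\omega}{}^{i}=\underset{1}{\omega}{}^{j}\wedge\omega_j^i+a_j\,\underset{1}{\omega}{}^{j}\wedge\underset{1}{\omega}{}^{i},\qquad d\underset{2}{\omega}{}^{i}=\underset{2}{\omega}{}^{j}\wedge\omega_j^i-a_j\,\underset{2}{\omega}{}^{j}\wedge\underset{2}{\omega}{}^{i},$$ $$d\omega_j^i-\omega_j^k\wedge\omega_k^i=b^i_{jkl}\,\underset{1}{\omega}{}^{k}\wedge\underset{2}{\omega}{}^{l}$$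 Assume that $a\neq0$ at every point, and let $\Delta$ be the transversal $a$-distribution, i.e. the two-dimensional distribution $a_1\underset{\alpha}{\omega}{}^{1}+a_2\underset{\alpha}{\omega}{}^{2}=0$, $\alpha=1,2$. Suppose that, throughout $U$, one of the following conditions holds: (1) $a_2=0$ and the connection form $\omega_2^1$ vanishes; (2) $a_1=0$ and the connection form $\omega_1^2$ vanishes; (3) $a_1=a_2$ and the connection forms satisfy $\omega_1^1+\omega_1^2=\omega_2^1+\omega_2^2$. Then $\Delta$ is the distribution defined by the equations $\underset{\alpha}{\omega}{}^{1}=0$, or $\underset{\alpha}{\omega}{}^{2}=0$, or $\underset{\alpha}{\omega}{}^{1}+\underset{\alpha}{\omega}{}^{2}=0$ ($\alpha=1,2$), respectively, and $\Delta$ is integrable: an integral surface passes through every point of $U$. Moreover, the web is foliated into hexagonal two-dimensional webs $W(3,2,1)$ on the integral surfaces of $\Delta$ (that is, on every integral surface the foliations $\lambda_\xi$ cut a planar three-web all of whose sufficiently small hexagonal figures close) if and only if, throughout $U$, respectively, (1) $b^1_{222}=b^2_{222}=0$; (2) $b^1_{111}=b^2_{111}=0$; (3) $-b^i_{111}+3\bigl(b^i_{(112)}-b^i_{(122)}\bigr)+b^i_{222}=0$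 for $i=1,2$, where $b^i_{(jkl)}$ is the average of $b^i_{jkl}$ over the six permutations of the lower indices. -/

import Mathlib

open scoped ContDiff Topology

/-- A (not necessarily continuous) differential 1-form on the normed space `E`. -/
abbrev OneForm (E : Type*) [NormedAddCommGroup E] [NormedSpace ℝ E] : Type _ :=
  E → (E →L[ℝ] ℝ)

namespace OneForm

/-- The exterior derivative `dη` of a 1-form, as a function of a point and two vectors:
`dη (v, w) = (D_v η) w - (D_w η) v` wherever `η` is differentiable. -/
noncomputable def d {E : Type*} [NormedAddCommGroup E] [NormedSpace ℝ E]
    (η : OneForm E) (x v w : E) : ℝ :=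
  extDeriv (fun y => ContinuousAlternatingMap.ofSubsingleton ℝ E ℝ (0 : Fin 1) (η y)) x ![v, w]

/-- The exterior product `η ∧ ζ` of two 1-forms. -/
def wedge {E : Type*} [NormedAddCommGroup E] [NormedSpace ℝ E]
    (η ζ : OneForm E) (x v w : E) : ℝ :=
  η x v * ζ x w - η x w * ζ x v

end OneForm

/-- `u : N → ℝ²` is a smooth first integral, on the set `N`, of the Pfaffian system
`η¹ = η² = 0`: the kernel of the differential of `u` is the space of solutions of the system.
If `η¹, η²` are independent then `u` is a submersion and its level sets are the
leaves (in `N`) of a foliation of codimension two. -/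
def IsFirstIntegral {E : Type*} [NormedAddCommGroup E] [NormedSpace ℝ E]
    (η : Fin 2 → OneForm E) (N : Set E) (u : E → Fin 2 → ℝ) : Prop :=
  ContDiffOn ℝ ∞ u N ∧ ∀ x ∈ N, ∀ v : E, fderiv ℝ u x v = 0 ↔ ∀ i, η i x v = 0

/-- A three-web of codimension two on the open set `U` (of a 4-dimensional space), together with
an adapted coframe: the foliation `λ_ξ` is given by `ω_ξ¹ = ω_ξ² = 0`, the three pairs of forms
are normalized by `ω_1^i + ω_2^i + ω_3^i = 0`, and `ω_1¹, ω_1², ω_2¹, ω_2²` is a coframe (so the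
foliations are in general position).  Indices start at `0`: `form ξ i` is `ω_{ξ+1}^{i+1}`. -/
structure ThreeWeb {E : Type*} [NormedAddCommGroup E] [NormedSpace ℝ E] (U : Set E) where
  /-- the forms of the adapted coframe -/
  form : Fin 3 → Fin 2 → OneForm E
  smooth : ∀ ξ i, ContDiffOn ℝ ∞ (form ξ i) U
  sum_eq_zero : ∀ i, ∀ x ∈ U, form 0 i x + form 1 i x + form 2 i x = 0
  coframe : ∀ x ∈ U, LinearIndependent ℝ (fun p : Fin 2 × Fin 2 => form p.1.castSucc p.2 x)
  /-- each system `ω_ξ¹ = ω_ξ² = 0` defines a foliation: it has local first integrals -/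
  foliation : ∀ ξ, ∀ x ∈ U, ∃ N : Set E, IsOpen N ∧ x ∈ N ∧ N ⊆ U ∧
    ∃ u : E → Fin 2 → ℝ, IsFirstIntegral (form ξ) N u

namespace ThreeWeb

/-- The structure equations of the web
`dω_1^i = ω_1^j ∧ ω_j^i + a_j ω_1^j ∧ ω_1^i`, `dω_2^i = ω_2^j ∧ ω_j^i - a_j ω_2^j ∧ ω_2^i`.
They determine the connection forms `ω_j^i = θ j i` and the torsion covector `a = (a_1, a_2)`
uniquely. -/
def IsConnection {E : Type*} [NormedAddCommGroup E] [NormedSpace ℝ E] {U : Set E}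
    (W : ThreeWeb U) (θ : Fin 2 → Fin 2 → OneForm E) (a : Fin 2 → E → ℝ) : Prop :=
  (∀ j i, ContDiffOn ℝ ∞ (θ j i) U) ∧ (∀ j, ContDiffOn ℝ ∞ (a j) U) ∧
  ∀ x ∈ U, ∀ v w : E, ∀ i,
    (W.form 0 i).d x v w =
      (∑ j, (W.form 0 j).wedge (θ j i) x v w) + ∑ j, a j x * (W.form 0 j).wedge (W.form 0 i) x v w ∧
    (W.form 1 i).d x v w =
      (∑ j, (W.form 1 j).wedge (θ j i) x v w) - ∑ j, a j x * (W.form 1 j).wedge (W.form 1 i) x v w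

/-- The functions `b i j k l = b^i_{jkl}` are the components of the curvature tensor, i.e. the
coefficients in `dω_j^i - ω_j^k ∧ ω_k^i = b^i_{jkl} ω_1^k ∧ ω_2^l`. -/
def IsCurvature {E : Type*} [NormedAddCommGroup E] [NormedSpace ℝ E] {U : Set E}
    (W : ThreeWeb U) (θ : Fin 2 → Fin 2 → OneForm E)
    (b : Fin 2 → Fin 2 → Fin 2 → Fin 2 → E → ℝ) : Prop :=
  ∀ x ∈ U, ∀ v w : E, ∀ i j,
    (θ j i).d x v w - ∑ k, (θ j k).wedge (θ k i) x v w =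
      ∑ k, ∑ l, b i j k l x * (W.form 0 k).wedge (W.form 1 l) x v w

/-- The transversal distribution `c_1 ω_α¹ + c_2 ω_α² = 0`, `α = 1, 2`, at the point `x`. -/
def transversal {E : Type*} [NormedAddCommGroup E] [NormedSpace ℝ E] {U : Set E}
    (W : ThreeWeb U) (c : Fin 2 → ℝ) (x : E) : Submodule ℝ E :=
  ⨅ α : Fin 2, LinearMap.ker ((∑ j, c j • W.form α.castSucc j x : E →L[ℝ] ℝ) : E →ₗ[ℝ] ℝ)

/-- The transversal `a`-distribution `Δ`: `a_1 ω_α¹ + a_2 ω_α² = 0`, `α = 1, 2`. -/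
def aDistribution {E : Type*} [NormedAddCommGroup E] [NormedSpace ℝ E] {U : Set E}
    (W : ThreeWeb U) (a : Fin 2 → E → ℝ) (x : E) : Submodule ℝ E :=
  W.transversal (fun j => a j x) x

end ThreeWeb

/-- `φ : V → U`, with `V` open in `ℝ²`, is a smooth parametrized integral surface of the
two-dimensional distribution `D` on `U`: its tangent plane at each point is the plane of `D`
(so `φ` is an immersion). -/
structure IsIntegralSurface {E : Type*} [NormedAddCommGroup E] [NormedSpace ℝ E]
    (U : Set E) (D : E → Submodule ℝ E)
    (V : Set (EuclideanSpace ℝ (Fin 2))) (φ : EuclideanSpace ℝ (Fin 2) → E) : Prop where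
  isOpen : IsOpen V
  mapsTo : Set.MapsTo φ V U
  smooth : ContDiffOn ℝ ∞ φ V
  tangent : ∀ s ∈ V,
    LinearMap.range (fderiv ℝ φ s : EuclideanSpace ℝ (Fin 2) →ₗ[ℝ] E) = D (φ s) ∧
      Module.finrank ℝ (D (φ s)) = 2

/-- The two-dimensional distribution `D` is integrable on `U`: an integral surface passes through
every point of `U`. -/
def IsIntegrableDistribution {E : Type*} [NormedAddCommGroup E] [NormedSpace ℝ E]
    (U : Set E) (D : E → Submodule ℝ E) : Prop :=
  ∀ x ∈ U, ∃ (V : Set (EuclideanSpace ℝ (Fin 2))) (φ : EuclideanSpace ℝ (Fin 2) → E),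
    IsIntegralSurface U D V φ ∧ x ∈ φ '' V

/-- The level sets of the three maps `f ξ` form a two-dimensional three-web `W(3, 2, 1)` on the
open set `N` of the plane: the kernels of the differentials are lines, pairwise transversal. -/
def IsPlanarThreeWeb (f : Fin 3 → EuclideanSpace ℝ (Fin 2) → Fin 2 → ℝ)
    (N : Set (EuclideanSpace ℝ (Fin 2))) : Prop :=
  (∀ ξ, ContDiffOn ℝ ∞ (f ξ) N) ∧
  ∀ s ∈ N, ∀ ξ,
    Module.finrank ℝ
      (LinearMap.ker (fderiv ℝ (f ξ) s : EuclideanSpace ℝ (Fin 2) →ₗ[ℝ] (Fin 2 → ℝ))) = 1 ∧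
    ∀ ζ, ζ ≠ ξ → ∀ v, fderiv ℝ (f ξ) s v = 0 → fderiv ℝ (f ζ) s v = 0 → v = 0

/-- All hexagonal figures in `N` formed by lines `f ξ = const` close.  Through a point `p` draw the
line of each family; start at `A 0` on the first of these lines and go round `p`, moving along
lines of the families 2, 1, 3, 2, 1, 3 in turn, with vertices `A 1, ..., A 5` on the third,
second, first, third, second line through `p`; closure means that the last line (of family 3)
through `A 5` returns to `A 0`. -/
def HexagonsClose {X Y : Type*} (f : Fin 3 → X → Y) (N : Set X) : Prop :=
  ∀ p ∈ N, ∀ A : Fin 6 → X, (∀ k, A k ∈ N) →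
    f 0 (A 0) = f 0 p → f 2 (A 1) = f 2 p → f 1 (A 2) = f 1 p →
    f 0 (A 3) = f 0 p → f 2 (A 4) = f 2 p → f 1 (A 5) = f 1 p →
    f 1 (A 0) = f 1 (A 1) → f 0 (A 1) = f 0 (A 2) → f 2 (A 2) = f 2 (A 3) →
    f 1 (A 3) = f 1 (A 4) → f 0 (A 4) = f 0 (A 5) →
    f 2 (A 5) = f 2 (A 0)

namespace ThreeWeb

/-- The foliations of the web `W` cut a hexagonal two-dimensional three-web on the parametrized
surface `φ : V → U`: near each point of the surface the lines cut by `λ_ξ`, i.e. the level curves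
of the restriction of a first integral of `λ_ξ`, form a three-web `W(3, 2, 1)`, and all
sufficiently small hexagonal figures close. -/
def CutsHexagonalWeb {E : Type*} [NormedAddCommGroup E] [NormedSpace ℝ E] {U : Set E}
    (W : ThreeWeb U) (V : Set (EuclideanSpace ℝ (Fin 2)))
    (φ : EuclideanSpace ℝ (Fin 2) → E) : Prop :=
  ∀ s ∈ V, ∃ (N : Set (EuclideanSpace ℝ (Fin 2))) (O : Set E) (u : Fin 3 → E → Fin 2 → ℝ),
    IsOpen N ∧ s ∈ N ∧ N ⊆ V ∧ IsOpen O ∧ O ⊆ U ∧ Set.MapsTo φ N O ∧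
    (∀ ξ, IsFirstIntegral (W.form ξ) O (u ξ)) ∧
    IsPlanarThreeWeb (fun ξ => u ξ ∘ φ) N ∧
    HexagonsClose (fun ξ => u ξ ∘ φ) N

/-- The web is foliated into hexagonal two-dimensional webs `W(3, 2, 1)` on the integral surfaces
of the distribution `D`: integral surfaces pass through all points of `U`, and the web cut on each
of them is hexagonal. -/
def FoliatedIntoHexagonalWebs {E : Type*} [NormedAddCommGroup E] [NormedSpace ℝ E] {U : Set E}
    (W : ThreeWeb U) (D : E → Submodule ℝ E) : Prop :=
  IsIntegrableDistribution U D ∧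
  ∀ (V : Set (EuclideanSpace ℝ (Fin 2))) (φ : EuclideanSpace ℝ (Fin 2) → E),
    IsIntegralSurface U D V φ → W.CutsHexagonalWeb V φ

end ThreeWeb

/-- The symmetrization `b^i_{(jkl)}` in the three lower indices. -/
noncomputable def symLower {E : Type*} (b : Fin 2 → Fin 2 → Fin 2 → Fin 2 → E → ℝ)
    (i j k l : Fin 2) (x : E) : ℝ :=
  (b i j k l x + b i k l j x + b i l j k x + b i k j l x + b i j l k x + b i l k j x) / 6

/-! The three cases are instances of one statement. Fix a constant vector `e` in ℝ² and let Δ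
consist of the vectors on which ω_1 and ω_2 are both proportional to `e`. The assumption on the
connection forms says that e^j ω_j^i is proportional to e^i, so the direction `e` is parallel; the
three cases are e = (0, 1), (-1, 0) and (-1, 1). A constant covector `d` with d_i e^i = 1 measures
components along `e`.

Integrability: the conormal form e^2 ω_α^1 - e^1 ω_α^2 satisfies a linear homogeneous ODE along the
leaves of λ_α (`d_conormal`), so its kernel descends to a line field on the local leaf space, which
is a plane. In the product coordinates given by the first integrals of λ_1 and λ_2, a product of one
integral curve from each leaf space is an integral surface of Δ.

Curvature: on an integral surface every ω_ξ equals e σ_ξ with a scalar form σ_ξ. The torsion terms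
a_j ω_α^j ∧ ω_α^i vanish there, so dσ_α = σ_α ∧ Θ for the single form Θ = d_i e^j ω_j^i. Hence Θ is
the connection of the planar web, and its curvature is K = d_i b^i_{jkl} e^j e^k e^l, through dΘ = K
σ_1 ∧ σ_2. Since `e` is parallel, the vector b^i_{jkl} e^j e^k e^l is itself a multiple of `e`
(`cubic_eq`), so K vanishes exactly when both components of the cubic do. Expanding the cubic for
the three choices of `e` gives the three conditions.

Planar webs: in coordinates where the first two families are the coordinate lines and the third is f
= const, let L = log|f_x| - log|f_y|. Then L_xy is a nonzero multiple of K (`mixed_fderiv_log_eq`).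
Reparametrizing x and y separately turns L into its second difference, which is xy times a value of
L_xy (`exists_normalized_coordinates`). If L_xy = 0, the third family becomes x + y = const and
hexagons close. If L_xy has constant sign, its lines are steeper than the antidiagonal in one pair
of opposite quadrants and flatter in the other, so a hexagonal path round the origin spirals and
fails to close. -/

/-! ### Calculus tools: mean value, local inverses, functional dependence -/

/-- A mean value theorem with an intermediate point in the open segment. -/
theorem exists_sub_eq_fderiv_openSegment {F : Type*} [NormedAddCommGroup F] [NormedSpace ℝ F]
    {f : F → ℝ} {Q : Set F} (hQ : Convex ℝ Q) (hf : ∀ z ∈ Q, DifferentiableAt ℝ f z)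
    {a b : F} (ha : a ∈ Q) (hb : b ∈ Q) :
    ∃ t ∈ Set.Ioo (0 : ℝ) 1, a + t • (b - a) ∈ Q ∧
      f b - f a = fderiv ℝ f (a + t • (b - a)) (b - a) := by
  have hmem : ∀ t ∈ Set.Icc (0 : ℝ) 1, a + t • (b - a) ∈ Q := fun t ht =>
    hQ.add_smul_sub_mem ha hb ht
  have hder : ∀ t ∈ Set.Icc (0 : ℝ) 1, HasDerivAt (fun t : ℝ => f (a + t • (b - a)))
      (fderiv ℝ f (a + t • (b - a)) (b - a)) t := by
    intro t ht
    have h1 : HasDerivAt (fun t : ℝ => a + t • (b - a)) (b - a) t := by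
      simpa using ((hasDerivAt_id t).smul_const (b - a)).const_add a
    exact (hf _ (hmem t ht)).hasFDerivAt.comp_hasDerivAt t h1
  obtain ⟨t, ht, h⟩ := exists_hasDerivAt_eq_slope (fun t : ℝ => f (a + t • (b - a)))
    (fun t => fderiv ℝ f (a + t • (b - a)) (b - a)) zero_lt_one
    (fun t ht => (hder t ht).continuousAt.continuousWithinAt)
    (fun t ht => hder t (Set.Ioo_subset_Icc_self ht))
  refine ⟨t, ht, hmem t (Set.Ioo_subset_Icc_self ht), ?_⟩
  rw [h]
  simp

/-- The inverse function theorem, with a smooth local inverse defined on a ball. -/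
theorem exists_local_inverse {F T : Type*} [NormedAddCommGroup F] [NormedSpace ℝ F]
    [FiniteDimensional ℝ F] [NormedAddCommGroup T] [NormedSpace ℝ T] [FiniteDimensional ℝ T]
    (hFT : Module.finrank ℝ F = Module.finrank ℝ T) {V : Set F} (hV : IsOpen V) {f : F → T}
    (hf : ContDiffOn ℝ ∞ f V) {s : F} (hs : s ∈ V) (hinj : ∀ v, fderiv ℝ f s v = 0 → v = 0) :
    ∃ ε > 0, ∃ G : T → F, ContDiffOn ℝ ∞ G (Metric.ball (f s) ε) ∧ G (f s) = s ∧
      (∀ z ∈ Metric.ball (f s) ε, G z ∈ V ∧ f (G z) = z ∧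
        ∀ w, fderiv ℝ f (G z) (fderiv ℝ G z w) = w) ∧
      ∀ O ⊆ Metric.ball (f s) ε, IsOpen O → IsOpen (G '' O) := by
  have : CompleteSpace F := FiniteDimensional.complete ℝ F
  have hfc : ∀ p ∈ V, ContDiffAt ℝ ∞ f p := fun p hp => hf.contDiffAt (hV.mem_nhds hp)
  have hinj' : Function.Injective (fderiv ℝ f s : F →ₗ[ℝ] T) :=
    (injective_iff_map_eq_zero _).2 hinj
  let e : F ≃L[ℝ] T := (LinearEquiv.ofInjectiveOfFinrankEq _ hinj' hFT).toContinuousLinearEquiv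
  have he : (e : F →L[ℝ] T) = fderiv ℝ f s := by
    ext v; rfl
  have hfs : HasFDerivAt f (e : F →L[ℝ] T) s := by
    rw [he]; exact ((hfc s hs).differentiableAt (by simp)).hasFDerivAt
  let R := (hfc s hs).toOpenPartialHomeomorph f hfs (by simp)
  have hRs : s ∈ R.source := (hfc s hs).mem_toOpenPartialHomeomorph_source hfs (by simp)
  have hRf : ∀ p, R p = f p := fun p => rfl
  -- Restricting to the points where the differential is invertible makes the inverse smooth on the
  -- whole target ball, not merely at the image of `s`.
  let V' : Set F := V ∩ (fderiv ℝ f) ⁻¹' (Set.range ((↑) : (F ≃L[ℝ] T) → F →L[ℝ] T))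
  have hV' : IsOpen V' := (hf.continuousOn_fderiv_of_isOpen hV (by simp)).isOpen_inter_preimage hV
    ContinuousLinearEquiv.isOpen
  let S := R.restrOpen V' hV'
  have hSs : s ∈ S.source := ⟨hRs, hs, e, he⟩
  obtain ⟨ε, hε, hball⟩ := Metric.isOpen_iff.1 S.open_target (f s) (S.map_source hSs)
  have hGV : ∀ z ∈ Metric.ball (f s) ε, S.symm z ∈ V' := fun z hz =>
    (S.map_target (hball hz)).2
  have hfG : ∀ z ∈ Metric.ball (f s) ε, f (S.symm z) = z := fun z hz =>
    S.right_inv (hball hz)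
  have hG : ∀ z ∈ Metric.ball (f s) ε, ContDiffAt ℝ ∞ S.symm z := by
    intro z hz
    obtain ⟨e', he'⟩ := (hGV z hz).2
    refine S.contDiffAt_symm (f₀' := e') (hball hz) ?_ ?_
    · rw [he']
      exact ((hfc _ (hGV z hz).1).differentiableAt (by simp)).hasFDerivAt
    · exact hfc _ (hGV z hz).1
  refine ⟨ε, hε, S.symm, fun z hz => (hG z hz).contDiffWithinAt, S.left_inv hSs,
    fun z hz => ⟨(hGV z hz).1, hfG z hz, fun w => ?_⟩, fun O hO hOo => ?_⟩
  · have h1 : HasFDerivAt (fun z => f (S.symm z))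
        ((fderiv ℝ f (S.symm z)).comp (fderiv ℝ S.symm z)) z :=
      ((hfc _ (hGV z hz).1).differentiableAt (by simp)).hasFDerivAt.comp z
        ((hG z hz).differentiableAt (by simp)).hasFDerivAt
    have h2 : HasFDerivAt (fun z => f (S.symm z)) (ContinuousLinearMap.id ℝ T) z :=
      (hasFDerivAt_id z).congr_of_eventuallyEq
        (Filter.eventually_of_mem (Metric.isOpen_ball.mem_nhds hz) hfG)
    have := congrArg (fun A : T →L[ℝ] T => A w) (h1.unique h2)
    simpa using this
  · exact S.symm.isOpen_image_of_subset_source hOo (hO.trans hball)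

/-- A map whose differential vanishes on the kernel of the differential of a coordinate function
is locally a function of this coordinate. -/
theorem exists_isOpen_forall_eq_of_coord_eq {F : Type*} [NormedAddCommGroup F] [NormedSpace ℝ F]
    [FiniteDimensional ℝ F] (hF : Module.finrank ℝ F = 2) {V : Set F} (hV : IsOpen V)
    {x y : F → ℝ} (hx : ContDiffOn ℝ ∞ x V) (hy : ContDiffOn ℝ ∞ y V)
    {g : F → Fin 2 → ℝ} (hg : ContDiffOn ℝ ∞ g V) {s : F} (hs : s ∈ V)
    (hind : ∀ v, fderiv ℝ x s v = 0 → fderiv ℝ y s v = 0 → v = 0)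
    (hker : ∀ p ∈ V, ∀ v, fderiv ℝ x p v = 0 → fderiv ℝ g p v = 0) :
    ∃ M, IsOpen M ∧ s ∈ M ∧ M ⊆ V ∧ ∀ p ∈ M, ∀ q ∈ M, x p = x q → g p = g q := by
  have hxd : ∀ p ∈ V, DifferentiableAt ℝ x p := fun p hp =>
    (hx.contDiffAt (hV.mem_nhds hp)).differentiableAt (by simp)
  have hyd : ∀ p ∈ V, DifferentiableAt ℝ y p := fun p hp =>
    (hy.contDiffAt (hV.mem_nhds hp)).differentiableAt (by simp)
  have hgd : ∀ p ∈ V, DifferentiableAt ℝ g p := fun p hp =>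
    (hg.contDiffAt (hV.mem_nhds hp)).differentiableAt (by simp)
  have hxy : ∀ p ∈ V, fderiv ℝ (fun p => (x p, y p)) p = (fderiv ℝ x p).prod (fderiv ℝ y p) :=
    fun p hp => (hxd p hp).fderiv_prodMk (hyd p hp)
  obtain ⟨ε, hε, G, hG, hGs, hGz, hGo⟩ := exists_local_inverse (T := ℝ × ℝ) (by simp [hF]) hV
    (f := fun p => (x p, y p)) (hx.prodMk hy) hs (fun v hv => by
      rw [hxy s hs] at hv
      exact hind v (congrArg Prod.fst hv) (congrArg Prod.snd hv))
  refine ⟨G '' Metric.ball (x s, y s) ε, hGo _ subset_rfl Metric.isOpen_ball,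
    ⟨_, Metric.mem_ball_self hε, hGs⟩, ?_, ?_⟩
  · rintro _ ⟨z, hz, rfl⟩
    exact (hGz z hz).1
  rintro _ ⟨z, hz, rfl⟩ _ ⟨z', hz', rfl⟩ hzz
  have hz1 : z.1 = z'.1 := by
    have h1 := congrArg Prod.fst (hGz z hz).2.1
    have h2 := congrArg Prod.fst (hGz z' hz').2.1
    simp only at h1 h2
    rw [← h1, ← h2, hzz]
  have hGd : ∀ z ∈ Metric.ball (x s, y s) ε, DifferentiableAt ℝ G z := fun z hz =>
    (hG.contDiffAt (Metric.isOpen_ball.mem_nhds hz)).differentiableAt (by simp)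
  have hcomp : ∀ z ∈ Metric.ball (x s, y s) ε, HasFDerivAt (fun z => g (G z))
      ((fderiv ℝ g (G z)).comp (fderiv ℝ G z)) z := fun z hz =>
    (hgd _ (hGz z hz).1).hasFDerivAt.comp z (hGd z hz).hasFDerivAt
  ext i
  have hcompi : ∀ z ∈ Metric.ball (x s, y s) ε, HasFDerivAt (fun z => g (G z) i)
      ((ContinuousLinearMap.proj i).comp ((fderiv ℝ g (G z)).comp (fderiv ℝ G z))) z :=
    fun z hz => (ContinuousLinearMap.hasFDerivAt (ContinuousLinearMap.proj (R := ℝ)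
      (φ := fun _ : Fin 2 => ℝ) i)).comp z (hcomp z hz)
  obtain ⟨t, -, htQ, ht⟩ := exists_sub_eq_fderiv_openSegment (convex_ball (x s, y s) ε)
    (fun z hz => (hcompi z hz).differentiableAt) hz' hz
  rw [(hcompi _ htQ).fderiv] at ht
  -- In the coordinates (x, y) the points `z` and `z'` differ only in the second one, so the image
  -- of the segment direction lies in the kernel of dx, where dg vanishes by hypothesis.
  have h0 : fderiv ℝ x (G (z' + t • (z - z'))) (fderiv ℝ G (z' + t • (z - z')) (z - z')) = 0 := by
    have h := (hGz _ htQ).2.2 (z - z')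
    rw [hxy _ (hGz _ htQ).1] at h
    have := congrArg Prod.fst h
    simpa [hz1] using this
  have := hker _ (hGz _ htQ).1 _ h0
  simp only [ContinuousLinearMap.comp_apply, this, map_zero] at ht
  linarith

/-! ### Closing and non-closing hexagons in the plane -/

/-- If the two partial derivatives of `g` coincide and do not vanish, then the hexagons formed by
the coordinate lines and the level lines of `g` close. -/
theorem hexagonsClose_of_fderiv_eq {Q : Set (ℝ × ℝ)} (hQ : Convex ℝ Q) {g : ℝ × ℝ → ℝ}
    (hg : ∀ z ∈ Q, DifferentiableAt ℝ g z)
    (heq : ∀ z ∈ Q, fderiv ℝ g z (1, 0) = fderiv ℝ g z (0, 1))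
    (hne : ∀ z ∈ Q, fderiv ℝ g z (1, 0) ≠ 0) :
    HexagonsClose (X := ℝ × ℝ) (Y := ℝ) ![Prod.fst, Prod.snd, g] Q := by
  -- The level lines of `g` are the lines x + y = const: the increment of `g` is g_x times the
  -- increment of x + y at an intermediate point, and g_x does not vanish. Closure then becomes a
  -- linear identity between coordinates.
  have key : ∀ a ∈ Q, ∀ b ∈ Q, (g a = g b ↔ a.1 + a.2 = b.1 + b.2) := by
    intro a ha b hb
    obtain ⟨t, -, htQ, ht⟩ := exists_sub_eq_fderiv_openSegment hQ hg ha hb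
    have hdec : b - a = (b.1 - a.1) • ((1, 0) : ℝ × ℝ) + (b.2 - a.2) • ((0, 1) : ℝ × ℝ) := by
      ext <;> simp
    generalize a + t • (b - a) = z at *
    rw [hdec, map_add, map_smul, map_smul, ← heq z htQ, smul_eq_mul, smul_eq_mul,
      ← add_mul] at ht
    constructor
    · intro h
      rw [h, sub_self, eq_comm, mul_eq_zero] at ht
      rcases ht with ht | ht
      · linarith
      · exact absurd ht (hne z htQ)
    · intro h
      have : b.1 - a.1 + (b.2 - a.2) = 0 := by linarith
      rw [this, zero_mul] at ht
      linarith
  intro p hp A hA h0 h1 h2 h3 h4 h5 h6 h7 h8 h9 h10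
  simp only [Matrix.cons_val_zero, Matrix.cons_val_one, Matrix.cons_val] at *
  rw [key _ (hA _) _ hp] at h1 h4
  rw [key _ (hA _) _ (hA _)] at h8 ⊢
  linarith

theorem HexagonsClose.mono {X Y : Type*} {f : Fin 3 → X → Y} {N M : Set X}
    (h : HexagonsClose f N) (hM : M ⊆ N) : HexagonsClose f M :=
  fun p hp A hA => h p (hM hp) A fun k => hM (hA k)

/-- Hexagons in the source of an injective change of variables are hexagons in the target. -/
theorem HexagonsClose.comap {X X' Y Y' : Type*} {f : Fin 3 → X → Y} {f' : Fin 3 → X' → Y'}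
    {N : Set X} {N' : Set X'} (h : HexagonsClose f N) {G : X' → X} (hG : Set.MapsTo G N' N)
    (hf : ∀ ξ, ∀ z ∈ N', ∀ w ∈ N', (f' ξ z = f' ξ w ↔ f ξ (G z) = f ξ (G w))) :
    HexagonsClose f' N' := by
  intro p hp A hA h0 h1 h2 h3 h4 h5 h6 h7 h8 h9 h10
  rw [hf _ _ (hA _) _ hp] at h0 h1 h2 h3 h4 h5
  rw [hf _ _ (hA _) _ (hA _)] at h6 h7 h8 h9 h10 ⊢
  exact h (G p) (hG hp) (fun k => G (A k)) (fun k => hG (hA k)) h0 h1 h2 h3 h4 h5 h6 h7 h8 h9 h10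

/-- A change of variables transports closed hexagons to its image. -/
theorem HexagonsClose.image {X X' Y Y' : Type*} {f : Fin 3 → X → Y} {f' : Fin 3 → X' → Y'}
    {N' : Set X'} (h : HexagonsClose f' N') {G : X' → X}
    (hf : ∀ ξ, ∀ z ∈ N', ∀ w ∈ N', (f' ξ z = f' ξ w ↔ f ξ (G z) = f ξ (G w))) :
    HexagonsClose f (G '' N') := by
  intro p hp A hA
  obtain ⟨p, hp, rfl⟩ := hp
  choose B hB hBA using hA
  obtain rfl : A = fun k => G (B k) := funext fun k => (hBA k).symm
  intro h0 h1 h2 h3 h4 h5 h6 h7 h8 h9 h10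
  simp only at h0 h1 h2 h3 h4 h5 h6 h7 h8 h9 h10 ⊢
  rw [← hf _ _ (hB _) _ hp] at h0 h1 h2 h3 h4 h5
  rw [← hf _ _ (hB _) _ (hB _)] at h6 h7 h8 h9 h10 ⊢
  exact h p hp B hB h0 h1 h2 h3 h4 h5 h6 h7 h8 h9 h10

/-- Hexagons do not depend on the order of the first two families of lines. -/
theorem HexagonsClose.swap {X Y : Type*} {f₀ f₁ f₂ : X → Y} {N : Set X}
    (h : HexagonsClose ![f₀, f₁, f₂] N) : HexagonsClose ![f₁, f₀, f₂] N := by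
  intro p hp A hA h0 h1 h2 h3 h4 h5 h6 h7 h8 h9 h10
  simp only [Matrix.cons_val_zero, Matrix.cons_val_one, Matrix.cons_val] at *
  -- Exchanging the first two families reverses the direction in which the hexagon is traversed, so
  -- the vertices are read backwards.
  have := h p hp ![A 5, A 4, A 3, A 2, A 1, A 0] (by
    intro k
    fin_cases k <;> exact hA _) h5 h4 h3 h2 h1 h0
  exact (this h10.symm h9.symm h8.symm h7.symm h6.symm).symm

/-- If the level lines of `g` are too steep in the first and third quadrants and too flat in the
second and fourth ones, then a polygonal line around the origin spirals outwards. -/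
theorem not_hexagonsClose_of_fderiv_lt {ε : ℝ} (hε : 0 < ε) {g : ℝ × ℝ → ℝ}
    (hg : ∀ z ∈ Metric.ball (0 : ℝ × ℝ) ε, DifferentiableAt ℝ g z)
    (hx : ∀ z ∈ Metric.ball (0 : ℝ × ℝ) ε, fderiv ℝ g z (1, 0) < 2 * fderiv ℝ g z (0, 1))
    (hy : ∀ z ∈ Metric.ball (0 : ℝ × ℝ) ε, fderiv ℝ g z (0, 1) < 2 * fderiv ℝ g z (1, 0))
    (hpos : ∀ z ∈ Metric.ball (0 : ℝ × ℝ) ε, 0 < z.1 * z.2 →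
      fderiv ℝ g z (0, 1) < fderiv ℝ g z (1, 0))
    (hneg : ∀ z ∈ Metric.ball (0 : ℝ × ℝ) ε, z.1 * z.2 < 0 →
      fderiv ℝ g z (1, 0) < fderiv ℝ g z (0, 1)) :
    ¬ HexagonsClose (X := ℝ × ℝ) (Y := ℝ) ![Prod.fst, Prod.snd, g] (Metric.ball 0 ε) := by
  intro hex
  have hQ : ∀ x y : ℝ, |x| < ε → |y| < ε → (x, y) ∈ Metric.ball (0 : ℝ × ℝ) ε := by
    intro x y hx hy
    simp [Prod.norm_def, hx, hy]
  have mvt : ∀ x y x' y' : ℝ, |x| < ε → |y| < ε → |x'| < ε → |y'| < ε →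
      ∃ t ∈ Set.Ioo (0 : ℝ) 1, ∃ z ∈ Metric.ball (0 : ℝ × ℝ) ε,
        z = (x + t * (x' - x), y + t * (y' - y)) ∧
        g (x', y') - g (x, y) = (x' - x) * fderiv ℝ g z (1, 0) + (y' - y) * fderiv ℝ g z (0, 1) := by
    intro x y x' y' h1 h2 h3 h4
    obtain ⟨t, ht, htQ, h⟩ := exists_sub_eq_fderiv_openSegment (convex_ball _ _) hg
      (hQ x y h1 h2) (hQ x' y' h3 h4)
    refine ⟨t, ht, _, htQ, by simp, ?_⟩
    have hdec : ((x', y') - (x, y) : ℝ × ℝ)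
        = (x' - x) • ((1, 0) : ℝ × ℝ) + (y' - y) • ((0, 1) : ℝ × ℝ) := by
      ext <;> simp
    rw [h]
    generalize (x, y) + t • ((x', y') - (x, y) : ℝ × ℝ) = z
    rw [hdec, map_add, map_smul, map_smul, smul_eq_mul, smul_eq_mul]
  have monox : ∀ x x' y : ℝ, |x| < ε → |y| < ε → |x'| < ε → x < x' → g (x, y) < g (x', y) := by
    intro x x' y h1 h2 h3 h
    obtain ⟨t, ht, z, hz, -, he⟩ := mvt x y x' y h1 h2 h3 h2
    nlinarith [hx z hz, hy z hz]
  have monoy : ∀ x y y' : ℝ, |x| < ε → |y| < ε → |y'| < ε → y < y' → g (x, y) < g (x, y') := by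
    intro x y y' h1 h2 h3 h
    obtain ⟨t, ht, z, hz, -, he⟩ := mvt x y x y' h1 h2 h1 h3
    nlinarith [hx z hz, hy z hz]
  have cont : ∀ z ∈ Metric.ball (0 : ℝ × ℝ) ε, ContinuousAt g z := fun z hz => (hg z hz).continuousAt
  have contx : ∀ y : ℝ, |y| < ε → ∀ x x' : ℝ, |x| < ε → |x'| < ε →
      ContinuousOn (fun t => g (t, y)) (Set.Icc x x') := by
    intro y h x x' h1 h2 t ht
    have : |t| < ε := by
      rw [abs_lt] at *; exact ⟨by linarith [ht.1], by linarith [ht.2]⟩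
    exact (ContinuousAt.comp (f := fun t : ℝ => (t, y)) (cont _ (hQ t y this h))
      (by fun_prop)).continuousWithinAt
  have conty : ∀ x : ℝ, |x| < ε → ∀ y y' : ℝ, |y| < ε → |y'| < ε →
      ContinuousOn (fun t => g (x, t)) (Set.Icc y y') := by
    intro x h y y' h1 h2 t ht
    have : |t| < ε := by
      rw [abs_lt] at *; exact ⟨by linarith [ht.1], by linarith [ht.2]⟩
    exact (ContinuousAt.comp (f := fun t : ℝ => (x, t)) (cont _ (hQ x t h this))
      (by fun_prop)).continuousWithinAt
  -- The slopes differ from 1 by a factor below 2, so each of the three slanted moves at most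
  -- doubles the distance to the origin: |s| < 2t, |r| < 4t, q < 8t = ε/2.
  set t : ℝ := ε / 16 with ht
  have h0 : |(0 : ℝ)| < ε := by simpa using hε
  have small : ∀ r : ℝ, -(8 * t) ≤ r → r ≤ 8 * t → |r| < ε := fun r h1 h2 => by
    rw [abs_lt]; constructor <;> linarith
  have hst : |t| < ε := small _ (by linarith) (by linarith)
  -- the vertex on the level line of the centre in the second quadrant
  obtain ⟨s, hs, hgs⟩ : ∃ s ∈ Set.Ioo (-(2 * t)) 0, g (s, t) = g (0, 0) := by
    have h2 : |(-(2 * t))| < ε := small _ (by linarith) (by linarith)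
    obtain ⟨s, hs, h⟩ := intermediate_value_Ioo (f := fun r => g (r, t)) (a := -(2 * t)) (b := 0)
      (by linarith) (contx t hst _ _ h2 h0) (show g (0, 0) ∈ _ from ⟨by
        obtain ⟨_, _, z, hz, -, he⟩ := mvt 0 0 (-(2 * t)) t h0 h0 h2 hst
        nlinarith [hy z hz], monoy 0 0 t h0 h0 hst (by linarith)⟩)
    -- Comparison with the point (-t, t) now shows that the move goes strictly outwards: in the
    -- second quadrant g_x < g_y. The next two moves follow the same pattern, giving t < -s < -r <
    -- q.
    exact ⟨s, hs, h⟩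
  have hss : |s| < ε := small _ (by linarith [hs.1]) (by linarith [hs.2])
  have hst' : s < -t := by
    by_contra! hle
    obtain ⟨τ, hτ, z, hz, rfl, he⟩ := mvt 0 0 (-t) t h0 h0 (by rwa [abs_neg]) hst
    have := hneg _ hz (by simp only; nlinarith [mul_pos hτ.1 (show 0 < t by linarith)])
    have h1 : g (-t, t) ≤ g (s, t) := by
      rcases hle.eq_or_lt with h | h
      · rw [h]
      · exact (monox _ _ _ (by rwa [abs_neg]) hst hss h).le
    nlinarith
  -- the vertex in the third quadrant
  obtain ⟨r, hr, hgr⟩ : ∃ r ∈ Set.Ioo (2 * s) 0, g (0, r) = g (s, 0) := by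
    have h2 : |2 * s| < ε := small _ (by linarith [hs.1]) (by linarith [hs.2])
    obtain ⟨r, hr, h⟩ := intermediate_value_Ioo (f := fun r => g (0, r)) (a := 2 * s) (b := 0)
      (by linarith [hs.2]) (conty 0 h0 _ _ h2 h0) (show g (s, 0) ∈ _ from ⟨by
        obtain ⟨_, _, z, hz, -, he⟩ := mvt 0 (2 * s) s 0 h0 h2 hss h0
        nlinarith [hx z hz, hs.2], monox s 0 0 hss h0 h0 hs.2⟩)
    exact ⟨r, hr, h⟩
  have hrr : |r| < ε := small _ (by linarith [hs.1, hr.1]) (by linarith [hr.2])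
  have hrs : r < s := by
    by_contra! hle
    obtain ⟨τ, hτ, z, hz, rfl, he⟩ := mvt s 0 0 s hss h0 h0 hss
    have := hpos _ hz (by
      simp only
      nlinarith [mul_pos (mul_pos hτ.1 (sub_pos.2 hτ.2)) (mul_pos_of_neg_of_neg hs.2 hs.2)])
    have h1 : g (0, s) ≤ g (0, r) := by
      rcases hle.eq_or_lt with h | h
      · rw [h]
      · exact (monoy _ _ _ h0 hss hrr h).le
    nlinarith [hs.2]
  -- the vertex in the fourth quadrant
  obtain ⟨q, hq, hgq⟩ : ∃ q ∈ Set.Ioo 0 (-(2 * r)), g (q, r) = g (0, 0) := by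
    have h2 : |(-(2 * r))| < ε := small _ (by linarith [hr.2]) (by linarith [hr.1, hs.1])
    obtain ⟨q, hq, h⟩ := intermediate_value_Ioo (f := fun q => g (q, r)) (a := 0) (b := -(2 * r))
      (by linarith [hr.2]) (contx r hrr _ _ h0 h2) (show g (0, 0) ∈ _ from
        ⟨monoy 0 r 0 h0 hrr h0 hr.2, by
          obtain ⟨_, _, z, hz, -, he⟩ := mvt 0 0 (-(2 * r)) r h0 h0 h2 hrr
          nlinarith [hy z hz, hr.2]⟩)
    exact ⟨q, hq, h⟩
  have hqq : |q| < ε := small _ (by linarith [hq.1]) (by linarith [hq.2, hr.1, hs.1])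
  have hqr : -r < q := by
    by_contra! hle
    obtain ⟨τ, hτ, z, hz, rfl, he⟩ := mvt 0 0 (-r) r h0 h0 (by rwa [abs_neg]) hrr
    have := hneg _ hz (by
      simp only; nlinarith [mul_pos (mul_pos hτ.1 hτ.1) (mul_pos_of_neg_of_neg hr.2 hr.2)])
    have h1 : g (q, r) ≤ g (-r, r) := by
      rcases hle.eq_or_lt with h | h
      · rw [h]
      · exact (monox _ _ _ hqq hrr (by rwa [abs_neg]) h).le
    nlinarith [hr.2]
  -- The last side compares (q, 0) with (0, q) in the first quadrant, and then (0, q) with the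
  -- starting vertex (0, t).
  have hend : g (0, t) < g (q, 0) := by
    have htq : t < q := by linarith
    have h1 := monoy 0 t q h0 hst hqq htq
    obtain ⟨τ, hτ, z, hz, rfl, he⟩ := mvt 0 q q 0 h0 hqq hqq h0
    have := hpos _ hz (by
      simp only; nlinarith [mul_pos (mul_pos hτ.1 (sub_pos.2 hτ.2)) (mul_pos hq.1 hq.1)])
    nlinarith [hq.1]
  have := hex (0, 0) (hQ _ _ h0 h0) ![(0, t), (s, t), (s, 0), (0, r), (q, r), (q, 0)] (by
    intro k
    fin_cases k
    · exact hQ _ _ h0 hst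
    · exact hQ _ _ hss hst
    · exact hQ _ _ hss h0
    · exact hQ _ _ h0 hrr
    · exact hQ _ _ hqq hrr
    · exact hQ _ _ hqq h0) rfl hgs rfl rfl hgq rfl rfl rfl hgr.symm rfl rfl
  exact hend.ne' this

/-- Reflection in the diagonal interchanges g_x and g_y while preserving the sign of xy, which
reduces this spiral to the opposite one. -/
theorem not_hexagonsClose_of_fderiv_gt {ε : ℝ} (hε : 0 < ε) {g : ℝ × ℝ → ℝ}
    (hg : ∀ z ∈ Metric.ball (0 : ℝ × ℝ) ε, DifferentiableAt ℝ g z)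
    (hx : ∀ z ∈ Metric.ball (0 : ℝ × ℝ) ε, fderiv ℝ g z (1, 0) < 2 * fderiv ℝ g z (0, 1))
    (hy : ∀ z ∈ Metric.ball (0 : ℝ × ℝ) ε, fderiv ℝ g z (0, 1) < 2 * fderiv ℝ g z (1, 0))
    (hpos : ∀ z ∈ Metric.ball (0 : ℝ × ℝ) ε, 0 < z.1 * z.2 →
      fderiv ℝ g z (1, 0) < fderiv ℝ g z (0, 1))
    (hneg : ∀ z ∈ Metric.ball (0 : ℝ × ℝ) ε, z.1 * z.2 < 0 →
      fderiv ℝ g z (0, 1) < fderiv ℝ g z (1, 0)) :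
    ¬ HexagonsClose (X := ℝ × ℝ) (Y := ℝ) ![Prod.fst, Prod.snd, g] (Metric.ball 0 ε) := by
  intro hex
  have hmem : ∀ z ∈ Metric.ball (0 : ℝ × ℝ) ε, z.swap ∈ Metric.ball (0 : ℝ × ℝ) ε := by
    intro z hz
    simpa [Prod.norm_def, and_comm] using hz
  have hd : ∀ z ∈ Metric.ball (0 : ℝ × ℝ) ε, HasFDerivAt (fun z : ℝ × ℝ => g z.swap)
      ((fderiv ℝ g z.swap).comp ((ContinuousLinearMap.snd ℝ ℝ ℝ).prod
        (ContinuousLinearMap.fst ℝ ℝ ℝ))) z := fun z hz =>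
    (hg _ (hmem z hz)).hasFDerivAt.comp z ((ContinuousLinearMap.snd ℝ ℝ ℝ).prod
        (ContinuousLinearMap.fst ℝ ℝ ℝ)).hasFDerivAt
  refine not_hexagonsClose_of_fderiv_lt hε (g := fun z => g z.swap)
    (fun z hz => (hd z hz).differentiableAt) ?_ ?_ ?_ ?_ ?_
  · intro z hz; rw [(hd z hz).fderiv]; simpa using hy _ (hmem z hz)
  · intro z hz; rw [(hd z hz).fderiv]; simpa using hx _ (hmem z hz)
  · intro z hz h; rw [(hd z hz).fderiv]
    simpa using hpos _ (hmem z hz) (by rwa [Prod.fst_swap, Prod.snd_swap, mul_comm])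
  · intro z hz h; rw [(hd z hz).fderiv]
    simpa using hneg _ (hmem z hz) (by rwa [Prod.fst_swap, Prod.snd_swap, mul_comm])
  · refine hex.swap.comap (G := Prod.swap) hmem fun ξ z _ w _ => ?_
    fin_cases ξ <;> simp

/-! ### Normalizing the first two families, and the mixed derivative criterion -/

/-- A smooth function on an interval has a smooth antiderivative. -/
theorem exists_contDiffOn_antideriv {ε : ℝ} (hε : 0 < ε) {α : ℝ → ℝ}
    (hα : ContDiffOn ℝ ∞ α (Set.Ioo (-ε) ε)) :
    ∃ X : ℝ → ℝ, ContDiffOn ℝ ∞ X (Set.Ioo (-ε) ε) ∧ X 0 = 0 ∧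
      ∀ t ∈ Set.Ioo (-ε) ε, HasDerivAt X (α t) t := by
  have hder : ∀ t ∈ Set.Ioo (-ε) ε, HasDerivAt (fun x => ∫ r in (0 : ℝ)..x, α r) (α t) t := by
    intro t ht
    have hsub : Set.uIcc 0 t ⊆ Set.Ioo (-ε) ε :=
      (Set.ordConnected_Ioo).uIcc_subset ⟨by linarith, hε⟩ ht
    have hcont : ContinuousAt α t := hα.continuousOn.continuousAt (isOpen_Ioo.mem_nhds ht)
    refine intervalIntegral.integral_hasDerivAt_right
      ((hα.continuousOn.mono hsub).intervalIntegrable) ?_ hcont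
    exact hα.continuousOn.stronglyMeasurableAtFilter isOpen_Ioo t ht
  refine ⟨fun x => ∫ r in (0 : ℝ)..x, α r, ?_, by simp, hder⟩
  rw [contDiffOn_infty_iff_deriv_of_isOpen isOpen_Ioo]
  refine ⟨fun t ht => (hder t ht).differentiableAt.differentiableWithinAt, ?_⟩
  exact hα.congr fun t ht => (hder t ht).deriv

/-- A nonvanishing continuous function on an interval around `0` has constant sign. -/
theorem mul_pos_of_continuousOn_of_ne_zero {ε : ℝ} (hε : 0 < ε) {α : ℝ → ℝ}
    (hα : ContinuousOn α (Set.Ioo (-ε) ε)) (hne : ∀ t ∈ Set.Ioo (-ε) ε, α t ≠ 0) :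
    ∀ t ∈ Set.Ioo (-ε) ε, 0 < α t * α 0 := by
  have h0 : (0 : ℝ) ∈ Set.Ioo (-ε) ε := ⟨by linarith, hε⟩
  intro t ht
  by_contra! hle
  have hc : ContinuousOn (fun t => α t * α 0) (Set.Ioo (-ε) ε) := hα.mul continuousOn_const
  obtain ⟨r, hr, h⟩ := isPreconnected_Ioo.intermediate_value ht h0 hc
    (show (0 : ℝ) ∈ _ from ⟨hle, mul_self_nonneg _⟩)
  exact mul_ne_zero (hne r hr) (hne 0 h0) h

/-- The second difference of a function is given by its mixed second derivative. -/
theorem exists_second_difference_eq {ε : ℝ} {L : ℝ × ℝ → ℝ}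
    (hL : ContDiffOn ℝ ∞ L (Metric.ball 0 ε)) {z : ℝ × ℝ} (hz : z ∈ Metric.ball (0 : ℝ × ℝ) ε) :
    ∃ w ∈ Metric.ball (0 : ℝ × ℝ) ε, L z - L (z.1, 0) - L (0, z.2) + L (0, 0) =
      z.1 * z.2 * fderiv ℝ (fun z => fderiv ℝ L z (1, 0)) w (0, 1) := by
  have hLd : ∀ z ∈ Metric.ball (0 : ℝ × ℝ) ε, HasFDerivAt L (fderiv ℝ L z) z := fun z hz =>
    ((hL.contDiffAt (Metric.isOpen_ball.mem_nhds hz)).differentiableAt (by simp)).hasFDerivAt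
  have hL' : ContDiffOn ℝ ∞ (fun z => fderiv ℝ L z (1, 0)) (Metric.ball 0 ε) :=
    (((contDiffOn_infty_iff_fderiv_of_isOpen Metric.isOpen_ball).1 hL).2).clm_apply contDiffOn_const
  obtain ⟨x, y⟩ := z
  have hxy : |x| < ε ∧ |y| < ε := by simpa [Prod.norm_def] using hz
  have hε : 0 < ε := (abs_nonneg x).trans_lt hxy.1
  have hmem : ∀ t r : ℝ, |t| < ε → |r| < ε → (t, r) ∈ Metric.ball (0 : ℝ × ℝ) ε := by
    intro t r h1 h2; simp [Prod.norm_def, h1, h2]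
  -- The mean value theorem is used twice: in x for the difference L(t, y) - L(t, 0), then in y for
  -- L_x.
  have hg : ∀ t ∈ Metric.ball (0 : ℝ) ε, HasFDerivAt (fun t : ℝ => L (t, y) - L (t, 0))
      ((fderiv ℝ L (t, y)).comp (ContinuousLinearMap.inl ℝ ℝ ℝ) -
        (fderiv ℝ L (t, 0)).comp (ContinuousLinearMap.inl ℝ ℝ ℝ)) t := by
    intro t ht
    have ht' : |t| < ε := by simpa using ht
    exact ((hLd (t, y) (hmem _ _ ht' hxy.2)).comp t (hasFDerivAt_prodMk_left t y)).sub
      ((hLd (t, 0) (hmem _ _ ht' (by simpa using hε))).comp t (hasFDerivAt_prodMk_left t 0))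
  obtain ⟨τ, hτ, hτQ, h1⟩ := exists_sub_eq_fderiv_openSegment (convex_ball (0 : ℝ) ε)
    (fun t ht => (hg t ht).differentiableAt) (Metric.mem_ball_self hε)
    (show x ∈ Metric.ball (0 : ℝ) ε by simpa using hxy.1)
  rw [(hg _ hτQ).fderiv] at h1
  generalize 0 + τ • (x - 0) = ξ at h1 hτQ
  have hξ : |ξ| < ε := by simpa using hτQ
  obtain ⟨ρ, hρ, hρQ, h2⟩ := exists_sub_eq_fderiv_openSegment (convex_ball (0 : ℝ × ℝ) ε)
    (fun z hz => (hL'.contDiffAt (Metric.isOpen_ball.mem_nhds hz)).differentiableAt (by simp))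
    (hmem ξ 0 hξ (by simpa using hε)) (hmem ξ y hξ hxy.2)
  refine ⟨_, hρQ, ?_⟩
  generalize (ξ, (0 : ℝ)) + ρ • ((ξ, y) - (ξ, 0) : ℝ × ℝ) = w at h2
  have e1 : ((ξ, y) - (ξ, 0) : ℝ × ℝ) = y • (0, 1) := by ext <;> simp
  have e2 : (ContinuousLinearMap.inl ℝ ℝ ℝ) (x - 0) = x • ((1, 0) : ℝ × ℝ) := by ext <;> simp
  rw [e1, map_smul, smul_eq_mul] at h2
  simp only [sub_apply, ContinuousLinearMap.comp_apply, e2, map_smul, smul_eq_mul] at h1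
  simp only
  linear_combination h1 + x * h2

/-- Near a point, the first two families of lines of a planar web can be parametrized so that the
second difference of `log f_x - log f_y` becomes the logarithm of the slope of the third family. -/
theorem exists_normalized_coordinates {ε : ℝ} (hε : 0 < ε) {f : ℝ × ℝ → ℝ}
    (hf : ContDiffOn ℝ ∞ f (Metric.ball 0 ε))
    (hfx : ∀ z ∈ Metric.ball (0 : ℝ × ℝ) ε, fderiv ℝ f z (1, 0) ≠ 0)
    (hfy : ∀ z ∈ Metric.ball (0 : ℝ × ℝ) ε, fderiv ℝ f z (0, 1) ≠ 0) :
    ∃ δ > 0, ∃ σ : ℝ, σ ≠ 0 ∧ ∃ G : ℝ × ℝ → ℝ × ℝ, ContDiffOn ℝ ∞ G (Metric.ball 0 δ) ∧ G 0 = 0 ∧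
      Set.MapsTo G (Metric.ball 0 δ) (Metric.ball 0 ε) ∧
      (∀ O ⊆ Metric.ball 0 δ, IsOpen O → IsOpen (G '' O)) ∧
      (∀ z ∈ Metric.ball (0 : ℝ × ℝ) δ, ∀ w ∈ Metric.ball (0 : ℝ × ℝ) δ,
        (z.1 = w.1 ↔ (G z).1 = (G w).1) ∧ (z.2 = w.2 ↔ (G z).2 = (G w).2)) ∧
      (∀ z ∈ Metric.ball (0 : ℝ × ℝ) δ, z.1 ≠ 0 → z.2 ≠ 0 →
        0 < σ * ((z.1 * z.2) * ((G z).1 * (G z).2))) ∧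
      (∀ z ∈ Metric.ball (0 : ℝ × ℝ) δ, fderiv ℝ (fun z => f (G z)) z (1, 0) ≠ 0 ∧
        fderiv ℝ (fun z => f (G z)) z (0, 1) ≠ 0) ∧
      fderiv ℝ (fun z => f (G z)) 0 (1, 0) = fderiv ℝ f 0 (1, 0) ∧
      fderiv ℝ (fun z => f (G z)) 0 (0, 1) = fderiv ℝ f 0 (1, 0) ∧
      ∀ z ∈ Metric.ball (0 : ℝ × ℝ) δ, ∃ w ∈ Metric.ball (0 : ℝ × ℝ) ε,
        Real.log (fderiv ℝ (fun z => f (G z)) z (1, 0)) -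
          Real.log (fderiv ℝ (fun z => f (G z)) z (0, 1)) =
        (G z).1 * (G z).2 * fderiv ℝ (fun z => fderiv ℝ (fun z =>
          Real.log (fderiv ℝ f z (1, 0)) - Real.log (fderiv ℝ f z (0, 1))) z (1, 0)) w (0, 1) := by
  have hmem : ∀ t r : ℝ, |t| < ε → |r| < ε → (t, r) ∈ Metric.ball (0 : ℝ × ℝ) ε := by
    intro t r h1 h2; simp [Prod.norm_def, h1, h2]
  have hI : ∀ t, t ∈ Set.Ioo (-ε) ε ↔ |t| < ε := fun t => abs_lt.symm
  have hz12 : ∀ z ∈ Metric.ball (0 : ℝ × ℝ) ε, |z.1| < ε ∧ |z.2| < ε := fun z hz => by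
    simpa [Prod.norm_def] using hz
  have h00 : |(0 : ℝ)| < ε := by simpa using hε
  have h0Q : ((0 : ℝ), (0 : ℝ)) ∈ Metric.ball (0 : ℝ × ℝ) ε := hmem 0 0 h00 h00
  have hf' := ((contDiffOn_infty_iff_fderiv_of_isOpen Metric.isOpen_ball).1 hf).2
  have hfd : ∀ z ∈ Metric.ball (0 : ℝ × ℝ) ε, DifferentiableAt ℝ f z := fun z hz =>
    (hf.contDiffAt (Metric.isOpen_ball.mem_nhds hz)).differentiableAt (by simp)
  set p : ℝ × ℝ → ℝ := fun z => fderiv ℝ f z (1, 0) with hp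
  set q : ℝ × ℝ → ℝ := fun z => fderiv ℝ f z (0, 1) with hq
  have hps : ContDiffOn ℝ ∞ p (Metric.ball 0 ε) := hf'.clm_apply contDiffOn_const
  have hqs : ContDiffOn ℝ ∞ q (Metric.ball 0 ε) := hf'.clm_apply contDiffOn_const
  have hL : ContDiffOn ℝ ∞ (fun z => Real.log (p z) - Real.log (q z)) (Metric.ball 0 ε) :=
    (hps.log hfx).sub (hqs.log hfy)
  set c : ℝ := p (0, 0) / q (0, 0) with hc
  have hc0 : c ≠ 0 := div_ne_zero (hfx _ h0Q) (hfy _ h0Q)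
  -- With L = log|f_x| - log|f_y|, the new coordinates X, Y have |X'| = exp(L(x, 0) - L(0, 0)) and
  -- |Y'| = exp(-L(0, y)). Dividing f_x by X' and f_y by Y' replaces L by its second difference.
  set α : ℝ → ℝ := fun t => p (t, 0) / q (t, 0) / c with hα
  set β : ℝ → ℝ := fun t => q (0, t) / p (0, t) with hβ
  have hm1 : Set.MapsTo (fun t : ℝ => (t, (0 : ℝ))) (Set.Ioo (-ε) ε) (Metric.ball 0 ε) :=
    fun t ht => hmem _ _ ((hI t).1 ht) h00
  have hm2 : Set.MapsTo (fun t : ℝ => ((0 : ℝ), t)) (Set.Ioo (-ε) ε) (Metric.ball 0 ε) :=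
    fun t ht => hmem _ _ h00 ((hI t).1 ht)
  have hαs : ContDiffOn ℝ ∞ α (Set.Ioo (-ε) ε) := by
    refine ContDiffOn.div (ContDiffOn.div (hps.comp (by fun_prop) hm1) (hqs.comp (by fun_prop) hm1)
      fun t ht => hfy _ (hm1 ht)) contDiffOn_const fun _ _ => hc0
  have hβs : ContDiffOn ℝ ∞ β (Set.Ioo (-ε) ε) := by
    refine ContDiffOn.div (hqs.comp (by fun_prop) hm2) (hps.comp (by fun_prop) hm2)
      fun t ht => hfx _ (hm2 ht)
  have hαne : ∀ t ∈ Set.Ioo (-ε) ε, α t ≠ 0 := fun t ht =>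
    div_ne_zero (div_ne_zero (hfx _ (hm1 ht)) (hfy _ (hm1 ht))) hc0
  have hβne : ∀ t ∈ Set.Ioo (-ε) ε, β t ≠ 0 := fun t ht =>
    div_ne_zero (hfy _ (hm2 ht)) (hfx _ (hm2 ht))
  have hαpos := mul_pos_of_continuousOn_of_ne_zero hε hαs.continuousOn hαne
  have hβpos := mul_pos_of_continuousOn_of_ne_zero hε hβs.continuousOn hβne
  have hα0 : α 0 = 1 := by simp [hα, ← hc, hc0]
  have hβ0 : β 0 = c⁻¹ := by simp [hβ, hc]
  obtain ⟨X, hXs, hX0, hX⟩ := exists_contDiffOn_antideriv hε hαs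
  obtain ⟨Y, hYs, hY0, hY⟩ := exists_contDiffOn_antideriv hε hβs
  have sgn : ∀ (Z γ : ℝ → ℝ), Z 0 = 0 → (∀ t ∈ Set.Ioo (-ε) ε, HasDerivAt Z (γ t) t) →
      (∀ t ∈ Set.Ioo (-ε) ε, 0 < γ t * γ 0) → ∀ t ∈ Set.Ioo (-ε) ε, t ≠ 0 → 0 < Z t * t * γ 0 := by
    intro Z γ hZ0 hZ hγ t ht hne
    obtain ⟨τ, hτ, hτQ, h⟩ := exists_sub_eq_fderiv_openSegment (convex_Ioo (-ε) ε)
      (fun t ht => (hZ t ht).differentiableAt) ((hI 0).2 h00) ht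
    rw [(hZ _ hτQ).hasFDerivAt.fderiv, hZ0] at h
    have : Z t = t * γ (0 + τ • (t - 0)) := by simpa using h
    rw [this]
    have := mul_pos (hγ _ hτQ) (mul_self_pos.2 hne)
    linarith
  have hFd : ∀ z ∈ Metric.ball (0 : ℝ × ℝ) ε, HasFDerivAt (fun z : ℝ × ℝ => (X z.1, Y z.2))
      ((α z.1 • ContinuousLinearMap.fst ℝ ℝ ℝ).prod (β z.2 • ContinuousLinearMap.snd ℝ ℝ ℝ)) z := by
    intro z hz
    exact ((hX _ ((hI _).2 (hz12 z hz).1)).comp_hasFDerivAt z hasFDerivAt_fst).prodMk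
      ((hY _ ((hI _).2 (hz12 z hz).2)).comp_hasFDerivAt z hasFDerivAt_snd)
  have hFs : ContDiffOn ℝ ∞ (fun z : ℝ × ℝ => (X z.1, Y z.2)) (Metric.ball 0 ε) :=
    (hXs.comp contDiffOn_fst fun z hz => (hI _).2 (hz12 z hz).1).prodMk
      (hYs.comp contDiffOn_snd fun z hz => (hI _).2 (hz12 z hz).2)
  obtain ⟨δ, hδ, G, hGs, hG0, hG, hGo⟩ := exists_local_inverse rfl Metric.isOpen_ball hFs h0Q
    (fun v hv => by
      rw [(hFd _ h0Q).fderiv] at hv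
      have h1 := congrArg Prod.fst hv
      have h2 := congrArg Prod.snd hv
      simp only [ContinuousLinearMap.prod_apply, smul_apply,
        ContinuousLinearMap.coe_fst', ContinuousLinearMap.coe_snd', smul_eq_mul, Prod.fst_zero,
        Prod.snd_zero, mul_eq_zero, hαne 0 ((hI 0).2 h00), hβne 0 ((hI 0).2 h00), false_or] at h1 h2
      exact Prod.ext h1 h2)
  have hc00 : (X ((0 : ℝ), (0 : ℝ)).1, Y ((0 : ℝ), (0 : ℝ)).2) = (0 : ℝ × ℝ) := by simp [hX0, hY0]
  rw [hc00] at hGs hG0 hG hGo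
  have hGd : ∀ z ∈ Metric.ball (0 : ℝ × ℝ) δ, DifferentiableAt ℝ G z := fun z hz =>
    (hGs.contDiffAt (Metric.isOpen_ball.mem_nhds hz)).differentiableAt (by simp)
  have hX' : ∀ z ∈ Metric.ball (0 : ℝ × ℝ) δ, X (G z).1 = z.1 ∧ Y (G z).2 = z.2 := fun z hz =>
    ⟨congrArg Prod.fst (hG z hz).2.1, congrArg Prod.snd (hG z hz).2.1⟩
  have hGm : ∀ z ∈ Metric.ball (0 : ℝ × ℝ) δ,
      (G z).1 ∈ Set.Ioo (-ε) ε ∧ (G z).2 ∈ Set.Ioo (-ε) ε := fun z hz =>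
    ⟨(hI _).2 (hz12 _ (hG z hz).1).1, (hI _).2 (hz12 _ (hG z hz).1).2⟩
  have hG' : ∀ z ∈ Metric.ball (0 : ℝ × ℝ) δ,
      fderiv ℝ G z (1, 0) = (α (G z).1)⁻¹ • (1, 0) ∧
      fderiv ℝ G z (0, 1) = (β (G z).2)⁻¹ • (0, 1) := by
    intro z hz
    have a0 := hαne _ (hGm z hz).1
    have b0 := hβne _ (hGm z hz).2
    have key := (hG z hz).2.2
    rw [(hFd _ (hG z hz).1).fderiv] at key
    have k1 := key (1, 0)
    have k2 := key (0, 1)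
    simp only [ContinuousLinearMap.prod_apply, smul_apply,
      ContinuousLinearMap.coe_fst', ContinuousLinearMap.coe_snd', smul_eq_mul, Prod.mk.injEq,
      mul_eq_zero, a0, b0, false_or] at k1 k2
    constructor
    · refine Prod.ext ?_ (by simpa using k1.2)
      simpa using eq_inv_of_mul_eq_one_right k1.1
    · refine Prod.ext (by simpa using k2.1) ?_
      simpa using eq_inv_of_mul_eq_one_right k2.2
  have hgd : ∀ z ∈ Metric.ball (0 : ℝ × ℝ) δ,
      fderiv ℝ (fun z => f (G z)) z (1, 0) = (α (G z).1)⁻¹ * p (G z) ∧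
      fderiv ℝ (fun z => f (G z)) z (0, 1) = (β (G z).2)⁻¹ * q (G z) := by
    intro z hz
    have : HasFDerivAt (fun z => f (G z)) _ z :=
      (hfd _ (hG z hz).1).hasFDerivAt.comp z (hGd z hz).hasFDerivAt
    rw [this.fderiv, ContinuousLinearMap.comp_apply, ContinuousLinearMap.comp_apply,
      (hG' z hz).1, (hG' z hz).2, map_smul, map_smul]
    exact ⟨rfl, rfl⟩
  have h0δ : (0 : ℝ × ℝ) ∈ Metric.ball (0 : ℝ × ℝ) δ := Metric.mem_ball_self hδ
  -- At the origin X' = 1 and Y' = 1/c. The change of the y-coordinate may therefore reverse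
  -- orientation, and σ = 1/c records the sign relating the products of old and new coordinates.
  refine ⟨δ, hδ, c⁻¹, inv_ne_zero hc0, G, hGs, hG0, fun z hz => (hG z hz).1, hGo, ?_, ?_, ?_, ?_,
    ?_, ?_⟩
  · intro z hz w hw
    have inj : ∀ (Z γ : ℝ → ℝ), (∀ t ∈ Set.Ioo (-ε) ε, HasDerivAt Z (γ t) t) →
        (∀ t ∈ Set.Ioo (-ε) ε, γ t ≠ 0) → ∀ t ∈ Set.Ioo (-ε) ε, ∀ r ∈ Set.Ioo (-ε) ε,
        Z t = Z r → t = r := by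
      intro Z γ hZ hγ t ht r hr h
      obtain ⟨τ, hτ, hτQ, h'⟩ := exists_sub_eq_fderiv_openSegment (convex_Ioo (-ε) ε)
        (fun t ht => (hZ t ht).differentiableAt) ht hr
      rw [(hZ _ hτQ).hasFDerivAt.fderiv, h] at h'
      have : r - t = 0 ∨ γ (t + τ • (r - t)) = 0 := by simpa using h'
      rcases this with h | h
      · linarith
      · exact absurd h (hγ _ hτQ)
    constructor
    · constructor
      · intro h
        refine inj X α hX hαne _ (hGm z hz).1 _ (hGm w hw).1 ?_
        rw [(hX' z hz).1, (hX' w hw).1, h]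
      · intro h
        rw [← (hX' z hz).1, ← (hX' w hw).1, h]
    · constructor
      · intro h
        refine inj Y β hY hβne _ (hGm z hz).2 _ (hGm w hw).2 ?_
        rw [(hX' z hz).2, (hX' w hw).2, h]
      · intro h
        rw [← (hX' z hz).2, ← (hX' w hw).2, h]
  · intro z hz h1 h2
    have g1 : (G z).1 ≠ 0 := fun h => h1 (by rw [← (hX' z hz).1, h, hX0])
    have g2 : (G z).2 ≠ 0 := fun h => h2 (by rw [← (hX' z hz).2, h, hY0])
    have s1 := sgn X α hX0 hX hαpos _ (hGm z hz).1 g1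
    have s2 := sgn Y β hY0 hY hβpos _ (hGm z hz).2 g2
    rw [(hX' z hz).1, hα0] at s1
    rw [(hX' z hz).2, hβ0] at s2
    have := mul_pos s1 s2
    linarith
  · intro z hz
    rw [(hgd z hz).1, (hgd z hz).2]
    exact ⟨mul_ne_zero (inv_ne_zero (hαne _ (hGm z hz).1)) (hfx _ (hG z hz).1),
      mul_ne_zero (inv_ne_zero (hβne _ (hGm z hz).2)) (hfy _ (hG z hz).1)⟩
  · rw [(hgd 0 h0δ).1, hG0, hα0, inv_one, one_mul]; rfl
  · rw [(hgd 0 h0δ).2, hG0, hβ0, inv_inv, hc]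
    exact div_mul_cancel₀ _ (hfy _ h0Q)
  · intro z hz
    obtain ⟨w, hw, h⟩ := exists_second_difference_eq hL (hG z hz).1
    refine ⟨w, hw, ?_⟩
    rw [← h, (hgd z hz).1, (hgd z hz).2]
    have m1 := hm1 (hGm z hz).1
    have m2 := hm2 (hGm z hz).2
    rw [Real.log_mul (inv_ne_zero (hαne _ (hGm z hz).1)) (hfx _ (hG z hz).1),
      Real.log_mul (inv_ne_zero (hβne _ (hGm z hz).2)) (hfy _ (hG z hz).1),
      Real.log_inv, Real.log_inv, hα, hβ]
    simp only
    rw [Real.log_div (div_ne_zero (hfx _ m1) (hfy _ m1)) hc0, Real.log_div (hfx _ m1) (hfy _ m1),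
      Real.log_div (hfy _ m2) (hfx _ m2), hc, Real.log_div (hfx _ h0Q) (hfy _ h0Q)]
    ring

/-- When L_xy vanishes, so does the second difference of L. In normalized coordinates the two
partial derivatives of the third function then agree in absolute value, and near the origin also in
sign, so the web is a web of parallel lines there. -/
theorem exists_isOpen_hexagonsClose {ε : ℝ} (hε : 0 < ε) {f : ℝ × ℝ → ℝ}
    (hf : ContDiffOn ℝ ∞ f (Metric.ball 0 ε))
    (hfx : ∀ z ∈ Metric.ball (0 : ℝ × ℝ) ε, fderiv ℝ f z (1, 0) ≠ 0)
    (hfy : ∀ z ∈ Metric.ball (0 : ℝ × ℝ) ε, fderiv ℝ f z (0, 1) ≠ 0)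
    (hL : ∀ z ∈ Metric.ball (0 : ℝ × ℝ) ε, fderiv ℝ (fun z => fderiv ℝ (fun z =>
      Real.log (fderiv ℝ f z (1, 0)) - Real.log (fderiv ℝ f z (0, 1))) z (1, 0)) z (0, 1) = 0) :
    ∃ O, IsOpen O ∧ (0 : ℝ × ℝ) ∈ O ∧ O ⊆ Metric.ball 0 ε ∧
      HexagonsClose (X := ℝ × ℝ) (Y := ℝ) ![Prod.fst, Prod.snd, f] O := by
  obtain ⟨δ, hδ, σ, hσ, G, hGs, hG0, hGm, hGo, hGi, -, hne, hx0, hy0, hlog⟩ :=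
    exists_normalized_coordinates hε hf hfx hfy
  set g : ℝ × ℝ → ℝ := fun z => f (G z) with hg
  have hgs : ContDiffOn ℝ ∞ g (Metric.ball 0 δ) := hf.comp hGs hGm
  have hgs' := ((contDiffOn_infty_iff_fderiv_of_isOpen Metric.isOpen_ball).1 hgs).2.continuousOn
  have hgd : ∀ z ∈ Metric.ball (0 : ℝ × ℝ) δ, DifferentiableAt ℝ g z := fun z hz =>
    (hgs.contDiffAt (Metric.isOpen_ball.mem_nhds hz)).differentiableAt (by simp)
  have h0 : (0 : ℝ × ℝ) ∈ Metric.ball (0 : ℝ × ℝ) δ := Metric.mem_ball_self hδ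
  have hc : ContinuousAt (fun z => fderiv ℝ g z (1, 0) * fderiv ℝ g z (0, 1)) 0 := by
    have := hgs'.continuousAt (Metric.isOpen_ball.mem_nhds h0)
    exact (this.clm_apply continuousAt_const).mul (this.clm_apply continuousAt_const)
  have hpos : ∀ᶠ z in 𝓝 (0 : ℝ × ℝ), 0 < fderiv ℝ g z (1, 0) * fderiv ℝ g z (0, 1) := by
    refine hc.eventually (lt_mem_nhds ?_)
    change 0 < fderiv ℝ g 0 (1, 0) * fderiv ℝ g 0 (0, 1)
    rw [hy0, hx0]
    exact mul_self_pos.2 (hfx _ (Metric.mem_ball_self hε))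
  obtain ⟨r, hr, hball⟩ := Metric.eventually_nhds_iff_ball.1
    (hpos.and (Metric.isOpen_ball.eventually_mem h0))
  refine ⟨G '' Metric.ball 0 r, hGo _ (fun z hz => (hball z hz).2) Metric.isOpen_ball,
    ⟨0, Metric.mem_ball_self hr, hG0⟩, ?_, ?_⟩
  · rintro _ ⟨z, hz, rfl⟩
    exact hGm (hball z hz).2
  refine HexagonsClose.image (f' := ![Prod.fst, Prod.snd, g]) (hexagonsClose_of_fderiv_eq
    (convex_ball 0 r) (fun z hz => hgd z (hball z hz).2) ?_
    (fun z hz => (hne z (hball z hz).2).1)) ?_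
  · intro z hz
    obtain ⟨w, hw, h⟩ := hlog z (hball z hz).2
    rw [hL w hw, mul_zero, sub_eq_zero] at h
    -- `Real.log` sees only absolute values, so the common sign of the two partial derivatives is
    -- needed to conclude that they are equal.
    have hp := (hball z hz).1
    rcases lt_trichotomy (fderiv ℝ g z (1, 0)) 0 with h1 | h1 | h1
    · have h2 : fderiv ℝ g z (0, 1) < 0 := by
        by_contra! h2
        exact absurd hp (not_lt.2 (mul_nonpos_of_nonpos_of_nonneg h1.le h2))
      rw [← Real.log_neg_eq_log, ← Real.log_neg_eq_log (fderiv ℝ g z (0, 1))] at h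
      exact neg_injective (Real.log_injOn_pos (neg_pos.2 h1) (neg_pos.2 h2) h)
    · rw [h1, zero_mul] at hp; exact absurd hp (lt_irrefl _)
    · exact Real.log_injOn_pos h1 (pos_of_mul_pos_right hp h1.le) h
  · intro ξ z hz w hw
    have := hGi z (hball z hz).2 w (hball w hw).2
    fin_cases ξ
    · exact this.1
    · exact this.2
    · exact Iff.rfl

/-- The number κ carries the sign of L_xy. In normalized coordinates log g_x - log g_y has the sign
of σκ times the product of the coordinates, which produces one of the two spirals. Positivity of f_x
at the origin makes both partial derivatives positive nearby, so their logarithms can be compared.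
-/
theorem not_hexagonsClose_of_fderiv_pos {ε : ℝ} (hε : 0 < ε) {f : ℝ × ℝ → ℝ}
    (hf : ContDiffOn ℝ ∞ f (Metric.ball 0 ε))
    (hfx : ∀ z ∈ Metric.ball (0 : ℝ × ℝ) ε, fderiv ℝ f z (1, 0) ≠ 0)
    (hfy : ∀ z ∈ Metric.ball (0 : ℝ × ℝ) ε, fderiv ℝ f z (0, 1) ≠ 0)
    (hf0 : 0 < fderiv ℝ f 0 (1, 0)) {κ : ℝ}
    (hL : ∀ z ∈ Metric.ball (0 : ℝ × ℝ) ε, 0 < κ * fderiv ℝ (fun z => fderiv ℝ (fun z =>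
      Real.log (fderiv ℝ f z (1, 0)) - Real.log (fderiv ℝ f z (0, 1))) z (1, 0)) z (0, 1)) :
    ¬ HexagonsClose (X := ℝ × ℝ) (Y := ℝ) ![Prod.fst, Prod.snd, f] (Metric.ball 0 ε) := by
  intro hex
  obtain ⟨δ, hδ, σ, hσ, G, hGs, hG0, hGm, hGo, hGi, hsgn, hne, hx0, hy0, hlog⟩ :=
    exists_normalized_coordinates hε hf hfx hfy
  set g : ℝ × ℝ → ℝ := fun z => f (G z) with hg
  have hgs : ContDiffOn ℝ ∞ g (Metric.ball 0 δ) := hf.comp hGs hGm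
  have hgs' := ((contDiffOn_infty_iff_fderiv_of_isOpen Metric.isOpen_ball).1 hgs).2.continuousOn
  have hgd : ∀ z ∈ Metric.ball (0 : ℝ × ℝ) δ, DifferentiableAt ℝ g z := fun z hz =>
    (hgs.contDiffAt (Metric.isOpen_ball.mem_nhds hz)).differentiableAt (by simp)
  have h0 : (0 : ℝ × ℝ) ∈ Metric.ball (0 : ℝ × ℝ) δ := Metric.mem_ball_self hδ
  have hcx : ContinuousAt (fun z => fderiv ℝ g z (1, 0)) 0 :=
    (hgs'.continuousAt (Metric.isOpen_ball.mem_nhds h0)).clm_apply continuousAt_const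
  have hcy : ContinuousAt (fun z => fderiv ℝ g z (0, 1)) 0 :=
    (hgs'.continuousAt (Metric.isOpen_ball.mem_nhds h0)).clm_apply continuousAt_const
  -- Both partial derivatives of `g` equal f_x at the origin, so by continuity their ratio stays
  -- between 1/2 and 2 nearby, as the spiral construction requires.
  have e1 : ∀ᶠ z in 𝓝 (0 : ℝ × ℝ), 0 < 2 * fderiv ℝ g z (0, 1) - fderiv ℝ g z (1, 0) := by
    refine ((continuousAt_const.mul hcy).sub hcx).eventually (lt_mem_nhds ?_)
    change 0 < 2 * fderiv ℝ g 0 (0, 1) - fderiv ℝ g 0 (1, 0)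
    rw [hx0, hy0]
    linarith
  have e2 : ∀ᶠ z in 𝓝 (0 : ℝ × ℝ), 0 < 2 * fderiv ℝ g z (1, 0) - fderiv ℝ g z (0, 1) := by
    refine ((continuousAt_const.mul hcx).sub hcy).eventually (lt_mem_nhds ?_)
    change 0 < 2 * fderiv ℝ g 0 (1, 0) - fderiv ℝ g 0 (0, 1)
    rw [hx0, hy0]
    linarith
  obtain ⟨r, hr, hball⟩ := Metric.eventually_nhds_iff_ball.1
    (e1.and (e2.and (Metric.isOpen_ball.eventually_mem h0)))
  have hexg : HexagonsClose (X := ℝ × ℝ) (Y := ℝ) ![Prod.fst, Prod.snd, g] (Metric.ball 0 r) := by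
    refine hex.comap (fun z hz => hGm (hball z hz).2.2) ?_
    intro ξ z hz w hw
    have := hGi z (hball z hz).2.2 w (hball w hw).2.2
    fin_cases ξ
    · exact this.1
    · exact this.2
    · exact Iff.rfl
  have hd := fun z hz => hgd z (hball z hz).2.2
  have hx : ∀ z ∈ Metric.ball (0 : ℝ × ℝ) r, fderiv ℝ g z (1, 0) < 2 * fderiv ℝ g z (0, 1) :=
    fun z hz => by linarith [(hball z hz).1]
  have hy : ∀ z ∈ Metric.ball (0 : ℝ × ℝ) r, fderiv ℝ g z (0, 1) < 2 * fderiv ℝ g z (1, 0) :=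
    fun z hz => by linarith [(hball z hz).2.1]
  have key : ∀ z ∈ Metric.ball (0 : ℝ × ℝ) r, z.1 * z.2 ≠ 0 →
      0 < (σ * κ) * ((z.1 * z.2) * (Real.log (fderiv ℝ g z (1, 0)) -
        Real.log (fderiv ℝ g z (0, 1)))) := by
    intro z hz hzz
    obtain ⟨w, hw, h⟩ := hlog z (hball z hz).2.2
    rw [h]
    have := mul_pos (hsgn z (hball z hz).2.2 (left_ne_zero_of_mul hzz) (right_ne_zero_of_mul hzz))
      (hL w hw)
    linarith
  have hκ : κ ≠ 0 := by
    rintro rfl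
    simpa using hL 0 (Metric.mem_ball_self hε)
  have px : ∀ z ∈ Metric.ball (0 : ℝ × ℝ) r, 0 < fderiv ℝ g z (1, 0) :=
    fun z hz => by linarith [hx z hz, hy z hz]
  have py : ∀ z ∈ Metric.ball (0 : ℝ × ℝ) r, 0 < fderiv ℝ g z (0, 1) :=
    fun z hz => by linarith [hx z hz, hy z hz]
  have lt_of : ∀ a b c : ℝ, 0 < a → 0 < b → 0 < c → 0 < c * (Real.log a - Real.log b) → b < a := by
    intro a b c ha hb hc h
    exact (Real.log_lt_log_iff hb ha).1 (sub_pos.1 (pos_of_mul_pos_right h hc.le))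
  rcases lt_or_gt_of_ne (mul_ne_zero hσ hκ) with hs | hs
  · refine not_hexagonsClose_of_fderiv_gt hr hd hx hy (fun z hz h => ?_) (fun z hz h => ?_) hexg
    · refine lt_of _ _ (-(σ * κ) * (z.1 * z.2)) (py z hz) (px z hz)
        (mul_pos (neg_pos.2 hs) h) ?_
      linarith [key z hz h.ne']
    · refine lt_of _ _ ((σ * κ) * (z.1 * z.2)) (px z hz) (py z hz)
        (mul_pos_of_neg_of_neg hs h) ?_
      linarith [key z hz h.ne]
  · refine not_hexagonsClose_of_fderiv_lt hr hd hx hy (fun z hz h => ?_) (fun z hz h => ?_) hexg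
    · refine lt_of _ _ ((σ * κ) * (z.1 * z.2)) (px z hz) (py z hz) (mul_pos hs h) ?_
      linarith [key z hz h.ne']
    · refine lt_of _ _ ((σ * κ) * -(z.1 * z.2)) (py z hz) (px z hz)
        (mul_pos hs (neg_pos.2 h)) ?_
      linarith [key z hz h.ne]

/-- If the curvature of a planar three-web has constant sign, then some hexagon does not close. -/
theorem not_hexagonsClose_of_curvature {ε : ℝ} (hε : 0 < ε) {f : ℝ × ℝ → ℝ}
    (hf : ContDiffOn ℝ ∞ f (Metric.ball 0 ε))
    (hfx : ∀ z ∈ Metric.ball (0 : ℝ × ℝ) ε, fderiv ℝ f z (1, 0) ≠ 0)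
    (hfy : ∀ z ∈ Metric.ball (0 : ℝ × ℝ) ε, fderiv ℝ f z (0, 1) ≠ 0) {κ : ℝ}
    (hL : ∀ z ∈ Metric.ball (0 : ℝ × ℝ) ε, 0 < κ * fderiv ℝ (fun z => fderiv ℝ (fun z =>
      Real.log (fderiv ℝ f z (1, 0)) - Real.log (fderiv ℝ f z (0, 1))) z (1, 0)) z (0, 1)) :
    ¬ HexagonsClose (X := ℝ × ℝ) (Y := ℝ) ![Prod.fst, Prod.snd, f] (Metric.ball 0 ε) := by
  intro hex
  -- Passing from f to -f changes neither the level lines nor the logarithms, since `Real.log` is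
  -- even.
  rcases lt_or_gt_of_ne (hfx 0 (Metric.mem_ball_self hε)) with h0 | h0
  · have hneg : ∀ z v, fderiv ℝ (fun z => -f z) z v = -fderiv ℝ f z v := fun z v => by
      rw [fderiv_fun_neg]; rfl
    refine not_hexagonsClose_of_fderiv_pos hε hf.neg (fun z hz => ?_) (fun z hz => ?_) ?_
      (κ := κ) (fun z hz => ?_) (hex.comap (G := id) (fun z hz => hz) fun ξ z _ w _ => ?_)
    · rw [hneg]; exact neg_ne_zero.2 (hfx z hz)
    · rw [hneg]; exact neg_ne_zero.2 (hfy z hz)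
    · rw [hneg]; exact neg_pos.2 h0
    · simp only [hneg, Real.log_neg_eq_log]
      exact hL z hz
    · fin_cases ξ <;> simp
  · exact not_hexagonsClose_of_fderiv_pos hε hf hfx hfy h0 hL hex

/-! ### One-forms and the exterior derivative -/

namespace OneForm

variable {E : Type*} [NormedAddCommGroup E] [NormedSpace ℝ E]

theorem d_apply {η : OneForm E} {x : E} (h : DifferentiableAt ℝ η x) (v w : E) :
    η.d x v w = fderiv ℝ η x v w - fderiv ℝ η x w v := by
  have hd : HasFDerivAt (fun y => ContinuousAlternatingMap.ofSubsingleton ℝ E ℝ (0 : Fin 1) (η y))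
      (((ContinuousAlternatingMap.ofSubsingletonLIE (𝕜 := ℝ) (E := E) (F := ℝ)
        (0 : Fin 1)).toContinuousLinearEquiv.toContinuousLinearMap).comp (fderiv ℝ η x)) x :=
    (ContinuousAlternatingMap.ofSubsingletonLIE (𝕜 := ℝ) (E := E) (F := ℝ)
        (0 : Fin 1)).toContinuousLinearEquiv.hasFDerivAt.comp x h.hasFDerivAt
  unfold d
  rw [extDeriv_apply hd.differentiableAt]
  have key : ∀ u : Fin 1 → E, fderiv ℝ (fun y =>
      ContinuousAlternatingMap.ofSubsingleton ℝ E ℝ (0 : Fin 1) (η y) u) x =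
      (fderiv ℝ η x).flip (u 0) := by
    intro u
    exact (h.hasFDerivAt.clm_apply (hasFDerivAt_const (u 0) x)).fderiv.trans (by ext; simp)
  simp only [key]
  simp [Fin.sum_univ_two, Fin.removeNth, sub_eq_add_neg]

/-- A linear combination of 1-forms with constant coefficients. -/
def comb {ι : Type*} [Fintype ι] (c : ι → ℝ) (η : ι → OneForm E) : OneForm E :=
  fun x => ∑ i, c i • η i x

theorem comb_apply {ι : Type*} [Fintype ι] (c : ι → ℝ) (η : ι → OneForm E) (x v : E) :
    comb c η x v = ∑ i, c i * η i x v := by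
  simp [comb]

theorem contDiffOn_comb {ι : Type*} [Fintype ι] {c : ι → ℝ} {η : ι → OneForm E} {U : Set E}
    (h : ∀ i, ContDiffOn ℝ ∞ (η i) U) : ContDiffOn ℝ ∞ (comb c η) U :=
  ContDiffOn.sum fun i _ => (h i).const_smul (c i)

theorem d_comb {ι : Type*} [Fintype ι] {c : ι → ℝ} {η : ι → OneForm E} {x : E}
    (h : ∀ i, DifferentiableAt ℝ (η i) x) (v w : E) :
    (comb c η).d x v w = ∑ i, c i * (η i).d x v w := by
  have hd : HasFDerivAt (comb c η) (∑ i, c i • fderiv ℝ (η i) x) x :=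
    HasFDerivAt.fun_sum fun i _ => (h i).hasFDerivAt.const_smul (c i)
  rw [d_apply hd.differentiableAt, hd.fderiv]
  simp only [fun i => d_apply (h i) v w, sum_apply, smul_apply,
    smul_eq_mul, mul_sub, Finset.sum_sub_distrib]

/-- The exterior derivative commutes with pullbacks. -/
theorem fderiv_pullback_sub {T : Type*} [NormedAddCommGroup T] [NormedSpace ℝ T] {η : OneForm E}
    {Φ : T → E} {z : T} (hη : DifferentiableAt ℝ η (Φ z)) (hΦ : ContDiffAt ℝ ∞ Φ z) (v w : T) :
    fderiv ℝ (fun z => η (Φ z) (fderiv ℝ Φ z w)) z v -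
      fderiv ℝ (fun z => η (Φ z) (fderiv ℝ Φ z v)) z w =
    η.d (Φ z) (fderiv ℝ Φ z v) (fderiv ℝ Φ z w) := by
  have hΦ' : DifferentiableAt ℝ (fderiv ℝ Φ) z :=
    (hΦ.fderiv_right (m := 1) (by norm_num; exact ENat.LEInfty.out)).differentiableAt (by simp)
  have hc : HasFDerivAt (fun z => η (Φ z)) ((fderiv ℝ η (Φ z)).comp (fderiv ℝ Φ z)) z :=
    hη.hasFDerivAt.comp z (hΦ.differentiableAt (by simp)).hasFDerivAt
  -- The second derivative of Φ enters both terms of the difference through η(D²Φ(v, w)) and cancels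
  -- by symmetry.
  have key : ∀ u t : T, fderiv ℝ (fun z => η (Φ z) (fderiv ℝ Φ z u)) z t =
      η (Φ z) (fderiv ℝ (fderiv ℝ Φ) z t u) +
        fderiv ℝ η (Φ z) (fderiv ℝ Φ z t) (fderiv ℝ Φ z u) := by
    intro u t
    rw [(hc.clm_apply (hΦ'.hasFDerivAt.clm_apply (hasFDerivAt_const u z))).fderiv]
    simp
  have hsymm : IsSymmSndFDerivAt ℝ Φ z := hΦ.isSymmSndFDerivAt (by simpa using ENat.LEInfty.out)
  rw [key, key, d_apply hη, hsymm.eq v w]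
  ring

end OneForm

/-! ### Structure equations along a constant direction -/

namespace ThreeWeb

variable {E : Type*} [NormedAddCommGroup E] [NormedSpace ℝ E] {U : Set E}

/-- The 1-form `e_2 ω_ξ^1 - e_1 ω_ξ^2`, which vanishes where `ω_ξ` is proportional to `e`. -/
def conormal (W : ThreeWeb U) (e : Fin 2 → ℝ) (ξ : Fin 3) : OneForm E :=
  OneForm.comb ![e 1, -e 0] (W.form ξ)

/-- The 1-form `d_1 ω_ξ^1 + d_2 ω_ξ^2`; if `d_1 e_1 + d_2 e_2 = 1` then it is the coordinate of
`ω_ξ` with respect to `e` where `ω_ξ` is proportional to `e`. -/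
def tangential (W : ThreeWeb U) (d : Fin 2 → ℝ) (ξ : Fin 3) : OneForm E :=
  OneForm.comb d (W.form ξ)

theorem conormal_apply (W : ThreeWeb U) (e : Fin 2 → ℝ) (ξ : Fin 3) (x v : E) :
    W.conormal e ξ x v = e 1 * W.form ξ 0 x v - e 0 * W.form ξ 1 x v := by
  simp [conormal, OneForm.comb_apply, Fin.sum_univ_two, sub_eq_add_neg]

theorem tangential_apply (W : ThreeWeb U) (d : Fin 2 → ℝ) (ξ : Fin 3) (x v : E) :
    W.tangential d ξ x v = d 0 * W.form ξ 0 x v + d 1 * W.form ξ 1 x v := by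
  simp [tangential, OneForm.comb_apply, Fin.sum_univ_two]

theorem contDiffOn_tangential (W : ThreeWeb U) (d : Fin 2 → ℝ) (ξ : Fin 3) :
    ContDiffOn ℝ ∞ (W.tangential d ξ) U :=
  OneForm.contDiffOn_comb fun i => W.smooth ξ i

theorem contDiffOn_conormal (W : ThreeWeb U) (e : Fin 2 → ℝ) (ξ : Fin 3) :
    ContDiffOn ℝ ∞ (W.conormal e ξ) U :=
  OneForm.contDiffOn_comb fun i => W.smooth ξ i

/-- The vectors `e` and `d` decompose ℝ² into the line of `e` and the kernel of `d`; vanishing of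
the conormal part leaves only the component along `e`. -/
theorem form_eq_of_conormal_eq_zero (W : ThreeWeb U) {e d : Fin 2 → ℝ}
    (hde : d 0 * e 0 + d 1 * e 1 = 1) {ξ : Fin 3} {x v : E} (h : W.conormal e ξ x v = 0)
    (i : Fin 2) : W.form ξ i x v = e i * W.tangential d ξ x v := by
  rw [conormal_apply] at h
  rw [tangential_apply]
  fin_cases i <;> simp only [Fin.zero_eta, Fin.mk_one]
  · linear_combination (-W.form ξ 0 x v) * hde + d 1 * h
  · linear_combination (-W.form ξ 1 x v) * hde - d 0 * h

theorem form_two_apply (W : ThreeWeb U) {x : E} (hx : x ∈ U) (i : Fin 2) (v : E) :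
    W.form 2 i x v = -(W.form 0 i x v + W.form 1 i x v) := by
  have := congrArg (fun A : E →L[ℝ] ℝ => A v) (W.sum_eq_zero i x hx)
  simp only [add_apply, zero_apply] at this
  linarith

theorem tangential_two (W : ThreeWeb U) (d : Fin 2 → ℝ) {x : E} (hx : x ∈ U) (v : E) :
    W.tangential d 2 x v = -(W.tangential d 0 x v + W.tangential d 1 x v) := by
  simp only [tangential_apply, form_two_apply W hx]
  ring

/-- The components of a vector in the coframe of a web can be prescribed. -/
theorem exists_form_eq (hE : Module.finrank ℝ E = 4) (W : ThreeWeb U) {x : E} (hx : x ∈ U)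
    (r : Fin 2 → Fin 2 → ℝ) : ∃! v : E, ∀ α i : Fin 2, W.form α.castSucc i x v = r α i := by
  have : FiniteDimensional ℝ E := Module.finite_of_finrank_pos (by omega)
  let A : E →ₗ[ℝ] (Fin 2 × Fin 2 → ℝ) :=
    LinearMap.pi fun p => (W.form p.1.castSucc p.2 x : E →ₗ[ℝ] ℝ)
  have hdim : Module.finrank ℝ E = Module.finrank ℝ (Fin 2 × Fin 2 → ℝ) := by simp [hE]
  -- A functional vanishing on a proper range would be a nontrivial linear relation between the four
  -- coframe forms.
  have hsurj : Function.Surjective A := by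
    rw [← LinearMap.range_eq_top]
    by_contra hne
    obtain ⟨g, hg0, hg⟩ := Submodule.exists_le_ker_of_lt_top _ (lt_top_iff_ne_top.2 hne)
    have hcomb : ∑ p : Fin 2 × Fin 2, g (fun q => if p = q then 1 else 0) • W.form p.1.castSucc p.2 x = 0 := by
      ext v
      have h0 : g (A v) = 0 := hg ⟨v, rfl⟩
      rw [LinearMap.pi_apply_eq_sum_univ] at h0
      simpa [A, mul_comm, Fintype.sum_prod_type] using h0
    have := Fintype.linearIndependent_iff.1 (W.coframe x hx) _ hcomb
    refine hg0 (LinearMap.pi_ext' fun p => LinearMap.ext_ring ?_)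
    have hp : (fun q => if p = q then (1 : ℝ) else 0) = Pi.single p 1 := by
      ext q
      simp [Pi.single_apply, eq_comm]
    simpa [hp] using this p
  have hinj : Function.Injective A :=
    (LinearMap.injective_iff_surjective_of_finrank_eq_finrank hdim).2 hsurj
  obtain ⟨v, hv⟩ := hsurj fun p => r p.1 p.2
  refine ⟨v, fun α i => congrFun hv (α, i), fun w hw => hinj ?_⟩
  rw [hv]
  ext p
  exact hw p.1 p.2

theorem eq_zero_of_form_eq_zero (hE : Module.finrank ℝ E = 4) (W : ThreeWeb U) {x : E}
    (hx : x ∈ U) {v : E} (h : ∀ α i : Fin 2, W.form α.castSucc i x v = 0) : v = 0 :=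
  (exists_form_eq hE W hx fun _ _ => 0).unique h fun α i => by simp

/-- The connection form of the webs cut on the surfaces with `ω_ξ` proportional to `e`. -/
def tangentialConnection (θ : Fin 2 → Fin 2 → OneForm E) (d e : Fin 2 → ℝ) : OneForm E :=
  OneForm.comb (fun p : Fin 2 × Fin 2 => d p.2 * e p.1) (fun p => θ p.1 p.2)

theorem tangentialConnection_apply (θ : Fin 2 → Fin 2 → OneForm E) (d e : Fin 2 → ℝ) (x v : E) :
    tangentialConnection θ d e x v = d 0 * e 0 * θ 0 0 x v + d 1 * e 0 * θ 0 1 x v +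
      d 0 * e 1 * θ 1 0 x v + d 1 * e 1 * θ 1 1 x v := by
  simp only [tangentialConnection, OneForm.comb_apply, Fintype.sum_prod_type, Fin.sum_univ_two]
  ring

/-- The cubic `b^i_{jkl} e^j e^k e^l`. -/
def cubic (b : Fin 2 → Fin 2 → Fin 2 → Fin 2 → E → ℝ) (e : Fin 2 → ℝ) (i : Fin 2) (x : E) : ℝ :=
  ∑ j, ∑ k, ∑ l, b i j k l x * e j * e k * e l

section Structure

variable {W : ThreeWeb U} {θ : Fin 2 → Fin 2 → OneForm E} {a : Fin 2 → E → ℝ}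
  {b : Fin 2 → Fin 2 → Fin 2 → Fin 2 → E → ℝ} {d e : Fin 2 → ℝ} {x : E}

/-- This is the linear ODE for the conormal form along a leaf of λ_α. For `v` tangent to the leaf
the torsion terms drop out, and what remains is a combination of ω_α^j(w) with coefficients P_j =
e^2 ω_j^1(v) - e^1 ω_j^2(v). Parallelism means e^j P_j = 0, so (P_1, P_2) is a multiple of (e^2,
-e^1); contraction with `d` recovers the factor. -/
theorem d_conormal (hU : IsOpen U) (hx : x ∈ U) (hθ : W.IsConnection θ a)
    (hde : d 0 * e 0 + d 1 * e 1 = 1)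
    (hθe : ∀ v, e 0 * (e 1 * θ 0 0 x v - e 0 * θ 0 1 x v) +
      e 1 * (e 1 * θ 1 0 x v - e 0 * θ 1 1 x v) = 0)
    {α : Fin 2} {v : E} (hv : ∀ i, W.form α.castSucc i x v = 0) (w : E) :
    (W.conormal e α.castSucc).d x v w = -(W.conormal e α.castSucc x w *
      (d 1 * (e 1 * θ 0 0 x v - e 0 * θ 0 1 x v) - d 0 * (e 1 * θ 1 0 x v - e 0 * θ 1 1 x v))) := by
  have hd : ∀ i, DifferentiableAt ℝ (W.form α.castSucc i) x := fun i =>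
    ((W.smooth _ i).contDiffAt (hU.mem_nhds hx)).differentiableAt (by simp)
  obtain ⟨-, -, hs⟩ := hθ
  have h0 := hs x hx v w 0
  have h1 := hs x hx v w 1
  rw [conormal, OneForm.d_comb hd]
  have h0v := hv 0
  have h1v := hv 1
  have hθv := hθe v
  simp only [Fin.sum_univ_two, OneForm.wedge, OneForm.comb_apply, Matrix.cons_val_zero,
    Matrix.cons_val_one] at *
  fin_cases α <;> simp only [Fin.zero_eta, Fin.mk_one, Fin.castSucc_zero, Fin.castSucc_one] at *
  · rw [h0.1, h1.1, h0v, h1v]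
    linear_combination ((e 1 * θ 0 0 x v - e 0 * θ 0 1 x v) * W.form 0 0 x w +
      (e 1 * θ 1 0 x v - e 0 * θ 1 1 x v) * W.form 0 1 x w) * hde -
      (d 0 * W.form 0 0 x w + d 1 * W.form 0 1 x w) * hθv
  · rw [h0.2, h1.2, h0v, h1v]
    linear_combination ((e 1 * θ 0 0 x v - e 0 * θ 0 1 x v) * W.form 1 0 x w +
      (e 1 * θ 1 0 x v - e 0 * θ 1 1 x v) * W.form 1 1 x w) * hde -
      (d 0 * W.form 1 0 x w + d 1 * W.form 1 1 x w) * hθv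

/-- On vectors where ω_α = e σ_α, each product ω_α^j ∧ ω_α^i is a multiple of σ_α ∧ σ_α = 0. The
torsion therefore disappears, and both families obey the same equation dσ_α = σ_α ∧ Θ. Parallelism
of `e` is not needed for this. -/
theorem d_tangential (hU : IsOpen U) (hx : x ∈ U) (hθ : W.IsConnection θ a)
    (hde : d 0 * e 0 + d 1 * e 1 = 1) {α : Fin 2} {v w : E}
    (hv : W.conormal e α.castSucc x v = 0) (hw : W.conormal e α.castSucc x w = 0) :
    (W.tangential d α.castSucc).d x v w =
      (W.tangential d α.castSucc).wedge (tangentialConnection θ d e) x v w := by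
  have hd : ∀ i, DifferentiableAt ℝ (W.form α.castSucc i) x := fun i =>
    ((W.smooth _ i).contDiffAt (hU.mem_nhds hx)).differentiableAt (by simp)
  obtain ⟨-, -, hs⟩ := hθ
  have h0 := hs x hx v w 0
  have h1 := hs x hx v w 1
  have hv' := W.form_eq_of_conormal_eq_zero hde hv
  have hw' := W.form_eq_of_conormal_eq_zero hde hw
  generalize ht : W.tangential d α.castSucc = η at hv' hw'
  rw [← ht, tangential, OneForm.d_comb hd, ← tangential, ht]
  simp only [Fin.sum_univ_two, OneForm.wedge, tangentialConnection_apply] at *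
  fin_cases α <;> simp only [Fin.zero_eta, Fin.mk_one, Fin.castSucc_zero, Fin.castSucc_one] at *
  · rw [h0.1, h1.1]
    simp only [hv', hw']
    ring
  · rw [h0.2, h1.2]
    simp only [hv', hw']
    ring

/-- Parallelism in solved form: the covariant derivative of `e` is e ⊗ Θ. -/
theorem sum_smul_connection (hde : d 0 * e 0 + d 1 * e 1 = 1) {v : E}
    (hθe : e 0 * (e 1 * θ 0 0 x v - e 0 * θ 0 1 x v) +
      e 1 * (e 1 * θ 1 0 x v - e 0 * θ 1 1 x v) = 0) (k : Fin 2) :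
    e 0 * θ 0 k x v + e 1 * θ 1 k x v = e k * tangentialConnection θ d e x v := by
  rw [tangentialConnection_apply]
  fin_cases k <;> simp only [Fin.zero_eta, Fin.mk_one]
  · linear_combination (-(e 0 * θ 0 0 x v + e 1 * θ 1 0 x v)) * hde + d 1 * hθe
  · linear_combination (-(e 0 * θ 0 1 x v + e 1 * θ 1 1 x v)) * hde - d 0 * hθe

/-- Contracting the curvature equation with c_i e^j and inserting e^j ω_j^k = e^k Θ turns the
quadratic term into Θ ∧ (c_i e^k ω_k^i), while ω_α = e σ_α turns the curvature term into the cubic.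
The covector `c` is left free because two choices matter: c = d gives the curvature of the planar
web, and c = (e^2, -e^1) gives the conormal part of the cubic. -/
theorem d_connection_comb (hU : IsOpen U) (hx : x ∈ U) (hθ : W.IsConnection θ a)
    (hb : W.IsCurvature θ b) (hde : d 0 * e 0 + d 1 * e 1 = 1)
    (hθe : ∀ v, e 0 * (e 1 * θ 0 0 x v - e 0 * θ 0 1 x v) +
      e 1 * (e 1 * θ 1 0 x v - e 0 * θ 1 1 x v) = 0) (c : Fin 2 → ℝ) {v w : E}
    (hv : ∀ α : Fin 2, W.conormal e α.castSucc x v = 0)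
    (hw : ∀ α : Fin 2, W.conormal e α.castSucc x w = 0) :
    (tangentialConnection θ c e).d x v w =
      (tangentialConnection θ d e).wedge (tangentialConnection θ c e) x v w +
      (c 0 * cubic b e 0 x + c 1 * cubic b e 1 x) *
        (W.tangential d 0).wedge (W.tangential d 1) x v w := by
  have hd : ∀ p : Fin 2 × Fin 2, DifferentiableAt ℝ (θ p.1 p.2) x := fun p =>
    ((hθ.1 _ _).contDiffAt (hU.mem_nhds hx)).differentiableAt (by simp)
  rw [tangentialConnection, OneForm.d_comb hd, ← tangentialConnection]
  have hb' : ∀ i j, (θ j i).d x v w = _ := fun i j => eq_add_of_sub_eq (hb x hx v w i j)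
  have k0v := sum_smul_connection (θ := θ) hde (hθe v) 0
  have k1v := sum_smul_connection (θ := θ) hde (hθe v) 1
  have k0w := sum_smul_connection (θ := θ) hde (hθe w) 0
  have k1w := sum_smul_connection (θ := θ) hde (hθe w) 1
  have f0v := W.form_eq_of_conormal_eq_zero hde (hv 0)
  have f1v := W.form_eq_of_conormal_eq_zero hde (hv 1)
  have f0w := W.form_eq_of_conormal_eq_zero hde (hw 0)
  have f1w := W.form_eq_of_conormal_eq_zero hde (hw 1)
  simp only [Fin.castSucc_zero, Fin.castSucc_one] at f0v f1v f0w f1w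
  rw [tangentialConnection_apply θ d e x v] at k0v k1v
  rw [tangentialConnection_apply θ d e x w] at k0w k1w
  simp only [Fintype.sum_prod_type, hb', Fin.sum_univ_two, OneForm.wedge, f0v, f1v, f0w, f1w,
    tangentialConnection_apply, cubic]
  linear_combination c 0 * (θ 0 0 x w * k0v + θ 1 0 x w * k1v - θ 0 0 x v * k0w - θ 1 0 x v * k1w) +
    c 1 * (θ 0 1 x w * k0v + θ 1 1 x w * k1v - θ 0 1 x v * k0w - θ 1 1 x v * k1w)

end Structure

end ThreeWeb

/-! ### The planar webs cut on integral surfaces and their curvature -/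

namespace ThreeWeb

variable {E : Type*} [NormedAddCommGroup E] [NormedSpace ℝ E] {U : Set E}
  {W : ThreeWeb U} {θ : Fin 2 → Fin 2 → OneForm E} {a : Fin 2 → E → ℝ}
  {b : Fin 2 → Fin 2 → Fin 2 → Fin 2 → E → ℝ} {d e : Fin 2 → ℝ}

theorem contDiffOn_tangentialConnection (hθ : W.IsConnection θ a) (d e : Fin 2 → ℝ) :
    ContDiffOn ℝ ∞ (tangentialConnection θ d e) U :=
  OneForm.contDiffOn_comb fun p => hθ.1 p.1 p.2

/-- The cubic `b^i_{jkl} e^j e^k e^l` is proportional to `e`. -/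
theorem cubic_eq (hE : Module.finrank ℝ E = 4) (hU : IsOpen U) (hθ : W.IsConnection θ a)
    (hb : W.IsCurvature θ b) (hde : d 0 * e 0 + d 1 * e 1 = 1)
    (hθe : ∀ x ∈ U, ∀ v, e 0 * (e 1 * θ 0 0 x v - e 0 * θ 0 1 x v) +
      e 1 * (e 1 * θ 1 0 x v - e 0 * θ 1 1 x v) = 0) {x : E} (hx : x ∈ U) (i : Fin 2) :
    cubic b e i x = e i * (d 0 * cubic b e 0 x + d 1 * cubic b e 1 x) := by
  -- By parallelism the conormal component of e^j ω_j^i vanishes identically, hence so does its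
  -- exterior derivative. The conormal part of the cubic is then read off on vectors `v`, `w` with
  -- (σ_1 ∧ σ_2)(v, w) = 1.
  have hz : ∀ y ∈ U, tangentialConnection θ ![e 1, -e 0] e y = 0 := by
    intro y hy
    ext v
    rw [tangentialConnection_apply]
    simp only [Matrix.cons_val_zero, Matrix.cons_val_one, zero_apply]
    linear_combination hθe y hy v
  obtain ⟨v, hv, -⟩ := exists_form_eq hE W hx ![e, 0]
  obtain ⟨w, hw, -⟩ := exists_form_eq hE W hx ![0, e]
  have v00 := hv 0 0
  have v01 := hv 0 1
  have v10 := hv 1 0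
  have v11 := hv 1 1
  have w00 := hw 0 0
  have w01 := hw 0 1
  have w10 := hw 1 0
  have w11 := hw 1 1
  simp only [Fin.castSucc_zero, Fin.castSucc_one, Matrix.cons_val_zero, Matrix.cons_val_one,
    Pi.zero_apply] at v00 v01 v10 v11 w00 w01 w10 w11
  have hcv : ∀ α : Fin 2, W.conormal e α.castSucc x v = 0 := by
    intro α
    rw [conormal_apply]
    fin_cases α
    · simp [v00, v01, mul_comm]
    · simp [v10, v11]
  have hcw : ∀ α : Fin 2, W.conormal e α.castSucc x w = 0 := by
    intro α
    rw [conormal_apply]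
    fin_cases α
    · simp [w00, w01]
    · simp [w10, w11, mul_comm]
  have key := d_connection_comb hU hx hθ hb hde (hθe x hx) ![e 1, -e 0] hcv hcw
  have hd : DifferentiableAt ℝ (tangentialConnection θ ![e 1, -e 0] e) x :=
    ((contDiffOn_tangentialConnection hθ _ _).contDiffAt (hU.mem_nhds hx)).differentiableAt
      (by simp)
  have hf : fderiv ℝ (tangentialConnection θ ![e 1, -e 0] e) x = 0 := by
    rw [Filter.EventuallyEq.fderiv_eq (f := fun _ => (0 : E →L[ℝ] ℝ))
      (Filter.eventually_of_mem (hU.mem_nhds hx) hz)]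
    simp
  rw [OneForm.d_apply hd, hf] at key
  simp only [OneForm.wedge, hz x hx, tangential_apply, v00, v01, v10, v11, w00, w01, w10, w11,
    Matrix.cons_val_zero, Matrix.cons_val_one, zero_apply, mul_zero,
    add_zero, sub_zero, zero_add] at key
  rw [hde] at key
  fin_cases i <;> simp only [Fin.zero_eta, Fin.mk_one]
  · linear_combination (-cubic b e 0 x) * hde - d 1 * key
  · linear_combination (-cubic b e 1 x) * hde + d 0 * key

/-- For c = d the quadratic term is Θ ∧ Θ = 0; what is left is the curvature of the planar web. -/
theorem d_tangentialConnection (hU : IsOpen U) {x : E} (hx : x ∈ U) (hθ : W.IsConnection θ a)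
    (hb : W.IsCurvature θ b) (hde : d 0 * e 0 + d 1 * e 1 = 1)
    (hθe : ∀ v, e 0 * (e 1 * θ 0 0 x v - e 0 * θ 0 1 x v) +
      e 1 * (e 1 * θ 1 0 x v - e 0 * θ 1 1 x v) = 0) {v w : E}
    (hv : ∀ α : Fin 2, W.conormal e α.castSucc x v = 0)
    (hw : ∀ α : Fin 2, W.conormal e α.castSucc x w = 0) :
    (tangentialConnection θ d e).d x v w = (d 0 * cubic b e 0 x + d 1 * cubic b e 1 x) *
        (W.tangential d 0).wedge (W.tangential d 1) x v w := by
  rw [d_connection_comb hU hx hθ hb hde hθe d hv hw]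
  simp only [OneForm.wedge]
  ring

/-- The curvature of the planar web cut on a surface with `ω_α` proportional to `e`, computed in
coordinates that are constant on the lines of the first two families. -/
theorem mixed_fderiv_log_eq (hU : IsOpen U) (hθ : W.IsConnection θ a)
    (hb : W.IsCurvature θ b) (hde : d 0 * e 0 + d 1 * e 1 = 1)
    (hθe : ∀ x ∈ U, ∀ v, e 0 * (e 1 * θ 0 0 x v - e 0 * θ 0 1 x v) +
      e 1 * (e 1 * θ 1 0 x v - e 0 * θ 1 1 x v) = 0)
    {Q : Set (ℝ × ℝ)} (hQ : IsOpen Q) {Φ : ℝ × ℝ → E} (hΦ : ContDiffOn ℝ ∞ Φ Q)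
    (hΦU : Set.MapsTo Φ Q U)
    (hcon : ∀ z ∈ Q, ∀ w, ∀ α : Fin 2, W.conormal e α.castSucc (Φ z) (fderiv ℝ Φ z w) = 0)
    (h0 : ∀ z ∈ Q, W.tangential d 0 (Φ z) (fderiv ℝ Φ z (0, 1)) = 0)
    (h1 : ∀ z ∈ Q, W.tangential d 1 (Φ z) (fderiv ℝ Φ z (1, 0)) = 0)
    (hp : ∀ z ∈ Q, W.tangential d 0 (Φ z) (fderiv ℝ Φ z (1, 0)) ≠ 0)
    (hq : ∀ z ∈ Q, W.tangential d 1 (Φ z) (fderiv ℝ Φ z (0, 1)) ≠ 0)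
    {f : ℝ × ℝ → ℝ}
    (hfx : ∀ z ∈ Q, fderiv ℝ f z (1, 0) ≠ 0) (hfy : ∀ z ∈ Q, fderiv ℝ f z (0, 1) ≠ 0)
    (hpq : ∀ z ∈ Q, fderiv ℝ f z (1, 0) * W.tangential d 1 (Φ z) (fderiv ℝ Φ z (0, 1)) =
      fderiv ℝ f z (0, 1) * W.tangential d 0 (Φ z) (fderiv ℝ Φ z (1, 0)))
    {z : ℝ × ℝ} (hz : z ∈ Q) :
    fderiv ℝ (fun z => fderiv ℝ (fun z =>
      Real.log (fderiv ℝ f z (1, 0)) - Real.log (fderiv ℝ f z (0, 1))) z (1, 0)) z (0, 1) =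
    -((d 0 * cubic b e 0 (Φ z) + d 1 * cubic b e 1 (Φ z)) *
      (W.tangential d 0 (Φ z) (fderiv ℝ Φ z (1, 0)) *
        W.tangential d 1 (Φ z) (fderiv ℝ Φ z (0, 1)))) := by
  have hΦd : ∀ z ∈ Q, ContDiffAt ℝ ∞ Φ z := fun z hz => hΦ.contDiffAt (hQ.mem_nhds hz)
  have hΦ' := ((contDiffOn_infty_iff_fderiv_of_isOpen hQ).1 hΦ).2
  have pull : ∀ {η : OneForm E}, ContDiffOn ℝ ∞ η U → ∀ w,
      ContDiffOn ℝ ∞ (fun z => η (Φ z) (fderiv ℝ Φ z w)) Q := fun hη w =>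
    (hη.comp hΦ hΦU).clm_apply (hΦ'.clm_apply contDiffOn_const)
  have dat : ∀ {g : ℝ × ℝ → ℝ}, ContDiffOn ℝ ∞ g Q → ∀ z ∈ Q, DifferentiableAt ℝ g z :=
    fun hg z hz => (hg.contDiffAt (hQ.mem_nhds hz)).differentiableAt (by simp)
  have daU : ∀ {η : OneForm E}, ContDiffOn ℝ ∞ η U → ∀ z ∈ Q, DifferentiableAt ℝ η (Φ z) :=
    fun hη z hz => (hη.contDiffAt (hU.mem_nhds (hΦU hz))).differentiableAt (by simp)
  -- On the surface the pullbacks are σ_1 = p dx, σ_2 = q dy and Θ = A dx + C dy. The structure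
  -- equations become p_y = -pC, q_x = -qA and C_x - A_y = Kpq.
  set p : ℝ × ℝ → ℝ := fun z => W.tangential d 0 (Φ z) (fderiv ℝ Φ z (1, 0)) with hpdef
  set q : ℝ × ℝ → ℝ := fun z => W.tangential d 1 (Φ z) (fderiv ℝ Φ z (0, 1)) with hqdef
  set A : ℝ × ℝ → ℝ := fun z => tangentialConnection θ d e (Φ z) (fderiv ℝ Φ z (1, 0)) with hA
  set C : ℝ × ℝ → ℝ := fun z => tangentialConnection θ d e (Φ z) (fderiv ℝ Φ z (0, 1)) with hC
  have hps : ContDiffOn ℝ ∞ p Q := pull (W.contDiffOn_tangential d 0) _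
  have hqs : ContDiffOn ℝ ∞ q Q := pull (W.contDiffOn_tangential d 1) _
  have hAs : ContDiffOn ℝ ∞ A Q := pull (contDiffOn_tangentialConnection hθ d e) _
  have hCs : ContDiffOn ℝ ∞ C Q := pull (contDiffOn_tangentialConnection hθ d e) _
  have hlp : ContDiffOn ℝ ∞ (fun z => Real.log (p z)) Q := hps.log hp
  have hlq : ContDiffOn ℝ ∞ (fun z => Real.log (q z)) Q := hqs.log hq
  -- The third family is σ_1 + σ_2 = 0, so f_x : f_y = p : q. Therefore L = log|p| - log|q|, whence
  -- L_x = (log|p|)_x + A and L_xy = -C_x + A_y = -Kpq.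
  have hlog : Set.EqOn (fun z => Real.log (fderiv ℝ f z (1, 0)) - Real.log (fderiv ℝ f z (0, 1)))
      (fun z => Real.log (p z) - Real.log (q z)) Q := by
    intro z hz
    have := congrArg Real.log (hpq z hz)
    rw [Real.log_mul (hfx z hz) (hq z hz), Real.log_mul (hfy z hz) (hp z hz)] at this
    simp only
    linarith
  have zero_of_eq : ∀ {g : ℝ × ℝ → ℝ}, (∀ z ∈ Q, g z = 0) → ∀ z ∈ Q, fderiv ℝ g z = 0 := by
    intro g hg z hz
    rw [Filter.EventuallyEq.fderiv_eq (f := fun _ => (0 : ℝ))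
      (Filter.eventually_of_mem (hQ.mem_nhds hz) hg)]
    simp
  have hpy : ∀ z ∈ Q, fderiv ℝ p z (0, 1) = -(p z * C z) := by
    intro z hz
    have := OneForm.fderiv_pullback_sub (daU (W.contDiffOn_tangential d 0) z hz) (hΦd z hz)
      (1, 0) (0, 1)
    have hd := d_tangential (α := 0) hU (hΦU hz) hθ hde (hcon z hz (1, 0) 0) (hcon z hz (0, 1) 0)
    rw [Fin.castSucc_zero] at hd
    rw [hd, zero_of_eq h0 z hz, OneForm.wedge, h0 z hz] at this
    simp only [zero_apply] at this
    linarith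
  have hqx : ∀ z ∈ Q, fderiv ℝ q z (1, 0) = -(q z * A z) := by
    intro z hz
    have := OneForm.fderiv_pullback_sub (daU (W.contDiffOn_tangential d 1) z hz) (hΦd z hz)
      (1, 0) (0, 1)
    have hd := d_tangential (α := 1) hU (hΦU hz) hθ hde (hcon z hz (1, 0) 1) (hcon z hz (0, 1) 1)
    rw [Fin.castSucc_one] at hd
    rw [hd, zero_of_eq h1 z hz, OneForm.wedge, h1 z hz] at this
    simp only [zero_apply] at this
    linarith
  have hAC : fderiv ℝ C z (1, 0) - fderiv ℝ A z (0, 1) =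
      (d 0 * cubic b e 0 (Φ z) + d 1 * cubic b e 1 (Φ z)) * (p z * q z) := by
    rw [hA, hC, OneForm.fderiv_pullback_sub (daU (contDiffOn_tangentialConnection hθ d e) z hz)
      (hΦd z hz) (1, 0) (0, 1), d_tangentialConnection hU (hΦU hz) hθ hb hde (hθe _ (hΦU hz))
      (hcon z hz _) (hcon z hz _), OneForm.wedge, h0 z hz, h1 z hz]
    simp only [hpdef, hqdef]
    ring
  have hlpy : ∀ z ∈ Q, fderiv ℝ (fun z => Real.log (p z)) z (0, 1) = -C z := by
    intro z hz
    rw [((dat hps z hz).hasFDerivAt.log (hp z hz)).fderiv, smul_apply, hpy z hz, smul_eq_mul]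
    have : p z ≠ 0 := hp z hz
    field_simp
  have hlqx : ∀ z ∈ Q, fderiv ℝ (fun z => Real.log (q z)) z (1, 0) = -A z := by
    intro z hz
    rw [((dat hqs z hz).hasFDerivAt.log (hq z hz)).fderiv, smul_apply, hqx z hz, smul_eq_mul]
    have : q z ≠ 0 := hq z hz
    field_simp
  have hstep : Set.EqOn (fun z => fderiv ℝ (fun z =>
      Real.log (fderiv ℝ f z (1, 0)) - Real.log (fderiv ℝ f z (0, 1))) z (1, 0))
      (fun z => fderiv ℝ (fun z => Real.log (p z)) z (1, 0) + A z) Q := by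
    intro z hz
    simp only
    rw [Filter.EventuallyEq.fderiv_eq (Filter.eventually_of_mem (hQ.mem_nhds hz) hlog),
      fderiv_fun_sub (dat hlp z hz) (dat hlq z hz), sub_apply, hlqx z hz, sub_neg_eq_add]
  have hlp' : DifferentiableAt ℝ (fderiv ℝ (fun z => Real.log (p z))) z :=
    ((((contDiffOn_infty_iff_fderiv_of_isOpen hQ).1 hlp).2).contDiffAt
      (hQ.mem_nhds hz)).differentiableAt (by simp)
  have happ : ∀ v w, fderiv ℝ (fun z => fderiv ℝ (fun z => Real.log (p z)) z v) z w =
      fderiv ℝ (fderiv ℝ (fun z => Real.log (p z))) z w v := by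
    intro v w
    rw [(hlp'.hasFDerivAt.clm_apply (hasFDerivAt_const v z)).fderiv]
    simp
  have hsymm : IsSymmSndFDerivAt ℝ (fun z => Real.log (p z)) z :=
    (hlp.contDiffAt (hQ.mem_nhds hz)).isSymmSndFDerivAt (by simpa using ENat.LEInfty.out)
  have hmix : fderiv ℝ (fun z => fderiv ℝ (fun z => Real.log (p z)) z (1, 0)) z (0, 1) =
      -fderiv ℝ C z (1, 0) := by
    rw [happ, hsymm.eq, ← happ,
      Filter.EventuallyEq.fderiv_eq (Filter.eventually_of_mem (hQ.mem_nhds hz) hlpy),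
      fderiv_fun_neg]
    rfl
  rw [Filter.EventuallyEq.fderiv_eq (Filter.eventually_of_mem (hQ.mem_nhds hz) hstep),
    fderiv_fun_add (hlp'.clm_apply (differentiableAt_const _)) (dat hAs z hz), add_apply, hmix,
    ← hAC]
  ring

/-- On Δ the third pair is also proportional to `e`, being minus the sum of the other two. Each
foliation thus cuts an integral surface along the lines of a single scalar form σ_ξ. -/
theorem form_eq_zero_iff (hde : d 0 * e 0 + d 1 * e 1 = 1) {x : E} (hx : x ∈ U) {v : E}
    (hv : ∀ α : Fin 2, W.conormal e α.castSucc x v = 0) (ξ : Fin 3) :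
    (∀ i, W.form ξ i x v = 0) ↔ W.tangential d ξ x v = 0 := by
  constructor
  · intro H
    simp [tangential_apply, H]
  · intro H i
    have hc : W.conormal e ξ x v = 0 := by
      have c0 := hv 0
      have c1 := hv 1
      rw [conormal_apply] at c0 c1 ⊢
      fin_cases ξ
      · exact c0
      · exact c1
      · simp only [Fin.castSucc_zero, Fin.castSucc_one, Fin.reduceFinMk] at c0 c1 ⊢
        rw [form_two_apply W hx, form_two_apply W hx]
        linarith
    rw [W.form_eq_of_conormal_eq_zero hde hc, H, mul_zero]

/-- Coordinates on an integral surface which rectify the lines cut by the first two foliations. -/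
theorem exists_web_coordinates (hE : Module.finrank ℝ E = 4) (hU : IsOpen U)
    (hθ : W.IsConnection θ a) (hb : W.IsCurvature θ b) (hde : d 0 * e 0 + d 1 * e 1 = 1)
    (hθe : ∀ x ∈ U, ∀ v, e 0 * (e 1 * θ 0 0 x v - e 0 * θ 0 1 x v) +
      e 1 * (e 1 * θ 1 0 x v - e 0 * θ 1 1 x v) = 0)
    {F : Type*} [NormedAddCommGroup F] [NormedSpace ℝ F] [FiniteDimensional ℝ F]
    (hF : Module.finrank ℝ F = 2) {V : Set F} (hV : IsOpen V)
    {φ : F → E} (hφ : ContDiffOn ℝ ∞ φ V) {O : Set E} (hO : IsOpen O) (hOU : O ⊆ U)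
    (hφO : Set.MapsTo φ V O)
    (hcon : ∀ s ∈ V, ∀ w, ∀ α : Fin 2, W.conormal e α.castSucc (φ s) (fderiv ℝ φ s w) = 0)
    (hinj : ∀ s ∈ V, ∀ v, fderiv ℝ φ s v = 0 → v = 0)
    {u : Fin 3 → E → Fin 2 → ℝ} (hu : ∀ ξ, IsFirstIntegral (W.form ξ) O (u ξ))
    {s : F} (hs : s ∈ V) :
    ∃ ε > 0, ∃ (G : ℝ × ℝ → F) (f : ℝ × ℝ → ℝ), Set.MapsTo G (Metric.ball 0 ε) V ∧ G 0 = s ∧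
      (∀ O ⊆ Metric.ball 0 ε, IsOpen O → IsOpen (G '' O)) ∧
      (∀ ξ, ∀ z ∈ Metric.ball (0 : ℝ × ℝ) ε, ∀ w ∈ Metric.ball (0 : ℝ × ℝ) ε,
        ((![Prod.fst, Prod.snd, f] : Fin 3 → ℝ × ℝ → ℝ) ξ z =
          (![Prod.fst, Prod.snd, f] : Fin 3 → ℝ × ℝ → ℝ) ξ w ↔
        u ξ (φ (G z)) = u ξ (φ (G w)))) ∧
      ContDiffOn ℝ ∞ f (Metric.ball 0 ε) ∧
      (∀ z ∈ Metric.ball (0 : ℝ × ℝ) ε, fderiv ℝ f z (1, 0) ≠ 0 ∧ fderiv ℝ f z (0, 1) ≠ 0) ∧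
      ∀ z ∈ Metric.ball (0 : ℝ × ℝ) ε, ∃ κ : ℝ, κ ≠ 0 ∧
        fderiv ℝ (fun z => fderiv ℝ (fun z =>
          Real.log (fderiv ℝ f z (1, 0)) - Real.log (fderiv ℝ f z (0, 1))) z (1, 0)) z (0, 1) =
        κ * (d 0 * cubic b e 0 (φ (G z)) + d 1 * cubic b e 1 (φ (G z))) := by
  have hφd : ∀ p ∈ V, DifferentiableAt ℝ φ p := fun p hp =>
    (hφ.contDiffAt (hV.mem_nhds hp)).differentiableAt (by simp)
  set h : Fin 3 → F → F →L[ℝ] ℝ := fun ξ p => (W.tangential d ξ (φ p)).comp (fderiv ℝ φ p) with hh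
  have hh2 : ∀ p ∈ V, ∀ v, h 2 p v = -(h 0 p v + h 1 p v) := fun p hp v =>
    W.tangential_two d (hOU (hφO hp)) _
  have hform : ∀ p ∈ V, ∀ ξ v, (∀ i, W.form ξ i (φ p) (fderiv ℝ φ p v) = 0) ↔ h ξ p v = 0 := by
    intro p hp ξ v
    exact form_eq_zero_iff hde (hOU (hφO hp)) (hcon p hp v) ξ
  have hjoint : ∀ p ∈ V, ∀ v, h 0 p v = 0 → h 1 p v = 0 → v = 0 := by
    intro p hp v H0 H1
    refine hinj p hp v (eq_zero_of_form_eq_zero hE W (hOU (hφO hp)) fun α i => ?_)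
    fin_cases α
    · exact (hform p hp 0 v).2 H0 i
    · exact (hform p hp 1 v).2 H1 i
  have hus : ∀ ξ, ∀ p ∈ V, DifferentiableAt ℝ (u ξ) (φ p) := fun ξ p hp =>
    ((hu ξ).1.contDiffAt (hO.mem_nhds (hφO hp))).differentiableAt (by simp)
  have hgs : ∀ ξ, ContDiffOn ℝ ∞ (fun p => u ξ (φ p)) V := fun ξ => (hu ξ).1.comp hφ hφO
  have hgd : ∀ ξ, ∀ p ∈ V, DifferentiableAt ℝ (fun p => u ξ (φ p)) p := fun ξ p hp =>
    ((hgs ξ).contDiffAt (hV.mem_nhds hp)).differentiableAt (by simp)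
  have hg : ∀ ξ, ∀ p ∈ V, ∀ v, fderiv ℝ (fun p => u ξ (φ p)) p v = 0 ↔ h ξ p v = 0 := by
    intro ξ p hp v
    have : HasFDerivAt (fun p => u ξ (φ p)) _ p :=
      (hus ξ p hp).hasFDerivAt.comp p (hφd p hp).hasFDerivAt
    rw [this.fderiv, ContinuousLinearMap.comp_apply, (hu ξ).2 _ (hφO hp), hform p hp]
  have hjs : ∃ t₀ t₁ : F, h 0 s t₀ = 1 ∧ h 0 s t₁ = 0 ∧ h 1 s t₀ = 0 ∧ h 1 s t₁ = 1 := by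
    have hsurj : Function.Surjective ((h 0 s).prod (h 1 s) : F →ₗ[ℝ] ℝ × ℝ) := by
      rw [← LinearMap.injective_iff_surjective_of_finrank_eq_finrank (by simp [hF]),
        injective_iff_map_eq_zero]
      exact fun v hv => hjoint s hs v (congrArg Prod.fst hv) (congrArg Prod.snd hv)
    obtain ⟨t₀, h₀⟩ := hsurj (1, 0)
    obtain ⟨t₁, h₁⟩ := hsurj (0, 1)
    exact ⟨t₀, t₁, congrArg Prod.fst h₀, congrArg Prod.fst h₁, congrArg Prod.snd h₀,
      congrArg Prod.snd h₁⟩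
  have hcomp : ∀ ξ i, ∀ p ∈ V, ∀ v,
      fderiv ℝ (fun p => u ξ (φ p) i) p v = fderiv ℝ (fun p => u ξ (φ p)) p v i := by
    intro ξ i p hp v
    rw [(hasFDerivAt_pi'.1 (hgd ξ p hp).hasFDerivAt i).fderiv]
    rfl
  have hne : ∀ ξ, ∃ i, fderiv ℝ (fun p => u ξ (φ p) i) s ≠ 0 := by
    intro ξ
    obtain ⟨t₀, t₁, h00, h01, h10, h11⟩ := hjs
    have : ∃ v, h ξ s v ≠ 0 := by
      fin_cases ξ
      · exact ⟨t₀, by simp [h00]⟩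
      · exact ⟨t₁, by simp [h11]⟩
      · refine ⟨t₀, ?_⟩
        change h 2 s t₀ ≠ 0
        rw [hh2 s hs, h00, h10]
        norm_num
    obtain ⟨v, hv⟩ := this
    by_contra! hall
    refine hv ((hg ξ s hs v).1 ?_)
    ext i
    rw [← hcomp ξ i s hs, hall i]
    rfl
  -- The first integrals take values in ℝ², but their restrictions to the surface have rank one; a
  -- component with nonzero differential at `s` serves as a scalar function with the same level
  -- lines nearby.
  choose i hi using hne
  set x : Fin 3 → F → ℝ := fun ξ p => u ξ (φ p) (i ξ) - u ξ (φ s) (i ξ) with hx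
  have hxs : ∀ ξ, ContDiffOn ℝ ∞ (x ξ) V := fun ξ =>
    (contDiffOn_pi.1 (hgs ξ) (i ξ)).sub contDiffOn_const
  have hxd : ∀ ξ, ∀ p ∈ V, DifferentiableAt ℝ (x ξ) p := fun ξ p hp =>
    ((hxs ξ).contDiffAt (hV.mem_nhds hp)).differentiableAt (by simp)
  have hxf : ∀ ξ p, fderiv ℝ (x ξ) p = fderiv ℝ (fun p => u ξ (φ p) (i ξ)) p := fun ξ p =>
    fderiv_sub_const _
  have hx0 : ∀ ξ, x ξ s = 0 := fun ξ => sub_self _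
  obtain ⟨N, hN, hNo, hsN⟩ := mem_nhds_iff.1 (show {p | p ∈ V ∧ ∀ ξ, fderiv ℝ (x ξ) p ≠ 0} ∈ 𝓝 s by
    refine Filter.Eventually.and (hV.mem_nhds hs) (Filter.eventually_all.2 fun ξ => ?_)
    refine ContinuousAt.eventually_ne ?_ (by rw [hxf]; exact hi ξ)
    exact ((hxs ξ).continuousOn_fderiv_of_isOpen hV (by simp)).continuousAt (hV.mem_nhds hs))
  have hNV : N ⊆ V := fun p hp => (hN hp).1
  -- The differential of the chosen component vanishes on the kernel of the restricted σ_ξ and is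
  -- nonzero, so the two kernels coincide.
  have hker : ∀ ξ, ∀ p ∈ N, ∀ v, fderiv ℝ (x ξ) p v = 0 ↔ h ξ p v = 0 := by
    intro ξ p hp v
    have hle : ∀ w, h ξ p w = 0 → fderiv ℝ (x ξ) p w = 0 := by
      intro w hw
      rw [hxf, hcomp ξ _ p (hNV hp), (hg ξ p (hNV hp) w).2 hw]
      rfl
    refine ⟨fun hv => ?_, hle v⟩
    by_contra hhv
    refine (hN hp).2 ξ (ContinuousLinearMap.ext fun w => ?_)
    have := hle (w - (h ξ p w / h ξ p v) • v) (by
      rw [map_sub, map_smul, smul_eq_mul, div_mul_cancel₀ _ hhv, sub_self])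
    rw [map_sub, map_smul, hv, smul_zero, sub_zero] at this
    rw [this]
    rfl
  -- Equal values of one component must force equal values of the whole first integral; another
  -- family, transversal to the given one, supplies the second coordinate.
  have hfac : ∀ ξ, ∃ M, IsOpen M ∧ s ∈ M ∧ M ⊆ N ∧ ∀ p ∈ M, ∀ q ∈ M, x ξ p = x ξ q →
      u ξ (φ p) = u ξ (φ q) := by
    intro ξ
    obtain ⟨ζ, hζ⟩ : ∃ ζ, ∀ v, h ξ s v = 0 → h ζ s v = 0 → v = 0 := by
      fin_cases ξ
      · exact ⟨1, fun v h0 h1 => hjoint s hs v h0 h1⟩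
      · exact ⟨0, fun v h0 h1 => hjoint s hs v h1 h0⟩
      · refine ⟨0, fun v h2 h0 => hjoint s hs v h0 ?_⟩
        have h2' : h 2 s v = 0 := h2
        rw [hh2 s hs, h0] at h2'
        linarith
    refine exists_isOpen_forall_eq_of_coord_eq hF hNo ((hxs ξ).mono hNV) ((hxs ζ).mono hNV)
      ((hgs ξ).mono hNV) hsN (fun v hv hv' => hζ v ((hker ξ s hsN v).1 hv)
      ((hker ζ s hsN v).1 hv')) fun p hp v hv => (hg ξ p (hNV hp) v).2 ((hker ξ p hp v).1 hv)
  choose M hMo hsM hMN hM using hfac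
  set P : Set F := ⋂ ξ, M ξ with hP
  have hPo : IsOpen P := isOpen_iInter_of_finite hMo
  have hsP : s ∈ P := Set.mem_iInter.2 hsM
  have hPM : ∀ ξ, P ⊆ M ξ := fun ξ => Set.iInter_subset M ξ
  have hPN : P ⊆ N := (hPM 0).trans (hMN 0)
  have hPV : P ⊆ V := hPN.trans hNV
  have hprod : ∀ p ∈ P, fderiv ℝ (fun p => (x 0 p, x 1 p)) p =
      (fderiv ℝ (x 0) p).prod (fderiv ℝ (x 1) p) := fun p hp =>
    (hxd 0 p (hPV hp)).fderiv_prodMk (hxd 1 p (hPV hp))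
  obtain ⟨ε, hε, G, hG, hGs, hGz, hGo⟩ := exists_local_inverse (T := ℝ × ℝ) (by simp [hF]) hPo
    (f := fun p => (x 0 p, x 1 p)) (((hxs 0).prodMk (hxs 1)).mono hPV) hsP (fun v hv => by
      rw [hprod s hsP] at hv
      exact hjoint s hs v ((hker 0 s hsN v).1 (congrArg Prod.fst hv))
        ((hker 1 s hsN v).1 (congrArg Prod.snd hv)))
  have hc0 : (x 0 s, x 1 s) = (0 : ℝ × ℝ) := by rw [hx0, hx0]; rfl
  rw [hc0] at hG hGs hGz hGo
  have hGP : Set.MapsTo G (Metric.ball 0 ε) P := fun z hz => (hGz z hz).1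
  have hGd : ∀ z ∈ Metric.ball (0 : ℝ × ℝ) ε, DifferentiableAt ℝ G z := fun z hz =>
    (hG.contDiffAt (Metric.isOpen_ball.mem_nhds hz)).differentiableAt (by simp)
  have hxG : ∀ z ∈ Metric.ball (0 : ℝ × ℝ) ε, x 0 (G z) = z.1 ∧ x 1 (G z) = z.2 := fun z hz =>
    ⟨congrArg Prod.fst (hGz z hz).2.1, congrArg Prod.snd (hGz z hz).2.1⟩
  have hdx : ∀ z ∈ Metric.ball (0 : ℝ × ℝ) ε, ∀ w,
      fderiv ℝ (x 0) (G z) (fderiv ℝ G z w) = w.1 ∧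
      fderiv ℝ (x 1) (G z) (fderiv ℝ G z w) = w.2 := by
    intro z hz w
    have := (hGz z hz).2.2 w
    rw [hprod _ (hGP hz)] at this
    exact ⟨congrArg Prod.fst this, congrArg Prod.snd this⟩
  have hlev : ∀ ξ, ∀ p ∈ P, ∀ q ∈ P, (x ξ p = x ξ q ↔ u ξ (φ p) = u ξ (φ q)) := by
    intro ξ p hp q hq
    refine ⟨hM ξ p (hPM ξ hp) q (hPM ξ hq), fun H => ?_⟩
    simp only [hx, H]
  have hy0 : ∀ z ∈ Metric.ball (0 : ℝ × ℝ) ε, h 0 (G z) (fderiv ℝ G z (0, 1)) = 0 := fun z hz =>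
    (hker 0 _ (hPN (hGP hz)) _).1 (hdx z hz _).1
  have hx1 : ∀ z ∈ Metric.ball (0 : ℝ × ℝ) ε, h 1 (G z) (fderiv ℝ G z (1, 0)) = 0 := fun z hz =>
    (hker 1 _ (hPN (hGP hz)) _).1 (hdx z hz _).2
  have hp0 : ∀ z ∈ Metric.ball (0 : ℝ × ℝ) ε, h 0 (G z) (fderiv ℝ G z (1, 0)) ≠ 0 := by
    intro z hz H
    have := (hker 0 _ (hPN (hGP hz)) _).2 H
    rw [(hdx z hz _).1] at this
    exact one_ne_zero this
  have hq1 : ∀ z ∈ Metric.ball (0 : ℝ × ℝ) ε, h 1 (G z) (fderiv ℝ G z (0, 1)) ≠ 0 := by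
    intro z hz H
    have := (hker 1 _ (hPN (hGP hz)) _).2 H
    rw [(hdx z hz _).2] at this
    exact one_ne_zero this
  set f : ℝ × ℝ → ℝ := fun z => x 2 (G z) with hf
  have hfs : ContDiffOn ℝ ∞ f (Metric.ball 0 ε) :=
    (hxs 2).comp hG fun z hz => hPV (hGP hz)
  have hfd : ∀ z ∈ Metric.ball (0 : ℝ × ℝ) ε, fderiv ℝ f z =
      (fderiv ℝ (x 2) (G z)).comp (fderiv ℝ G z) := fun z hz =>
    ((hxd 2 _ (hPV (hGP hz))).hasFDerivAt.comp z (hGd z hz).hasFDerivAt).fderiv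
  have hfker : ∀ z ∈ Metric.ball (0 : ℝ × ℝ) ε, ∀ w, fderiv ℝ f z w = 0 ↔
      h 0 (G z) (fderiv ℝ G z w) + h 1 (G z) (fderiv ℝ G z w) = 0 := by
    intro z hz w
    rw [hfd z hz, ContinuousLinearMap.comp_apply, hker 2 _ (hPN (hGP hz)),
      hh2 _ (hPV (hGP hz)), neg_eq_zero]
  have hfx : ∀ z ∈ Metric.ball (0 : ℝ × ℝ) ε, fderiv ℝ f z (1, 0) ≠ 0 := by
    intro z hz H
    rw [hfker z hz, hx1 z hz, add_zero] at H
    exact hp0 z hz H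
  have hfy : ∀ z ∈ Metric.ball (0 : ℝ × ℝ) ε, fderiv ℝ f z (0, 1) ≠ 0 := by
    intro z hz H
    rw [hfker z hz, hy0 z hz, zero_add] at H
    exact hq1 z hz H
  refine ⟨ε, hε, G, f, fun z hz => hPV (hGP hz), hGs, hGo, ?_, hfs,
    fun z hz => ⟨hfx z hz, hfy z hz⟩, ?_⟩
  · intro ξ z hz w hw
    rw [← hlev ξ _ (hGP hz) _ (hGP hw)]
    fin_cases ξ
    · change z.1 = w.1 ↔ x 0 (G z) = x 0 (G w)
      rw [(hxG z hz).1, (hxG w hw).1]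
    · change z.2 = w.2 ↔ x 1 (G z) = x 1 (G w)
      rw [(hxG z hz).2, (hxG w hw).2]
    · exact Iff.rfl
  · intro z hz
    have hΦ : ContDiffOn ℝ ∞ (fun z => φ (G z)) (Metric.ball 0 ε) :=
      hφ.comp hG fun z hz => hPV (hGP hz)
    have hΦd : ∀ z ∈ Metric.ball (0 : ℝ × ℝ) ε, fderiv ℝ (fun z => φ (G z)) z =
        (fderiv ℝ φ (G z)).comp (fderiv ℝ G z) := fun z hz =>
      ((hφd _ (hPV (hGP hz))).hasFDerivAt.comp z (hGd z hz).hasFDerivAt).fderiv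
    refine ⟨-(h 0 (G z) (fderiv ℝ G z (1, 0)) * h 1 (G z) (fderiv ℝ G z (0, 1))),
      neg_ne_zero.2 (mul_ne_zero (hp0 z hz) (hq1 z hz)), ?_⟩
    rw [mixed_fderiv_log_eq hU hθ hb hde hθe Metric.isOpen_ball hΦ
      (fun z hz => hOU (hφO (hPV (hGP hz)))) ?_ ?_ ?_ ?_ ?_ hfx hfy ?_ hz]
    · rw [hΦd z hz]
      simp only [hh, ContinuousLinearMap.comp_apply]
      ring
    · intro z hz w α
      rw [hΦd z hz]
      exact hcon _ (hPV (hGP hz)) _ α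
    · intro z hz
      rw [hΦd z hz]
      exact hy0 z hz
    · intro z hz
      rw [hΦd z hz]
      exact hx1 z hz
    · intro z hz
      rw [hΦd z hz]
      exact hp0 z hz
    · intro z hz
      rw [hΦd z hz]
      exact hq1 z hz
    · intro z hz
      rw [hΦd z hz]
      -- The vector q ∂_x - p ∂_y annihilates σ_1 + σ_2, hence df; this is the proportion f_x q =
      -- f_y p.
      have hdec : ((h 1 (G z) (fderiv ℝ G z (0, 1)), -h 0 (G z) (fderiv ℝ G z (1, 0))) : ℝ × ℝ) =
          h 1 (G z) (fderiv ℝ G z (0, 1)) • ((1, 0) : ℝ × ℝ) -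
          h 0 (G z) (fderiv ℝ G z (1, 0)) • ((0, 1) : ℝ × ℝ) := by
        ext <;> simp
      have := (hfker z hz (h 1 (G z) (fderiv ℝ G z (0, 1)),
        -h 0 (G z) (fderiv ℝ G z (1, 0)))).2 (by
          rw [hdec]
          simp only [map_sub, map_smul, smul_eq_mul, hx1 z hz, hy0 z hz]
          ring)
      rw [hdec] at this
      simp only [map_sub, map_smul, smul_eq_mul] at this
      change fderiv ℝ f z (1, 0) * h 1 (G z) (fderiv ℝ G z (0, 1)) =
        fderiv ℝ f z (0, 1) * h 0 (G z) (fderiv ℝ G z (1, 0))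
      linarith

end ThreeWeb

/-! ### Integrability of the transversal distribution -/

/-- A smooth vector field on an open set has smooth integral curves. -/
theorem exists_contDiffOn_integralCurve {T : Type*} [NormedAddCommGroup T] [NormedSpace ℝ T]
    [CompleteSpace T] {ζ : T → T} {B : Set T} (hB : IsOpen B) (hζ : ContDiffOn ℝ ∞ ζ B) {y : T}
    (hy : y ∈ B) :
    ∃ δ > 0, ∃ c : ℝ → T, c 0 = y ∧ ContDiffOn ℝ ∞ c (Set.Ioo (-δ) δ) ∧
      ∀ t ∈ Set.Ioo (-δ) δ, c t ∈ B ∧ HasDerivAt c (ζ (c t)) t := by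
  obtain ⟨c, hc0, ε, hε, hc⟩ :=
    ((hζ.contDiffAt (hB.mem_nhds hy)).of_le
      (by simp)).exists_forall_mem_closedBall_exists_eq_forall_mem_Ioo_hasDerivAt₀ 0
  rw [zero_sub, zero_add] at hc
  have hcc : ContinuousAt c 0 := (hc 0 ⟨by linarith, hε⟩).continuousAt
  obtain ⟨r, hr, hrB⟩ := Metric.eventually_nhds_iff_ball.1
    (hcc.eventually_mem (hB.mem_nhds (by rwa [hc0])))
  -- Halving leaves room for a closed interval inside the domain of the solution, on which
  -- smoothness is bootstrapped from the equation.
  set δ := min ε r / 2 with hδ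
  have hm : 0 < min ε r := lt_min hε hr
  have hδ0 : 0 < δ := by positivity
  have hδm : δ < min ε r := by linarith
  have h1 : ∀ t ∈ Set.Icc (-δ) δ, c t ∈ B ∧ HasDerivAt c (ζ (c t)) t := by
    intro t ht
    have hte : |t| < min ε r := (abs_le.2 ht).trans_lt hδm
    refine ⟨hrB t ?_, hc t (abs_lt.1 (hte.trans_le (min_le_left _ _)))⟩
    rw [Metric.mem_ball, dist_zero_right]
    exact hte.trans_le (min_le_right _ _)
  refine ⟨δ, hδ0, c, hc0, ?_, fun t ht => h1 t (Set.Ioo_subset_Icc_self ht)⟩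
  refine ContDiffOn.mono (ODE.contDiffOn_enat_Icc_of_hasDerivWithinAt (n := ⊤) (u := B)
    (f := fun _ x => ζ x) ?_ (fun t ht => (h1 t ht).2.hasDerivWithinAt) fun t ht => (h1 t ht).1)
    Set.Ioo_subset_Icc_self
  exact hζ.comp contDiffOn_snd fun p hp => hp.2

namespace ThreeWeb

variable {E : Type*} [NormedAddCommGroup E] [NormedSpace ℝ E] {U : Set E}
  {W : ThreeWeb U} {θ : Fin 2 → Fin 2 → OneForm E} {a : Fin 2 → E → ℝ} {d e : Fin 2 → ℝ}

/-- The kernel of the conormal form is constant along the leaves of the foliation. -/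
theorem conormal_eq_zero_add (hU : IsOpen U) (hθ : W.IsConnection θ a)
    (hde : d 0 * e 0 + d 1 * e 1 = 1)
    (hθe : ∀ x ∈ U, ∀ v, e 0 * (e 1 * θ 0 0 x v - e 0 * θ 0 1 x v) +
      e 1 * (e 1 * θ 1 0 x v - e 0 * θ 1 1 x v) = 0) {T : Type*} [NormedAddCommGroup T]
    [NormedSpace ℝ T] {Q : Set T} (hQo : IsOpen Q) (hQ : Convex ℝ Q) {Φ : T → E}
    (hΦ : ContDiffOn ℝ ∞ Φ Q) (hΦU : Set.MapsTo Φ Q U) {α : Fin 2} {τ : T}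
    (hτ : ∀ q ∈ Q, ∀ i, W.form α.castSucc i (Φ q) (fderiv ℝ Φ q τ) = 0) {q : T} (hq : q ∈ Q)
    (hqτ : q + τ ∈ Q) {v : T} (hv : W.conormal e α.castSucc (Φ q) (fderiv ℝ Φ q v) = 0) :
    W.conormal e α.castSucc (Φ (q + τ)) (fderiv ℝ Φ (q + τ) v) = 0 := by
  have hΦ' := ((contDiffOn_infty_iff_fderiv_of_isOpen hQo).1 hΦ).2
  have pull : ∀ {η : OneForm E}, ContDiffOn ℝ ∞ η U → ∀ w,
      ContDiffOn ℝ ∞ (fun z => η (Φ z) (fderiv ℝ Φ z w)) Q := fun hη w =>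
    (hη.comp hΦ hΦU).clm_apply (hΦ'.clm_apply contDiffOn_const)
  set g : T → ℝ := fun z => W.conormal e α.castSucc (Φ z) (fderiv ℝ Φ z v) with hg
  have hgs : ContDiffOn ℝ ∞ g Q := pull (W.contDiffOn_conormal e _) v
  set k : T → ℝ := fun z =>
    d 1 * (e 1 * θ 0 0 (Φ z) (fderiv ℝ Φ z τ) - e 0 * θ 0 1 (Φ z) (fderiv ℝ Φ z τ)) -
      d 0 * (e 1 * θ 1 0 (Φ z) (fderiv ℝ Φ z τ) - e 0 * θ 1 1 (Φ z) (fderiv ℝ Φ z τ)) with hk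
  have hks : ContinuousOn k Q := by
    have := fun i j => (pull (hθ.1 i j) τ).continuousOn
    exact (continuousOn_const.mul ((continuousOn_const.mul (this 0 0)).sub
      (continuousOn_const.mul (this 0 1)))).sub (continuousOn_const.mul
      ((continuousOn_const.mul (this 1 0)).sub (continuousOn_const.mul (this 1 1))))
  -- The direction τ is tangent to the leaves, so differentiating the conormal component of `v`
  -- along τ gives g' = -gk. A solution that vanishes once stays zero along the segment.
  have hgτ : ∀ z ∈ Q, fderiv ℝ g z τ = -(g z * k z) := by
    intro z hz
    have h0 : fderiv ℝ (fun z => W.conormal e α.castSucc (Φ z) (fderiv ℝ Φ z τ)) z = 0 := by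
      rw [Filter.EventuallyEq.fderiv_eq (f := fun _ => (0 : ℝ))
        (Filter.eventually_of_mem (hQo.mem_nhds hz) fun z hz => ?_)]
      · simp
      · simp only [conormal_apply, hτ z hz, mul_zero, sub_zero]
    have := OneForm.fderiv_pullback_sub (((W.contDiffOn_conormal e α.castSucc).contDiffAt
      (hU.mem_nhds (hΦU hz))).differentiableAt (by simp)) (hΦ.contDiffAt (hQo.mem_nhds hz)) τ v
    rw [h0, d_conormal hU (hΦU hz) hθ hde (hθe _ (hΦU hz)) (hτ z hz)] at this
    simpa using this
  have hmem : ∀ t ∈ Set.Icc (0 : ℝ) 1, q + t • τ ∈ Q := by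
    intro t ht
    have := hQ.add_smul_sub_mem hq hqτ ht
    rwa [add_sub_cancel_left] at this
  have hline : ∀ t : ℝ, HasDerivAt (fun t : ℝ => q + t • τ) τ t := fun t => by
    simpa using ((hasDerivAt_id t).smul_const τ).const_add q
  have hder : ∀ t ∈ Set.Icc (0 : ℝ) 1, HasDerivAt (fun t : ℝ => g (q + t • τ))
      (-(g (q + t • τ) * k (q + t • τ))) t := by
    intro t ht
    rw [← hgτ _ (hmem t ht)]
    exact ((hgs.contDiffAt (hQo.mem_nhds (hmem t ht))).differentiableAt
      (by simp)).hasFDerivAt.comp_hasDerivAt t (hline t)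
  have hkc : ContinuousOn (fun t : ℝ => k (q + t • τ)) (Set.Icc 0 1) :=
    hks.comp (by fun_prop) hmem
  obtain ⟨K, hK⟩ := isCompact_Icc.exists_bound_of_continuousOn hkc
  have := eq_zero_of_abs_deriv_le_mul_abs_self_of_eq_zero_right (K := K)
    (fun t ht => (hder t ht).continuousAt.continuousWithinAt)
    (fun t ht => (hder t (Set.Ico_subset_Icc_self ht)).hasDerivWithinAt)
    (by simpa [hg] using hv) (fun t ht => by
      rw [norm_neg, norm_mul, mul_comm]
      exact mul_le_mul_of_nonneg_right (hK t (Set.Ico_subset_Icc_self ht)) (norm_nonneg _))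
    1 ⟨zero_le_one, le_rfl⟩
  simpa [hg] using this

/-- The distribution given by the conormal forms is two-dimensional, so that an immersed
parametrized surface tangent to it is an integral surface. -/
theorem range_eq_and_finrank_eq (hE : Module.finrank ℝ E = 4) (hde : d 0 * e 0 + d 1 * e 1 = 1)
    {x : E} (hx : x ∈ U) {D : Submodule ℝ E}
    (hD : ∀ v, v ∈ D ↔ ∀ α : Fin 2, W.conormal e α.castSucc x v = 0)
    {F : Type*} [AddCommGroup F] [Module ℝ F] (hF : Module.finrank ℝ F = 2) {A : F →ₗ[ℝ] E}
    (hA : ∀ v, A v = 0 → v = 0)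
    (hAD : ∀ v, ∀ α : Fin 2, W.conormal e α.castSucc x (A v) = 0) :
    LinearMap.range A = D ∧ Module.finrank ℝ D = 2 := by
  have : FiniteDimensional ℝ E := Module.finite_of_finrank_pos (by omega)
  have hr : Module.finrank ℝ (LinearMap.range A) = 2 := by
    rw [LinearMap.finrank_range_of_inj ((injective_iff_map_eq_zero A).2 hA), hF]
  have hle : LinearMap.range A ≤ D := by
    rintro _ ⟨v, rfl⟩
    exact (hD _).2 (hAD v)
  -- On Δ the pair (σ_1, σ_2) is injective, which bounds the dimension of Δ by 2.
  let L : D →ₗ[ℝ] ℝ × ℝ := (((W.tangential d 0 x).prod (W.tangential d 1 x) : E →L[ℝ] ℝ × ℝ) :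
    E →ₗ[ℝ] ℝ × ℝ).comp D.subtype
  have hL : Function.Injective L := by
    rw [injective_iff_map_eq_zero]
    rintro ⟨v, hv⟩ hLv
    have h0 : W.tangential d 0 x v = 0 := congrArg Prod.fst hLv
    have h1 : W.tangential d 1 x v = 0 := congrArg Prod.snd hLv
    have hc := (hD v).1 hv
    refine Subtype.ext (eq_zero_of_form_eq_zero hE W hx fun α i => ?_)
    fin_cases α
    · exact (form_eq_zero_iff hde hx hc 0).2 h0 i
    · exact (form_eq_zero_iff hde hx hc 1).2 h1 i
  have hD2 : Module.finrank ℝ D ≤ 2 := by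
    simpa using LinearMap.finrank_le_finrank_of_injective hL
  have heq := Submodule.eq_of_le_of_finrank_le hle (by rw [hr]; exact hD2)
  exact ⟨heq, heq ▸ hr⟩

/-- No general Frobenius theorem is involved. The first integrals of λ_1 and λ_2 give local
coordinates with values in ℝ² × ℝ², in which Δ is the sum of a line field on each factor; the
product of two integral curves is the required surface. -/
theorem isIntegrableDistribution (hE : Module.finrank ℝ E = 4) (hU : IsOpen U)
    (hθ : W.IsConnection θ a) (hde : d 0 * e 0 + d 1 * e 1 = 1)
    (hθe : ∀ x ∈ U, ∀ v, e 0 * (e 1 * θ 0 0 x v - e 0 * θ 0 1 x v) +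
      e 1 * (e 1 * θ 1 0 x v - e 0 * θ 1 1 x v) = 0) {D : E → Submodule ℝ E}
    (hD : ∀ x ∈ U, ∀ v, v ∈ D x ↔ ∀ α : Fin 2, W.conormal e α.castSucc x v = 0) :
    IsIntegrableDistribution U D := by
  have : FiniteDimensional ℝ E := Module.finite_of_finrank_pos (by omega)
  intro x hx
  obtain ⟨N₀, hN₀, hxN₀, hN₀U, u₀, hu₀⟩ := W.foliation 0 x hx
  obtain ⟨N₁, hN₁, hxN₁, hN₁U, u₁, hu₁⟩ := W.foliation 1 x hx
  set N := N₀ ∩ N₁ with hN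
  have hNo : IsOpen N := hN₀.inter hN₁
  have hd₀ : ∀ p ∈ N, DifferentiableAt ℝ u₀ p := fun p hp =>
    (hu₀.1.contDiffAt (hN₀.mem_nhds hp.1)).differentiableAt (by simp)
  have hd₁ : ∀ p ∈ N, DifferentiableAt ℝ u₁ p := fun p hp =>
    (hu₁.1.contDiffAt (hN₁.mem_nhds hp.2)).differentiableAt (by simp)
  have hprod : ∀ p ∈ N, fderiv ℝ (fun p => (u₀ p, u₁ p)) p = (fderiv ℝ u₀ p).prod (fderiv ℝ u₁ p) :=
    fun p hp => (hd₀ p hp).fderiv_prodMk (hd₁ p hp)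
  have hinj : ∀ p ∈ N, ∀ v, fderiv ℝ (fun p => (u₀ p, u₁ p)) p v = 0 → v = 0 := by
    intro p hp v hv
    rw [hprod p hp] at hv
    have h0 := (hu₀.2 p hp.1 v).1 (congrArg Prod.fst hv)
    have h1 := (hu₁.2 p hp.2 v).1 (congrArg Prod.snd hv)
    refine eq_zero_of_form_eq_zero hE W (hN₀U hp.1) fun α i => ?_
    fin_cases α
    · exact h0 i
    · exact h1 i
  obtain ⟨ε, hε, G, hG, hGx, hGz, -⟩ := exists_local_inverse
    (T := (Fin 2 → ℝ) × (Fin 2 → ℝ)) (by simp [hE]) hNo (f := fun p => (u₀ p, u₁ p))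
    ((hu₀.1.mono Set.inter_subset_left).prodMk (hu₁.1.mono Set.inter_subset_right))
    ⟨hxN₀, hxN₁⟩ (hinj x ⟨hxN₀, hxN₁⟩)
  set A := u₀ x with hA
  set B := u₁ x with hB
  have hGU : Set.MapsTo G (Metric.ball (A, B) ε) U := fun z hz => hN₀U (hGz z hz).1.1
  have hGd : ∀ z ∈ Metric.ball (A, B) ε, DifferentiableAt ℝ G z := fun z hz =>
    (hG.contDiffAt (Metric.isOpen_ball.mem_nhds hz)).differentiableAt (by simp)
  have hG' := ((contDiffOn_infty_iff_fderiv_of_isOpen Metric.isOpen_ball).1 hG).2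
  have hleaf₀ : ∀ z ∈ Metric.ball (A, B) ε, ∀ w : Fin 2 → ℝ, ∀ i,
      W.form 0 i (G z) (fderiv ℝ G z (0, w)) = 0 := by
    intro z hz w
    have := (hGz z hz).2.2 (0, w)
    rw [hprod _ (hGz z hz).1] at this
    exact (hu₀.2 _ (hGz z hz).1.1 _).1 (congrArg Prod.fst this)
  have hleaf₁ : ∀ z ∈ Metric.ball (A, B) ε, ∀ w : Fin 2 → ℝ, ∀ i,
      W.form 1 i (G z) (fderiv ℝ G z (w, 0)) = 0 := by
    intro z hz w
    have := (hGz z hz).2.2 (w, 0)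
    rw [hprod _ (hGz z hz).1] at this
    exact (hu₁.2 _ (hGz z hz).1.2 _).1 (congrArg Prod.snd this)
  have hmem : ∀ y ∈ Metric.ball A ε, ∀ z ∈ Metric.ball B ε, (y, z) ∈ Metric.ball (A, B) ε :=
    fun y hy z hz => by rw [← ball_prod_same]; exact ⟨hy, hz⟩
  have hAm := Metric.mem_ball_self (x := A) hε
  have hBm := Metric.mem_ball_self (x := B) hε
  have hcs : ∀ α : Fin 2, ∀ w, ContDiffOn ℝ ∞
      (fun z => W.conormal e α.castSucc (G z) (fderiv ℝ G z w)) (Metric.ball (A, B) ε) :=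
    fun α w => ((W.contDiffOn_conormal e _).comp hG hGU).clm_apply (hG'.clm_apply contDiffOn_const)
  -- a linear functional on the plane, its kernel and its nonvanishing
  have perp : ∀ S : (Fin 2 → ℝ) →ₗ[ℝ] ℝ,
      S ![S (Pi.single 1 1), -S (Pi.single 0 1)] = 0 := by
    intro S
    have h : ![S (Pi.single 1 1), -S (Pi.single 0 1)] =
        S (Pi.single 1 1) • Pi.single 0 1 - S (Pi.single 0 1) • Pi.single 1 1 := by
      ext i
      fin_cases i <;> simp
    rw [h, map_sub, map_smul, map_smul, smul_eq_mul, smul_eq_mul, mul_comm, sub_self]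
  have perp_ne : ∀ S : (Fin 2 → ℝ) →ₗ[ℝ] ℝ, S ≠ 0 →
      ![S (Pi.single 1 1), -S (Pi.single 0 1)] ≠ 0 := by
    intro S hS h
    refine hS (LinearMap.pi_ext' fun i => LinearMap.ext_ring ?_)
    have h0 := congrFun h 0
    have h1 := congrFun h 1
    simp only [Matrix.cons_val_zero, Matrix.cons_val_one, Pi.zero_apply, neg_eq_zero] at h0 h1
    fin_cases i
    · simpa using h1
    · simpa using h0
  have hsurj : ∀ z ∈ Metric.ball (A, B) ε, ∀ v, ∃ w, fderiv ℝ G z w = v := by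
    intro z hz v
    refine ⟨fderiv ℝ (fun p => (u₀ p, u₁ p)) (G z) v, ?_⟩
    rw [← sub_eq_zero]
    refine hinj _ (hGz z hz).1 _ ?_
    rw [map_sub, (hGz z hz).2.2, sub_self]
  have hGinj : ∀ z ∈ Metric.ball (A, B) ε, ∀ w, fderiv ℝ G z w = 0 → w = 0 := by
    intro z hz w hw
    rw [← (hGz z hz).2.2 w, hw, map_zero]
  have hcne : ∀ x ∈ U, ∀ α : Fin 2, ∃ v, W.conormal e α.castSucc x v ≠ 0 := by
    intro x hx α
    obtain ⟨v, hv, -⟩ := exists_form_eq hE W hx fun _ => ![e 1, -e 0]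
    refine ⟨v, ?_⟩
    rw [conormal_apply, hv α 0, hv α 1]
    simp only [Matrix.cons_val_zero, Matrix.cons_val_one]
    intro h
    have h0 : e 0 = 0 := by nlinarith [mul_self_nonneg (e 0), mul_self_nonneg (e 1)]
    have h1 : e 1 = 0 := by nlinarith [mul_self_nonneg (e 0), mul_self_nonneg (e 1)]
    rw [h0, h1] at hde
    simp at hde
  -- The conormal form of λ_1 restricted to the slice z = B, viewed as a functional on the leaf
  -- space of λ_1. Rotating its coefficients by a right angle gives the vector field `ζ₀` spanning
  -- its kernel; `S₁` and `ζ₁` play the same role for λ_2.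
  let S₀ : (Fin 2 → ℝ) → (Fin 2 → ℝ) →ₗ[ℝ] ℝ := fun y =>
    ((W.conormal e 0 (G (y, B))).comp ((fderiv ℝ G (y, B)).comp
      (ContinuousLinearMap.inl ℝ (Fin 2 → ℝ) (Fin 2 → ℝ))) : (Fin 2 → ℝ) →L[ℝ] ℝ)
  let S₁ : (Fin 2 → ℝ) → (Fin 2 → ℝ) →ₗ[ℝ] ℝ := fun z =>
    ((W.conormal e 1 (G (A, z))).comp ((fderiv ℝ G (A, z)).comp
      (ContinuousLinearMap.inr ℝ (Fin 2 → ℝ) (Fin 2 → ℝ))) : (Fin 2 → ℝ) →L[ℝ] ℝ)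
  have hS₀ne : ∀ y ∈ Metric.ball A ε, S₀ y ≠ 0 := by
    intro y hy h
    have hz := hmem y hy B hBm
    obtain ⟨v, hv⟩ := hcne _ (hGU hz) 0
    obtain ⟨w, rfl⟩ := hsurj _ hz v
    refine hv ?_
    have h1 : W.conormal e 0 (G (y, B)) (fderiv ℝ G (y, B) (w.1, 0)) = 0 :=
      congrArg (fun S : (Fin 2 → ℝ) →ₗ[ℝ] ℝ => S w.1) h
    have h2 : W.conormal e 0 (G (y, B)) (fderiv ℝ G (y, B) (0, w.2)) = 0 := by
      simp [conormal_apply, hleaf₀ _ hz]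
    have hw : w = (w.1, 0) + (0, w.2) := by simp
    rw [hw, map_add, map_add, Fin.castSucc_zero, h1, h2, add_zero]
  have hS₁ne : ∀ z ∈ Metric.ball B ε, S₁ z ≠ 0 := by
    intro y hy h
    have hz := hmem A hAm y hy
    obtain ⟨v, hv⟩ := hcne _ (hGU hz) 1
    obtain ⟨w, rfl⟩ := hsurj _ hz v
    refine hv ?_
    have h1 : W.conormal e 1 (G (A, y)) (fderiv ℝ G (A, y) (0, w.2)) = 0 :=
      congrArg (fun S : (Fin 2 → ℝ) →ₗ[ℝ] ℝ => S w.2) h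
    have h2 : W.conormal e 1 (G (A, y)) (fderiv ℝ G (A, y) (w.1, 0)) = 0 := by
      simp [conormal_apply, hleaf₁ _ hz]
    have hw : w = (w.1, 0) + (0, w.2) := by simp
    rw [hw, map_add, map_add, Fin.castSucc_one, h1, h2, add_zero]
  let ζ₀ : (Fin 2 → ℝ) → (Fin 2 → ℝ) := fun y =>
    ![S₀ y (Pi.single 1 1), -S₀ y (Pi.single 0 1)]
  let ζ₁ : (Fin 2 → ℝ) → (Fin 2 → ℝ) := fun y =>
    ![S₁ y (Pi.single 1 1), -S₁ y (Pi.single 0 1)]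
  have hζ₀ : ContDiffOn ℝ ∞ ζ₀ (Metric.ball A ε) := by
    have h : ∀ w, ContDiffOn ℝ ∞ (fun y => S₀ y w) (Metric.ball A ε) := fun w =>
      (hcs 0 (w, 0)).comp (f := fun y => (y, B)) (by fun_prop) fun y hy => hmem y hy B hBm
    refine contDiffOn_pi.2 fun i => ?_
    fin_cases i
    · exact h _
    · exact (h _).neg
  have hζ₁ : ContDiffOn ℝ ∞ ζ₁ (Metric.ball B ε) := by
    have h : ∀ w, ContDiffOn ℝ ∞ (fun y => S₁ y w) (Metric.ball B ε) := fun w =>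
      (hcs 1 (0, w)).comp (f := fun y => (A, y)) (by fun_prop) fun y hy => hmem A hAm y hy
    refine contDiffOn_pi.2 fun i => ?_
    fin_cases i
    · exact h _
    · exact (h _).neg
  -- Moving z from B stays in one leaf of λ_1, so the kernel found on the slice remains the kernel
  -- at every z: the line field lives on the leaf space.
  have hcon₀ : ∀ y ∈ Metric.ball A ε, ∀ z ∈ Metric.ball B ε,
      W.conormal e 0 (G (y, z)) (fderiv ℝ G (y, z) (ζ₀ y, 0)) = 0 := by
    intro y hy z hz
    have he : (y, z) = (y, B) + (0, z - B) := by simp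
    rw [he]
    exact conormal_eq_zero_add (α := 0) hU hθ hde hθe Metric.isOpen_ball (convex_ball _ _) hG hGU
      (fun q hq i => hleaf₀ q hq _ i) (hmem y hy B hBm) (he ▸ hmem y hy z hz) (perp (S₀ y))
  have hcon₁ : ∀ y ∈ Metric.ball A ε, ∀ z ∈ Metric.ball B ε,
      W.conormal e 1 (G (y, z)) (fderiv ℝ G (y, z) (0, ζ₁ z)) = 0 := by
    intro y hy z hz
    have he : (y, z) = (A, z) + (y - A, 0) := by simp
    rw [he]
    exact conormal_eq_zero_add (α := 1) hU hθ hde hθe Metric.isOpen_ball (convex_ball _ _) hG hGU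
      (fun q hq i => hleaf₁ q hq _ i) (hmem A hAm z hz) (he ▸ hmem y hy z hz) (perp (S₁ z))
  obtain ⟨δ₀, hδ₀, c₀, hc₀A, hc₀s, hc₀⟩ :=
    exists_contDiffOn_integralCurve Metric.isOpen_ball hζ₀ hAm
  obtain ⟨δ₁, hδ₁, c₁, hc₁B, hc₁s, hc₁⟩ :=
    exists_contDiffOn_integralCurve Metric.isOpen_ball hζ₁ hBm
  let V : Set (EuclideanSpace ℝ (Fin 2)) :=
    {s | s 0 ∈ Set.Ioo (-δ₀) δ₀ ∧ s 1 ∈ Set.Ioo (-δ₁) δ₁}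
  have hVo : IsOpen V :=
    (isOpen_Ioo.preimage (EuclideanSpace.proj (𝕜 := ℝ) (0 : Fin 2)).continuous).inter
      (isOpen_Ioo.preimage (EuclideanSpace.proj (𝕜 := ℝ) (1 : Fin 2)).continuous)
  have hVm : ∀ s ∈ V, (c₀ (s 0), c₁ (s 1)) ∈ Metric.ball (A, B) ε := fun s hs =>
    hmem _ (hc₀ _ hs.1).1 _ (hc₁ _ hs.2).1
  have hder : ∀ s ∈ V, HasFDerivAt (fun s : EuclideanSpace ℝ (Fin 2) => G (c₀ (s 0), c₁ (s 1)))
      ((fderiv ℝ G (c₀ (s 0), c₁ (s 1))).comp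
        (((EuclideanSpace.proj (𝕜 := ℝ) (0 : Fin 2)).smulRight (ζ₀ (c₀ (s 0)))).prod
        ((EuclideanSpace.proj (𝕜 := ℝ) (1 : Fin 2)).smulRight (ζ₁ (c₁ (s 1)))))) s := by
    intro s hs
    have h0 := (hc₀ _ hs.1).2.hasFDerivAt.comp s
      (EuclideanSpace.proj (𝕜 := ℝ) (0 : Fin 2)).hasFDerivAt
    have h1 := (hc₁ _ hs.2).2.hasFDerivAt.comp s
      (EuclideanSpace.proj (𝕜 := ℝ) (1 : Fin 2)).hasFDerivAt
    exact (hGd _ (hVm s hs)).hasFDerivAt.comp s (h0.prodMk h1)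
  refine ⟨V, fun s => G (c₀ (s 0), c₁ (s 1)), ⟨hVo, fun s hs => hGU (hVm s hs), ?_, ?_⟩,
    0, ⟨⟨?_, ?_⟩, ?_⟩, ?_⟩
  · refine hG.comp (ContDiffOn.prodMk (hc₀s.comp ?_ fun s hs => hs.1)
      (hc₁s.comp ?_ fun s hs => hs.2)) hVm
    · exact (EuclideanSpace.proj (𝕜 := ℝ) (0 : Fin 2)).contDiff.contDiffOn
    · exact (EuclideanSpace.proj (𝕜 := ℝ) (1 : Fin 2)).contDiff.contDiffOn
  · intro s hs
    have hz := hVm s hs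
    have happ : ∀ v, fderiv ℝ (fun s : EuclideanSpace ℝ (Fin 2) => G (c₀ (s 0), c₁ (s 1))) s v =
        fderiv ℝ G (c₀ (s 0), c₁ (s 1)) (v 0 • ζ₀ (c₀ (s 0)), v 1 • ζ₁ (c₁ (s 1))) := by
      intro v
      rw [(hder s hs).fderiv]
      rfl
    refine range_eq_and_finrank_eq (W := W) hE hde (hGU hz) (hD _ (hGU hz)) (by simp) ?_ ?_
    · intro v hv
      have hv' := hGinj _ hz _ ((happ v).symm.trans hv)
      have h0 := (smul_eq_zero.1 (congrArg Prod.fst hv')).resolve_right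
        (perp_ne _ (hS₀ne _ (hc₀ _ hs.1).1))
      have h1 := (smul_eq_zero.1 (congrArg Prod.snd hv')).resolve_right
        (perp_ne _ (hS₁ne _ (hc₁ _ hs.2).1))
      ext i
      fin_cases i
      · exact h0
      · exact h1
    · intro v α
      have hdec : (v 0 • ζ₀ (c₀ (s 0)), v 1 • ζ₁ (c₁ (s 1))) =
          v 0 • (ζ₀ (c₀ (s 0)), (0 : Fin 2 → ℝ)) + v 1 • ((0 : Fin 2 → ℝ), ζ₁ (c₁ (s 1))) := by
        simp
      have hv := happ v
      rw [hdec, map_add, map_smul, map_smul] at hv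
      change W.conormal e α.castSucc (G (c₀ (s 0), c₁ (s 1)))
        (fderiv ℝ (fun s : EuclideanSpace ℝ (Fin 2) => G (c₀ (s 0), c₁ (s 1))) s v) = 0
      rw [hv, map_add, map_smul, map_smul]
      fin_cases α
      · have h1 := hcon₀ _ (hc₀ _ hs.1).1 _ (hc₁ _ hs.2).1
        have h2 : W.conormal e 0 (G (c₀ (s 0), c₁ (s 1)))
            (fderiv ℝ G (c₀ (s 0), c₁ (s 1)) (0, ζ₁ (c₁ (s 1)))) = 0 := by
          simp [conormal_apply, hleaf₀ _ hz]
        simp [h1, h2]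
      · have h1 := hcon₁ _ (hc₀ _ hs.1).1 _ (hc₁ _ hs.2).1
        have h2 : W.conormal e 1 (G (c₀ (s 0), c₁ (s 1)))
            (fderiv ℝ G (c₀ (s 0), c₁ (s 1)) (ζ₀ (c₀ (s 0)), 0)) = 0 := by
          simp [conormal_apply, hleaf₁ _ hz]
        simp [h1, h2]
  · simpa using hδ₀
  · simpa using hδ₀
  · simpa using hδ₁
  · simpa [hc₀A, hc₁B] using hGx

end ThreeWeb

/-! ### Hexagonality and the cubic form of the curvature -/

namespace ThreeWeb

variable {E : Type*} [NormedAddCommGroup E] [NormedSpace ℝ E] {U : Set E}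
  {W : ThreeWeb U} {θ : Fin 2 → Fin 2 → OneForm E} {a : Fin 2 → E → ℝ}
  {b : Fin 2 → Fin 2 → Fin 2 → Fin 2 → E → ℝ} {d e : Fin 2 → ℝ}

theorem conormal_fderiv_eq_zero {D : E → Submodule ℝ E}
    (hD : ∀ x ∈ U, ∀ v, v ∈ D x ↔ ∀ α : Fin 2, W.conormal e α.castSucc x v = 0)
    {V : Set (EuclideanSpace ℝ (Fin 2))} {φ : EuclideanSpace ℝ (Fin 2) → E}
    (hφ : IsIntegralSurface U D V φ) {s : EuclideanSpace ℝ (Fin 2)} (hs : s ∈ V)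
    (w : EuclideanSpace ℝ (Fin 2)) (α : Fin 2) :
    W.conormal e α.castSucc (φ s) (fderiv ℝ φ s w) = 0 := by
  refine (hD _ (hφ.mapsTo hs) _).1 ?_ α
  rw [← (hφ.tangent s hs).1]
  exact ⟨w, rfl⟩

theorem _root_.IsIntegralSurface.eq_zero_of_fderiv_eq_zero {D : E → Submodule ℝ E}
    {V : Set (EuclideanSpace ℝ (Fin 2))} {φ : EuclideanSpace ℝ (Fin 2) → E}
    (hφ : IsIntegralSurface U D V φ) {s : EuclideanSpace ℝ (Fin 2)} (hs : s ∈ V)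
    {v : EuclideanSpace ℝ (Fin 2)} (hv : fderiv ℝ φ s v = 0) : v = 0 := by
  obtain ⟨h1, h2⟩ := hφ.tangent s hs
  have hsum := LinearMap.finrank_range_add_finrank_ker
    (fderiv ℝ φ s : EuclideanSpace ℝ (Fin 2) →ₗ[ℝ] E)
  rw [h1, h2, finrank_euclideanSpace_fin] at hsum
  have hker : LinearMap.ker (fderiv ℝ φ s : EuclideanSpace ℝ (Fin 2) →ₗ[ℝ] E) = ⊥ :=
    Submodule.finrank_eq_zero.1 (by omega)
  have : v ∈ LinearMap.ker (fderiv ℝ φ s : EuclideanSpace ℝ (Fin 2) →ₗ[ℝ] E) := hv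
  rwa [hker, Submodule.mem_bot] at this

/-- The foliations of a web cut a planar three-web on the integral surfaces of a transversal
distribution. -/
theorem isPlanarThreeWeb_comp (hE : Module.finrank ℝ E = 4) (hde : d 0 * e 0 + d 1 * e 1 = 1)
    {D : E → Submodule ℝ E}
    (hD : ∀ x ∈ U, ∀ v, v ∈ D x ↔ ∀ α : Fin 2, W.conormal e α.castSucc x v = 0)
    {V : Set (EuclideanSpace ℝ (Fin 2))} {φ : EuclideanSpace ℝ (Fin 2) → E}
    (hφ : IsIntegralSurface U D V φ) {O : Set E} (hO : IsOpen O)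
    {u : Fin 3 → E → Fin 2 → ℝ} (hu : ∀ ξ, IsFirstIntegral (W.form ξ) O (u ξ))
    {N : Set (EuclideanSpace ℝ (Fin 2))} (hNV : N ⊆ V) (hφO : Set.MapsTo φ N O) :
    IsPlanarThreeWeb (fun ξ => u ξ ∘ φ) N := by
  refine ⟨fun ξ => (hu ξ).1.comp (hφ.smooth.mono hNV) hφO, fun s hs => ?_⟩
  have hsU := hφ.mapsTo (hNV hs)
  have hker : ∀ ξ v, fderiv ℝ (u ξ ∘ φ) s v = 0 ↔
      ∀ i, W.form ξ i (φ s) (fderiv ℝ φ s v) = 0 := by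
    intro ξ v
    have h : HasFDerivAt (u ξ ∘ φ) _ s :=
      (((hu ξ).1.contDiffAt (hO.mem_nhds (hφO hs))).differentiableAt
        (by simp)).hasFDerivAt.comp s ((hφ.smooth.contDiffAt
        (hφ.isOpen.mem_nhds (hNV hs))).differentiableAt (by simp)).hasFDerivAt
    rw [h.fderiv, ContinuousLinearMap.comp_apply, (hu ξ).2 _ (hφO hs)]
  have htr : ∀ ξ ζ, ζ ≠ ξ → ∀ v, fderiv ℝ (u ξ ∘ φ) s v = 0 → fderiv ℝ (u ζ ∘ φ) s v = 0 →
      v = 0 := by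
    intro ξ ζ hne v h1 h2
    rw [hker] at h1 h2
    refine hφ.eq_zero_of_fderiv_eq_zero (hNV hs) (eq_zero_of_form_eq_zero hE W hsU ?_)
    have h3 := fun i => form_two_apply W hsU i (fderiv ℝ φ s v)
    intro α i
    specialize h1 i
    specialize h2 i
    specialize h3 i
    fin_cases ξ <;> fin_cases ζ <;> fin_cases α <;> simp at h1 h2 hne ⊢ <;> linarith
  refine fun ξ => ⟨?_, fun ζ hζ => htr ξ ζ hζ⟩
  let h : Fin 3 → Module.Dual ℝ (EuclideanSpace ℝ (Fin 2)) := fun ξ =>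
    ((W.tangential d ξ (φ s)).comp (fderiv ℝ φ s) : EuclideanSpace ℝ (Fin 2) →L[ℝ] ℝ)
  have hh : ∀ ξ, LinearMap.ker
      (fderiv ℝ (u ξ ∘ φ) s : EuclideanSpace ℝ (Fin 2) →ₗ[ℝ] (Fin 2 → ℝ)) =
      LinearMap.ker (h ξ) := by
    intro ξ
    ext v
    exact (hker ξ v).trans (form_eq_zero_iff hde hsU
      (conormal_fderiv_eq_zero hD hφ (hNV hs) v) ξ)
  -- If σ_ξ vanished on the tangent plane, every direction of another family would also be a
  -- direction of family ξ, against transversality.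
  have hne : h ξ ≠ 0 := by
    intro h0
    obtain ⟨ζ, hζ⟩ := exists_ne ξ
    have hbot : LinearMap.ker (h ζ) ≠ ⊥ :=
      LinearMap.ker_ne_bot_of_finrank_lt (by simp)
    obtain ⟨v, hv, hv0⟩ := Submodule.exists_mem_ne_zero_of_ne_bot hbot
    have h1 : v ∈ LinearMap.ker (h ξ) := by simp [h0]
    rw [← hh] at h1 hv
    exact hv0 (htr ξ ζ hζ v h1 hv)
  have := Module.Dual.finrank_ker_add_one_of_ne_zero hne
  rw [← hh, finrank_euclideanSpace_fin] at this
  change Module.finrank ℝ (LinearMap.ker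
      (fderiv ℝ (u ξ ∘ φ) s : EuclideanSpace ℝ (Fin 2) →ₗ[ℝ] (Fin 2 → ℝ))) = 1
  omega

/-- A vanishing cubic makes L_xy vanish in web coordinates around each point; the planar criterion
then closes the hexagons, and the coordinate map carries them to the surface. -/
theorem cutsHexagonalWeb_of_cubic_eq_zero (hE : Module.finrank ℝ E = 4) (hU : IsOpen U)
    (hθ : W.IsConnection θ a) (hb : W.IsCurvature θ b) (hde : d 0 * e 0 + d 1 * e 1 = 1)
    (hθe : ∀ x ∈ U, ∀ v, e 0 * (e 1 * θ 0 0 x v - e 0 * θ 0 1 x v) +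
      e 1 * (e 1 * θ 1 0 x v - e 0 * θ 1 1 x v) = 0) {D : E → Submodule ℝ E}
    (hD : ∀ x ∈ U, ∀ v, v ∈ D x ↔ ∀ α : Fin 2, W.conormal e α.castSucc x v = 0)
    (hcub : ∀ x ∈ U, ∀ i, cubic b e i x = 0)
    {V : Set (EuclideanSpace ℝ (Fin 2))} {φ : EuclideanSpace ℝ (Fin 2) → E}
    (hφ : IsIntegralSurface U D V φ) : W.CutsHexagonalWeb V φ := by
  intro s hs
  choose N hNo hsN hNU u hu using fun ξ => W.foliation ξ (φ s) (hφ.mapsTo hs)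
  set O : Set E := ⋂ ξ, N ξ with hO
  have hOo : IsOpen O := isOpen_iInter_of_finite hNo
  have hON : ∀ ξ, O ⊆ N ξ := fun ξ => Set.iInter_subset N ξ
  have hOU : O ⊆ U := (hON 0).trans (hNU 0)
  have huO : ∀ ξ, IsFirstIntegral (W.form ξ) O (u ξ) := fun ξ =>
    ⟨(hu ξ).1.mono (hON ξ), fun x hx => (hu ξ).2 x (hON ξ hx)⟩
  set V' := V ∩ φ ⁻¹' O with hV'
  have hV'o : IsOpen V' := hφ.smooth.continuousOn.isOpen_inter_preimage hφ.isOpen hOo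
  have hsV' : s ∈ V' := ⟨hs, Set.mem_iInter.2 hsN⟩
  obtain ⟨ε, hε, G, f, hGV, hG0, hGo, hlev, hfs, hfne, hcurv⟩ := exists_web_coordinates hE hU hθ hb
    hde hθe finrank_euclideanSpace_fin hV'o (hφ.smooth.mono Set.inter_subset_left) hOo hOU
    (fun p hp => hp.2) (fun p hp => conormal_fderiv_eq_zero hD hφ hp.1)
    (fun p hp v hv => hφ.eq_zero_of_fderiv_eq_zero hp.1 hv) huO hsV'
  obtain ⟨Q, hQo, h0Q, hQ, hex⟩ := exists_isOpen_hexagonsClose hε hfs (fun z hz => (hfne z hz).1)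
    (fun z hz => (hfne z hz).2) (fun z hz => by
      obtain ⟨κ, -, h⟩ := hcurv z hz
      have hzU := hOU (hGV hz).2
      rw [h, hcub _ hzU, hcub _ hzU]
      ring)
  have hsub : G '' Q ⊆ V' := by
    rintro _ ⟨z, hz, rfl⟩
    exact hGV (hQ hz)
  refine ⟨G '' Q, O, u, hGo Q hQ hQo, ⟨0, h0Q, hG0⟩, hsub.trans Set.inter_subset_left, hOo, hOU,
    fun p hp => (hsub hp).2, huO, ?_, ?_⟩
  · exact isPlanarThreeWeb_comp hE hde hD hφ hOo huO (hsub.trans Set.inter_subset_left)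
      fun p hp => (hsub hp).2
  · exact hex.image fun ξ z hz w hw => hlev ξ z (hQ hz) w (hQ hw)

/-- By continuity, curvature that is nonzero at a point keeps its sign on a small ball in web
coordinates, where some hexagon then fails to close. Only the component K along `e` is detected in
this way; `cubic_eq` extends the conclusion to both components. -/
theorem cubic_eq_zero_of_cutsHexagonalWeb (hE : Module.finrank ℝ E = 4) (hU : IsOpen U)
    (hθ : W.IsConnection θ a) (hb : W.IsCurvature θ b) (hde : d 0 * e 0 + d 1 * e 1 = 1)
    (hθe : ∀ x ∈ U, ∀ v, e 0 * (e 1 * θ 0 0 x v - e 0 * θ 0 1 x v) +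
      e 1 * (e 1 * θ 1 0 x v - e 0 * θ 1 1 x v) = 0) {D : E → Submodule ℝ E}
    (hD : ∀ x ∈ U, ∀ v, v ∈ D x ↔ ∀ α : Fin 2, W.conormal e α.castSucc x v = 0)
    {V : Set (EuclideanSpace ℝ (Fin 2))} {φ : EuclideanSpace ℝ (Fin 2) → E}
    (hφ : IsIntegralSurface U D V φ) (hW : W.CutsHexagonalWeb V φ)
    {s : EuclideanSpace ℝ (Fin 2)} (hs : s ∈ V) (i : Fin 2) : cubic b e i (φ s) = 0 := by
  rw [cubic_eq hE hU hθ hb hde hθe (hφ.mapsTo hs)]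
  obtain ⟨N, O, u, hNo, hsN, hNV, hOo, hOU, hφO, hu, -, hex⟩ := hW s hs
  obtain ⟨ε, hε, G, f, hGN, hG0, hGo, hlev, hfs, hfne, hcurv⟩ := exists_web_coordinates hE hU hθ hb
    hde hθe finrank_euclideanSpace_fin hNo (hφ.smooth.mono hNV) hOo hOU hφO
    (fun p hp => conormal_fderiv_eq_zero hD hφ (hNV hp))
    (fun p hp v hv => hφ.eq_zero_of_fderiv_eq_zero (hNV hp) hv) hu hsN
  have hexQ : HexagonsClose (X := ℝ × ℝ) (Y := ℝ) ![Prod.fst, Prod.snd, f] (Metric.ball 0 ε) :=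
    hex.comap hGN hlev
  have h0 : (0 : ℝ × ℝ) ∈ Metric.ball (0 : ℝ × ℝ) ε := Metric.mem_ball_self hε
  by_contra hne
  set L : ℝ × ℝ → ℝ := fun z => fderiv ℝ (fun z => fderiv ℝ (fun z =>
    Real.log (fderiv ℝ f z (1, 0)) - Real.log (fderiv ℝ f z (0, 1))) z (1, 0)) z (0, 1) with hL
  have hL0 : L 0 ≠ 0 := by
    obtain ⟨κ, hκ, h⟩ := hcurv 0 h0
    rw [hG0] at h
    exact fun h' => mul_ne_zero hκ (right_ne_zero_of_mul hne) (h.symm.trans h')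
  have hLc : ContinuousAt L 0 := by
    have smooth : ∀ {g : ℝ × ℝ → ℝ}, ContDiffOn ℝ ∞ g (Metric.ball 0 ε) → ∀ w,
        ContDiffOn ℝ ∞ (fun z => fderiv ℝ g z w) (Metric.ball 0 ε) := fun hg w =>
      (((contDiffOn_infty_iff_fderiv_of_isOpen Metric.isOpen_ball).1 hg).2).clm_apply
        contDiffOn_const
    exact (smooth (smooth (((smooth hfs _).log fun z hz => (hfne z hz).1).sub
      ((smooth hfs _).log fun z hz => (hfne z hz).2)) _) _).continuousOn.continuousAt
      (Metric.isOpen_ball.mem_nhds h0)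
  -- The value `L 0` itself serves as the sign constant κ.
  obtain ⟨r, hr, hball⟩ := Metric.eventually_nhds_iff_ball.1
    (((continuousAt_const.mul hLc).eventually (lt_mem_nhds (show 0 < L 0 * L 0 from
      mul_self_pos.2 hL0))).and (Metric.isOpen_ball.eventually_mem h0))
  have hsub : Metric.ball (0 : ℝ × ℝ) r ⊆ Metric.ball 0 ε := fun z hz => (hball z hz).2
  exact not_hexagonsClose_of_curvature hr (hfs.mono hsub) (fun z hz => (hfne z (hsub hz)).1)
    (fun z hz => (hfne z (hsub hz)).2) (fun z hz => (hball z hz).1) (hexQ.mono hsub)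

/-- If the transversal distribution `ω_α ∥ e` is parallel with respect to the connection, then it is
integrable, and the web is foliated into hexagonal webs on its integral surfaces if and only if the
cubic `b^i_{jkl} e^j e^k e^l` vanishes. -/
theorem integrable_and_foliated_iff (hE : Module.finrank ℝ E = 4) (hU : IsOpen U)
    (hθ : W.IsConnection θ a) (hb : W.IsCurvature θ b) (hde : d 0 * e 0 + d 1 * e 1 = 1)
    (hθe : ∀ x ∈ U, ∀ v, e 0 * (e 1 * θ 0 0 x v - e 0 * θ 0 1 x v) +
      e 1 * (e 1 * θ 1 0 x v - e 0 * θ 1 1 x v) = 0) {D : E → Submodule ℝ E}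
    (hDe : ∀ x ∈ U, D x = W.transversal ![e 1, -e 0] x) :
    IsIntegrableDistribution U D ∧
      (W.FoliatedIntoHexagonalWebs D ↔ ∀ x ∈ U, ∀ i, cubic b e i x = 0) := by
  have hD : ∀ x ∈ U, ∀ v, v ∈ D x ↔ ∀ α : Fin 2, W.conormal e α.castSucc x v = 0 := by
    intro x hx v
    rw [hDe x hx, transversal, Submodule.mem_iInf]
    rfl
  have hint := isIntegrableDistribution hE hU hθ hde hθe hD
  refine ⟨hint, fun h x hx i => ?_, fun h => ⟨hint, fun V φ hφ =>
    cutsHexagonalWeb_of_cubic_eq_zero hE hU hθ hb hde hθe hD h hφ⟩⟩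
  obtain ⟨V, φ, hφ, s, hs, rfl⟩ := hint x hx
  exact cubic_eq_zero_of_cutsHexagonalWeb hE hU hθ hb hde hθe hD hφ (h.2 V φ hφ) hs i

/-- Proportional covectors define the same transversal distribution. -/
theorem transversal_eq_of_smul (W : ThreeWeb U) {c c' : Fin 2 → ℝ} {r : ℝ} (hr : r ≠ 0)
    (h : c = r • c') (x : E) : W.transversal c x = W.transversal c' x := by
  refine iInf_congr fun α => ?_
  ext v
  subst h
  simp only [LinearMap.mem_ker, ContinuousLinearMap.coe_coe, Fin.sum_univ_two, Pi.smul_apply,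
    smul_eq_mul, add_apply, smul_apply]
  rw [mul_assoc, mul_assoc, ← mul_add, mul_eq_zero, or_iff_right hr]

end ThreeWeb

/-! ### The three special directions -/

theorem corollary4 {E : Type*} [NormedAddCommGroup E] [NormedSpace ℝ E]
    (hE : Module.finrank ℝ E = 4) {U : Set E} (hU : IsOpen U) (W : ThreeWeb U)
    (θ : Fin 2 → Fin 2 → OneForm E) (a : Fin 2 → E → ℝ) (hθ : W.IsConnection θ a)
    (b : Fin 2 → Fin 2 → Fin 2 → Fin 2 → E → ℝ) (hb : W.IsCurvature θ b)
    (ha : ∀ x ∈ U, ∃ j, a j x ≠ 0) :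
    -- the case `a_2 = 0`, `ω_2^1 = 0`
    ((∀ x ∈ U, a 1 x = 0 ∧ θ 1 0 x = 0) →
      (∀ x ∈ U, W.aDistribution a x = W.transversal ![1, 0] x) ∧
      IsIntegrableDistribution U (W.aDistribution a) ∧
      (W.FoliatedIntoHexagonalWebs (W.aDistribution a) ↔
        ∀ x ∈ U, b 0 1 1 1 x = 0 ∧ b 1 1 1 1 x = 0)) ∧
    -- the case `a_1 = 0`, `ω_1^2 = 0`
    ((∀ x ∈ U, a 0 x = 0 ∧ θ 0 1 x = 0) →
      (∀ x ∈ U, W.aDistribution a x = W.transversal ![0, 1] x) ∧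
      IsIntegrableDistribution U (W.aDistribution a) ∧
      (W.FoliatedIntoHexagonalWebs (W.aDistribution a) ↔
        ∀ x ∈ U, b 0 0 0 0 x = 0 ∧ b 1 0 0 0 x = 0)) ∧
    -- the case `a_1 = a_2`, `ω_1^1 + ω_1^2 = ω_2^1 + ω_2^2`
    ((∀ x ∈ U, a 0 x = a 1 x ∧ θ 0 0 x + θ 0 1 x = θ 1 0 x + θ 1 1 x) →
      (∀ x ∈ U, W.aDistribution a x = W.transversal ![1, 1] x) ∧
      IsIntegrableDistribution U (W.aDistribution a) ∧
      (W.FoliatedIntoHexagonalWebs (W.aDistribution a) ↔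
        ∀ x ∈ U, ∀ i : Fin 2,
          -b i 0 0 0 x + 3 * (symLower b i 0 0 1 x - symLower b i 0 1 1 x) + b i 1 1 1 x = 0)) := by
  refine ⟨fun h => ?_, fun h => ?_, fun h => ?_⟩
  · have hD : ∀ x ∈ U, W.aDistribution a x = W.transversal ![1, 0] x := by
      intro x hx
      obtain ⟨h1, -⟩ := h x hx
      have h0 : a 0 x ≠ 0 := by
        obtain ⟨j, hj⟩ := ha x hx
        fin_cases j
        · exact hj
        · exact absurd h1 hj
      refine W.transversal_eq_of_smul h0 ?_ x
      ext j
      fin_cases j <;> simp [h1]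
    -- In each case `e` spans the solutions of the equation of Δ, with its sign chosen so that (e^2,
    -- -e^1) is exactly the covector displayed in the statement.
    obtain ⟨hint, hiff⟩ := ThreeWeb.integrable_and_foliated_iff (d := ![0, 1]) (e := ![0, 1]) hE hU
      hθ hb (by simp) (fun x hx v => by simp [(h x hx).2]) (D := W.aDistribution a)
      (fun x hx => by simpa using hD x hx)
    refine ⟨hD, hint, hiff.trans (forall₂_congr fun x _ => ?_)⟩
    simp [ThreeWeb.cubic, Fin.forall_fin_two]
  · have hD : ∀ x ∈ U, W.aDistribution a x = W.transversal ![0, 1] x := by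
      intro x hx
      obtain ⟨h1, -⟩ := h x hx
      have h0 : a 1 x ≠ 0 := by
        obtain ⟨j, hj⟩ := ha x hx
        fin_cases j
        · exact absurd h1 hj
        · exact hj
      refine W.transversal_eq_of_smul h0 ?_ x
      ext j
      fin_cases j <;> simp [h1]
    obtain ⟨hint, hiff⟩ := ThreeWeb.integrable_and_foliated_iff (d := ![-1, 0]) (e := ![-1, 0]) hE
      hU hθ hb (by simp) (fun x hx v => by simp [(h x hx).2]) (D := W.aDistribution a)
      (fun x hx => by simpa using hD x hx)
    refine ⟨hD, hint, hiff.trans (forall₂_congr fun x _ => ?_)⟩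
    simp [ThreeWeb.cubic, Fin.forall_fin_two]
  · have hD : ∀ x ∈ U, W.aDistribution a x = W.transversal ![1, 1] x := by
      intro x hx
      obtain ⟨h1, -⟩ := h x hx
      have h0 : a 0 x ≠ 0 := by
        obtain ⟨j, hj⟩ := ha x hx
        fin_cases j
        · exact hj
        · rw [h1]; exact hj
      refine W.transversal_eq_of_smul h0 ?_ x
      ext j
      fin_cases j <;> simp [h1]
    obtain ⟨hint, hiff⟩ := ThreeWeb.integrable_and_foliated_iff (d := ![0, 1]) (e := ![-1, 1]) hE hU
      hθ hb (by simp) (fun x hx v => by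
        have := congrArg (fun A : E →L[ℝ] ℝ => A v) (h x hx).2
        simp only [add_apply] at this
        simp only [Matrix.cons_val_zero, Matrix.cons_val_one]
        linarith) (D := W.aDistribution a)
      (fun x hx => by simpa using hD x hx)
    refine ⟨hD, hint, hiff.trans (forall₂_congr fun x _ => forall_congr' fun i => ?_)⟩
    -- At (-1, 1) the cubic has eight signed terms; those with the same number of indices equal to 2
    -- combine into three times a symmetrized component.
    have : ThreeWeb.cubic b ![-1, 1] i x = -b i 0 0 0 x +
        3 * (symLower b i 0 0 1 x - symLower b i 0 1 1 x) + b i 1 1 1 x := by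
      simp only [ThreeWeb.cubic, symLower, Fin.sum_univ_two, Matrix.cons_val_zero,
        Matrix.cons_val_one]
      ring
    rw [this]
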